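/- Fix an infinite supply of letters; an alphabet $V$ is a finite set of letters, $\lambda$ is the empty word. A language $L\subseteq V^*$ is, with respect to $V$: *monoidal* if $L=V^*$; *nilpotent* if $L$ or $V^*\setminus L$ is finite; *combinational* if $L=V^*X$ with $X\subseteq V$; *definite* if $L=A\cup V^*B$ with finite $A,B\subseteq V^*$; *suffix-closed* if $xy\in L$ implies $y\in L$ for all $x,y\in V^*$; *ordered* if it is accepted by a deterministic finite automaton with input alphabet $V$ and a total order $\preceq$ on its states such that $z\preceq z'$ implies $\delta(z,a)\preceq\delta(z',a)$ for all $a\in V$; *commutative* (*circular*) if it contains with each word all its permutations (all its circular shifts); *non-counting* if there is $k\ge1$ with $xy^kz\in L\iff xy^{k+1}z\in L$ for all $x,y,z\in V^*$; *power-separating* if there is $m\ge1$ such that for every $x\in V^*$ the set $\{x^n: n\ge m\}$ is either disjoint from $L$ or contained in $L$; *union-free* if it is described by a regular expression built from $\emptyset$, $\lambda$ and letters by product and star only; *strictly locally $k$-testable* if there are $B,I,E\subseteq V^k$ such that every word $a_1\cdots a_n$ over $V$ with $n\ge k$ belongs to $L$ if and only if $a_1\cdots a_k\in B$, $a_{j+1}\cdots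 a_{j+k}\in I$ for $1\le j\le n-k-1$, and $a_{n-k+1}\cdots a_n\in E$ (words shorter than $k$ are unrestricted); *strictly locally testable* if this holds for some $k\ge1$. Let $\mathit{FIN},\mathit{MON},\mathit{NIL},\mathit{COMB},\mathit{DEF},\mathit{SUF},\mathit{ORD},\mathit{COMM},\mathit{CIRC},\mathit{NC},\mathit{PS},\mathit{UF},\mathit{SLT}_k\ (k\ge1),\mathit{SLT},\mathit{REG}$ be the families of all finite, monoidal, nilpotent, combinational, definite, regular suffix-closed, ordered, regular commutative, regular circular, regular non-counting, regular power-separating, union-free, strictly locally $k$-testable, strictly locally testable, and regular languages. A contextual grammar with selection in a family $F$ is a triple $G=(V,\mathcal P,A)$ with an alphabet $V$, a finite set $\mathcal P$ of pairs $(S,C)$, where $S$ is a language over some $U\subseteq V$ that belongs to $F$ with respect to $U$ and $C\subset V^*\times V^*$ is finite, and a finite set $A\subset V^*$. A word $x$ derives $y$ externally if there are $(S,C)\in\mathcal P$ and $(u,v)\in C$ with $x\in S$ and $y=uxv$. The language externally generated by $G$ is the set of all words derived from words of $A$ in zero or more steps, and $\mathcal{EC}(F)$ is the family of all languages externally generated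 by contextual grammars with selection in $F$. **Theorem.** 1. The following proper inclusions hold (solid arrows): $\mathcal{EC}(X)\subset\mathcal{EC}(Y)$ for $(X,Y)$ one of $(\mathit{FIN},\mathit{MON})$, $(\mathit{MON},\mathit{COMB})$, $(\mathit{MON},\mathit{NIL})$, $(\mathit{MON},\mathit{SUF})$, $(\mathit{NIL},\mathit{DEF})$, $(\mathit{NIL},\mathit{COMM})$, $(\mathit{COMB},\mathit{DEF})$, $(\mathit{COMB},\mathit{SLT}_1)$, $(\mathit{SLT}_k,\mathit{SLT}_{k+1})$ and $(\mathit{SLT}_k,\mathit{SLT})$ for $k\ge1$, $(\mathit{SLT}_1,\mathit{ORD})$, $(\mathit{DEF},\mathit{ORD})$, $(\mathit{DEF},\mathit{SLT})$, $(\mathit{SLT},\mathit{NC})$, $(\mathit{NC},\mathit{PS})$, $(\mathit{SUF},\mathit{PS})$, $(\mathit{PS},\mathit{REG})$, $(\mathit{COMM},\mathit{CIRC})$, $(\mathit{CIRC},\mathit{REG})$. 2. $\mathcal{EC}(\mathit{ORD})\subseteq\mathcal{EC}(\mathit{NC})$ (dashed arrow; properness is not claimed). 3. $\mathcal{EC}(\mathit{REG})=\mathcal{EC}(\mathit{UF})$.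 4. Let $X,Y$ be two of the above families other than $\mathit{UF}$ such that, in the directed graph formed by the arrows in 1 and 2, there is no directed path from $X$ to $Y$ or from $Y$ to $X$. If $\{X,Y\}$ is neither $\{\mathit{ORD},\mathit{SLT}\}$ nor $\{\mathit{ORD},\mathit{SLT}_k\}$ for some $k\ge2$, then $\mathcal{EC}(X)$ and $\mathcal{EC}(Y)$ are incomparable, i.e. neither is contained in the other. 5. $\mathcal{EC}(\mathit{ORD})\not\subseteq\mathcal{EC}(\mathit{SLT})$, and $\mathcal{EC}(\mathit{ORD})\not\subseteq\mathcal{EC}(\mathit{SLT}_k)$ for all $k\ge2$. -/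

import Mathlib

namespace ExtCG

/-! Letters are drawn from a type `T`; an alphabet is a finite subset `V : Finset T`, a word is a
`List T`, and a language is a `Language T` (a set of words). -/

/-- The language `V*` of all words over the alphabet `V`. -/
def wordsOver {T : Type*} (V : Finset T) : Language T := {w | ∀ a ∈ w, a ∈ V}

/-- The power `y ^ n` of a word `y`. -/
def wordPow {T : Type*} (y : List T) (n : ℕ) : List T := (List.replicate n y).flatten

/-! ### Properties of a language `L ⊆ V*` with respect to the alphabet `V` -/

/-- `L = V*`. -/
def IsMonoidal {T : Type*} (V : Finset T) (L : Language T) : Prop := L = wordsOver V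

/-- `L` or its complement `V* \ L` is finite. -/
def IsNilpotent {T : Type*} (V : Finset T) (L : Language T) : Prop :=
  {w : List T | w ∈ L}.Finite ∨ {w : List T | w ∈ wordsOver V ∧ w ∉ L}.Finite

/-- `L = V* X` for some subset `X` of `V`. -/
def IsCombinational {T : Type*} (V : Finset T) (L : Language T) : Prop :=
  ∃ X : Finset T, X ⊆ V ∧ ∀ w : List T, w ∈ L ↔ ∃ x ∈ wordsOver V, ∃ a ∈ X, w = x ++ [a]

/-- `L = A ∪ V* B` for finite subsets `A`, `B` of `V*`. -/
def IsDefinite {T : Type*} (V : Finset T) (L : Language T) : Prop :=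
  ∃ A B : Finset (List T), (∀ w ∈ A, w ∈ wordsOver V) ∧ (∀ w ∈ B, w ∈ wordsOver V) ∧
    ∀ w : List T, w ∈ L ↔ w ∈ A ∨ ∃ x ∈ wordsOver V, ∃ b ∈ B, w = x ++ b

/-- Every suffix of a word of `L` belongs to `L`. -/
def IsSuffixClosed {T : Type*} (V : Finset T) (L : Language T) : Prop :=
  ∀ x ∈ wordsOver V, ∀ y ∈ wordsOver V, x ++ y ∈ L → y ∈ L

/-- `L` is accepted by a deterministic finite automaton with input alphabet `V` whose state set
carries a total order that is preserved by every letter of `V`. (Mathlib's `DFA T Z` also has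
transitions for letters outside of `V`; these play no role.) -/
def IsOrdered {T : Type*} (V : Finset T) (L : Language T) : Prop :=
  ∃ (Z : Type) (_ : Fintype Z) (_ : LinearOrder Z) (M : DFA T Z),
    (∀ a ∈ V, Monotone fun z : Z => M.step z a) ∧
    ∀ w : List T, w ∈ L ↔ w ∈ wordsOver V ∧ w ∈ M.accepts

/-- `L` contains with each word all permutations of this word. -/
def IsCommutative {T : Type*} (L : Language T) : Prop :=
  ∀ v w : List T, v.Perm w → v ∈ L → w ∈ L

/-- `L` contains with each word all circular shifts of this word. -/
def IsCircular {T : Type*} (L : Language T) : Prop :=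
  ∀ x y : List T, x ++ y ∈ L → y ++ x ∈ L

/-- There is `k ≥ 1` such that `x y^k z ∈ L` if and only if `x y^(k+1) z ∈ L`. -/
def IsNonCounting {T : Type*} (V : Finset T) (L : Language T) : Prop :=
  ∃ k : ℕ, 1 ≤ k ∧ ∀ x ∈ wordsOver V, ∀ y ∈ wordsOver V, ∀ z ∈ wordsOver V,
    (x ++ wordPow y k ++ z ∈ L ↔ x ++ wordPow y (k + 1) ++ z ∈ L)

/-- There is `m ≥ 1` such that, for each word `x`, the set `{x^n | n ≥ m}` is disjoint from `L`
or contained in `L`. -/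
def IsPowerSeparating {T : Type*} (V : Finset T) (L : Language T) : Prop :=
  ∃ m : ℕ, 1 ≤ m ∧ ∀ x ∈ wordsOver V,
    (∀ n, m ≤ n → wordPow x n ∉ L) ∨ (∀ n, m ≤ n → wordPow x n ∈ L)

/-- Regular expressions over `V` built from `∅`, `λ` and letters by product and star only. -/
inductive UnionFreeExpr {T : Type*} (V : Finset T) : RegularExpression T → Prop
  | zero : UnionFreeExpr V RegularExpression.zero
  | epsilon : UnionFreeExpr V RegularExpression.epsilon
  | char (a : T) (ha : a ∈ V) : UnionFreeExpr V (RegularExpression.char a)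
  | comp (P Q : RegularExpression T) (hP : UnionFreeExpr V P) (hQ : UnionFreeExpr V Q) :
      UnionFreeExpr V (RegularExpression.comp P Q)
  | star (P : RegularExpression T) (hP : UnionFreeExpr V P) :
      UnionFreeExpr V (RegularExpression.star P)

/-- `L` is described by a regular expression without union. -/
def IsUnionFree {T : Type*} (V : Finset T) (L : Language T) : Prop :=
  ∃ R : RegularExpression T, UnionFreeExpr V R ∧ R.matches' = L

/-- There are sets `B, I, E ⊆ V^k` such that a word `w = a_1 ... a_n` over `V` with `n ≥ k` belongs
to `L` iff `a_1 ... a_k ∈ B`, `a_(j+1) ... a_(j+k) ∈ I` for `1 ≤ j ≤ n - k - 1`, and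
`a_(n-k+1) ... a_n ∈ E`. There is no restriction on words shorter than `k`. -/
def IsStrictlyLocallyTestable {T : Type*} (k : ℕ) (V : Finset T) (L : Language T) : Prop :=
  ∃ B I E : Set (List T),
    (∀ w ∈ B, w ∈ wordsOver V ∧ w.length = k) ∧
    (∀ w ∈ I, w ∈ wordsOver V ∧ w.length = k) ∧
    (∀ w ∈ E, w ∈ wordsOver V ∧ w.length = k) ∧
    ∀ w ∈ wordsOver V, k ≤ w.length →
      (w ∈ L ↔ w.take k ∈ B ∧
        (∀ j, 1 ≤ j → j + k + 1 ≤ w.length → (w.drop j).take k ∈ I) ∧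
        w.drop (w.length - k) ∈ E)

/-! ### The families -/

/-- A family of languages: `L ∈ F V` means that the language `L` over the alphabet `V` belongs to
the family with respect to `V`. -/
abbrev LangFamily (T : Type*) := Finset T → Set (Language T)

def FIN (T : Type*) : LangFamily T :=
  fun V => {L | L ≤ wordsOver V ∧ {w : List T | w ∈ L}.Finite}
def MON (T : Type*) : LangFamily T := fun V => {L | L ≤ wordsOver V ∧ IsMonoidal V L}
def NIL (T : Type*) : LangFamily T := fun V => {L | L ≤ wordsOver V ∧ IsNilpotent V L}
def COMB (T : Type*) : LangFamily T := fun V => {L | L ≤ wordsOver V ∧ IsCombinational V L}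
def DEF (T : Type*) : LangFamily T := fun V => {L | L ≤ wordsOver V ∧ IsDefinite V L}
def SUF (T : Type*) : LangFamily T :=
  fun V => {L | L ≤ wordsOver V ∧ L.IsRegular ∧ IsSuffixClosed V L}
def ORD (T : Type*) : LangFamily T := fun V => {L | L ≤ wordsOver V ∧ IsOrdered V L}
def COMM (T : Type*) : LangFamily T :=
  fun V => {L | L ≤ wordsOver V ∧ L.IsRegular ∧ IsCommutative L}
def CIRC (T : Type*) : LangFamily T :=
  fun V => {L | L ≤ wordsOver V ∧ L.IsRegular ∧ IsCircular L}
def NC (T : Type*) : LangFamily T :=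
  fun V => {L | L ≤ wordsOver V ∧ L.IsRegular ∧ IsNonCounting V L}
def PS (T : Type*) : LangFamily T :=
  fun V => {L | L ≤ wordsOver V ∧ L.IsRegular ∧ IsPowerSeparating V L}
def UF (T : Type*) : LangFamily T := fun V => {L | L ≤ wordsOver V ∧ IsUnionFree V L}
def SLTk (T : Type*) (k : ℕ) : LangFamily T :=
  fun V => {L | L ≤ wordsOver V ∧ IsStrictlyLocallyTestable k V L}
def SLT (T : Type*) : LangFamily T :=
  fun V => {L | L ≤ wordsOver V ∧ ∃ k : ℕ, 1 ≤ k ∧ IsStrictlyLocallyTestable k V L}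
def REG (T : Type*) : LangFamily T := fun V => {L | L ≤ wordsOver V ∧ L.IsRegular}

/-! ### Contextual grammars with external derivation -/

/-- A triple of a basic alphabet, a finite set of selection pairs `(S, C)` where `S` is a language
and `C` is a finite set of contexts over the basic alphabet, and a finite set of start words
over the basic alphabet. -/
structure ContextualGrammar (T : Type*) where
  alphabet : Finset T
  pairs : Set (Language T × Set (List T × List T))
  startWords : Set (List T)
  pairs_finite : pairs.Finite
  contexts_finite : ∀ p ∈ pairs, p.2.Finite
  contexts_over : ∀ p ∈ pairs, ∀ c ∈ p.2, c.1 ∈ wordsOver alphabet ∧ c.2 ∈ wordsOver alphabet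
  startWords_finite : startWords.Finite
  startWords_over : ∀ w ∈ startWords, w ∈ wordsOver alphabet

/-- Each selection language belongs to `F` with respect to some subset of the basic alphabet. -/
def ContextualGrammar.HasSelectionIn {T : Type*} (G : ContextualGrammar T) (F : LangFamily T) :
    Prop :=
  ∀ p ∈ G.pairs, ∃ U : Finset T, U ⊆ G.alphabet ∧ p.1 ∈ F U

/-- The external derivation relation. -/
def ContextualGrammar.ExtDerives {T : Type*} (G : ContextualGrammar T) (x y : List T) : Prop :=
  ∃ p ∈ G.pairs, x ∈ p.1 ∧ ∃ c ∈ p.2, y = c.1 ++ x ++ c.2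

/-- The externally generated language. -/
def ContextualGrammar.extLanguage {T : Type*} (G : ContextualGrammar T) : Language T :=
  {z | ∃ x ∈ G.startWords, Relation.ReflTransGen G.ExtDerives x z}

/-- The family of all languages generated externally by contextual grammars with selection
in `F`. -/
def EC {T : Type*} (F : LangFamily T) : Set (Language T) :=
  {L | ∃ G : ContextualGrammar T, G.HasSelectionIn F ∧ G.extLanguage = L}

/-! ### The diagram -/

/-- The entries of the diagram (`reg` is the common entry of `EC(REG)` and `EC(UF)`). -/
inductive Entry
  | fin | mon | nil | comb | defi | suf | ord | comm | circ | nc | ps | reg | slt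
  | sltk (k : ℕ+)

/-- The family of selection languages that belongs to an entry. -/
def Entry.family (T : Type*) : Entry → LangFamily T
  | .fin => FIN T
  | .mon => MON T
  | .nil => NIL T
  | .comb => COMB T
  | .defi => DEF T
  | .suf => SUF T
  | .ord => ORD T
  | .comm => COMM T
  | .circ => CIRC T
  | .nc => NC T
  | .ps => PS T
  | .reg => REG T
  | .slt => SLT T
  | .sltk k => SLTk T k

/-- The solid arrows of the diagram. -/
inductive SolidArrow : Entry → Entry → Prop
  | fin_mon : SolidArrow .fin .mon
  | mon_comb : SolidArrow .mon .comb
  | mon_nil : SolidArrow .mon .nil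
  | mon_suf : SolidArrow .mon .suf
  | nil_defi : SolidArrow .nil .defi
  | nil_comm : SolidArrow .nil .comm
  | comb_defi : SolidArrow .comb .defi
  | comb_sltk : SolidArrow .comb (.sltk 1)
  | sltk_succ (k : ℕ+) : SolidArrow (.sltk k) (.sltk (k + 1))
  | sltk_slt (k : ℕ+) : SolidArrow (.sltk k) .slt
  | sltk_ord : SolidArrow (.sltk 1) .ord
  | defi_ord : SolidArrow .defi .ord
  | defi_slt : SolidArrow .defi .slt
  | slt_nc : SolidArrow .slt .nc
  | nc_ps : SolidArrow .nc .ps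
  | suf_ps : SolidArrow .suf .ps
  | ps_reg : SolidArrow .ps .reg
  | comm_circ : SolidArrow .comm .circ
  | circ_reg : SolidArrow .circ .reg

/-- The arrows of the diagram, including the dashed one from `ord` to `nc`. -/
def Arrow (X Y : Entry) : Prop := SolidArrow X Y ∨ (X = .ord ∧ Y = .nc)

/-- There is a directed path (possibly of length zero) from `X` to `Y`. -/
def HasPath (X Y : Entry) : Prop := Relation.ReflTransGen Arrow X Y

/-- The exceptional pairs. -/
def Exceptional (X Y : Entry) : Prop :=
  X = .ord ∧ (Y = .slt ∨ ∃ k : ℕ+, 2 ≤ k ∧ Y = .sltk k)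

end ExtCG

namespace ExtCG

/-! ### Words, powers of words and finiteness by length -/

section Words

variable {T : Type*}

/-! Inclusions. External derivation is insensitive to finite changes of the selection: if a
selection language is, up to finitely many words, a finite union of sublanguages from another
family, each piece can carry the same contexts, and the words derived in one step from the finitely
many missed generated words become start words (`EC_subset_of_cofinite_cover`). Thus a nilpotent
language may be replaced by all sufficiently long words, a definite one by the languages V*b, a
strictly locally k-testable one by its words of length at least k + 2. What remains is automata
theory: a monotone map on a finite chain has eventually constant orbits (ordered implies
non-counting), a buffer of recent letters read as a number is an ordered automaton
(`singleton_suffix_mem_ORD`), and powers of a word lead to eventually periodic states (suffix-closed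
implies power-separating). For union-free selection, Kleene's construction together with (R₁ ∪ ... ∪
Rₙ)* = (R₁* ... Rₙ*)* makes each regular language a finite union of union-free ones.

Separations. All except the one from the finite families use languages R ∪ cQc, where Q ⊆ R and the
letter c does not occur in R. A long word cwc can only arise in one step from some x ∈ R, by a
context (cy, zc), and whatever the same selection language picks from R must be sent into Q by x ↦
yxz. By pigeonhole a single selection language and context serve infinitely many words of a
prescribed sequence (`exists_context_of_framed_mem_EC`). A closure property of the selection family
then lets the selection pick a wrong word of R. Conversely, a selection language that cuts Q out of
R generates R ∪ cQc as soon as R itself can be generated (`framed_mem_EC`).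

Diagram. Twelve separations, two of them indexed by k, suffice: a non-inclusion persists when the
left family grows and the right family shrinks along the arrows. -/

theorem mem_wordsOver {V : Finset T} {w : List T} : w ∈ wordsOver V ↔ ∀ a ∈ w, a ∈ V := Iff.rfl

theorem nil_mem_wordsOver (V : Finset T) : [] ∈ wordsOver V := by simp [mem_wordsOver]

theorem append_mem_wordsOver {V : Finset T} {x y : List T} :
    x ++ y ∈ wordsOver V ↔ x ∈ wordsOver V ∧ y ∈ wordsOver V := by
  simp only [mem_wordsOver, List.mem_append]
  exact ⟨fun h => ⟨fun a ha => h a (.inl ha), fun a ha => h a (.inr ha)⟩,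
    fun h a ha => ha.elim (h.1 a) (h.2 a)⟩

theorem cons_mem_wordsOver {V : Finset T} {a : T} {x : List T} :
    a :: x ∈ wordsOver V ↔ a ∈ V ∧ x ∈ wordsOver V := by
  simp [mem_wordsOver]

theorem replicate_mem_wordsOver {V : Finset T} {a : T} (ha : a ∈ V) (n : ℕ) :
    List.replicate n a ∈ wordsOver V := by
  intro b hb
  rwa [List.eq_of_mem_replicate hb]

theorem wordsOver_mono {U V : Finset T} (h : U ⊆ V) {w : List T} (hw : w ∈ wordsOver U) :
    w ∈ wordsOver V := fun a ha => h (hw a ha)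

theorem finite_wordsOver_length_le (V : Finset T) (n : ℕ) :
    {w : List T | w ∈ wordsOver V ∧ w.length ≤ n}.Finite := by
  refine ((List.finite_length_le V n).image (List.map Subtype.val)).subset ?_
  rintro w ⟨hw, hn⟩
  exact ⟨w.attach.map fun a => ⟨a.1, hw a.1 a.2⟩, by simpa using hn, by simp⟩

theorem wordPow_succ (y : List T) (n : ℕ) : wordPow y (n + 1) = y ++ wordPow y n := rfl

theorem wordPow_add (y : List T) (m n : ℕ) : wordPow y (m + n) = wordPow y m ++ wordPow y n := by
  rw [wordPow, List.replicate_add, List.flatten_append]; rfl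

theorem wordPow_singleton (a : T) (n : ℕ) : wordPow [a] n = List.replicate n a := by
  simp [wordPow]

theorem length_wordPow (y : List T) (n : ℕ) : (wordPow y n).length = n * y.length := by
  simp [wordPow]

theorem wordPow_mem_wordsOver {V : Finset T} {y : List T} (hy : y ∈ wordsOver V) (n : ℕ) :
    wordPow y n ∈ wordsOver V := by
  induction n with
  | zero => exact nil_mem_wordsOver V
  | succ n ih => exact append_mem_wordsOver.2 ⟨hy, ih⟩

end Words

/-! ### Contextual grammars and the exchange of selection languages -/

section Grammars

variable {T : Type*}

theorem ContextualGrammar.extLanguage_step {G : ContextualGrammar T} {x y : List T}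
    (hx : x ∈ G.extLanguage) (h : G.ExtDerives x y) : y ∈ G.extLanguage := by
  obtain ⟨s, hs, hsx⟩ := hx
  exact ⟨s, hs, hsx.tail h⟩

theorem ContextualGrammar.startWords_subset (G : ContextualGrammar T) {x : List T}
    (hx : x ∈ G.startWords) : x ∈ G.extLanguage := ⟨x, hx, .refl⟩

theorem ContextualGrammar.extLanguage_induction {G : ContextualGrammar T} {P : List T → Prop}
    (start : ∀ x ∈ G.startWords, P x)
    (step : ∀ x y, x ∈ G.extLanguage → P x → G.ExtDerives x y → P y)
    {w : List T} (hw : w ∈ G.extLanguage) : P w := by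
  obtain ⟨s, hs, hsw⟩ := hw
  induction hsw with
  | refl => exact start s hs
  | tail hab hbc ih => exact step _ _ ⟨s, hs, hab⟩ ih hbc

theorem ContextualGrammar.extLanguage_le (G : ContextualGrammar T) {w : List T}
    (hw : w ∈ G.extLanguage) : w ∈ wordsOver G.alphabet := by
  refine extLanguage_induction G.startWords_over ?_ hw
  rintro x y - hx ⟨p, hp, -, c, hc, rfl⟩
  have := G.contexts_over p hp c hc
  exact append_mem_wordsOver.2 ⟨append_mem_wordsOver.2 ⟨this.1, hx⟩, this.2⟩

/-- If each selection language can be replaced, up to finitely many words, by a finite union of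
sublanguages from another family, then the generated families are contained in each other. -/
theorem EC_subset_of_cofinite_cover {F F' : LangFamily T}
    (h : ∀ U L, L ∈ F U → ∃ D : Set (Language T), D.Finite ∧ (∀ K ∈ D, K ∈ F' U ∧ ∀ w ∈ K, w ∈ L) ∧
      {w : List T | w ∈ L ∧ ∀ K ∈ D, w ∉ K}.Finite) : EC F ⊆ EC F' := by
  rintro _ ⟨G, hG, rfl⟩
  have h' : ∀ p ∈ G.pairs, ∃ D : Set (Language T), D.Finite ∧
      (∀ K ∈ D, (∃ U ⊆ G.alphabet, K ∈ F' U) ∧ ∀ w ∈ K, w ∈ p.1) ∧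
      {w : List T | w ∈ p.1 ∧ ∀ K ∈ D, w ∉ K}.Finite := by
    intro p hp
    obtain ⟨U, hU, hpU⟩ := hG p hp
    obtain ⟨D, h1, h2, h3⟩ := h U p.1 hpU
    exact ⟨D, h1, fun K hK => ⟨⟨U, hU, (h2 K hK).1⟩, (h2 K hK).2⟩, h3⟩
  choose! D hD1 hD2 hD3 using h'
  -- Only the results of missed words that `G` really generates are added. This keeps the new start
  -- words inside the old language.
  let start : Set (List T) := G.startWords ∪ ⋃ p ∈ G.pairs, ⋃ c ∈ p.2,
    (fun x => c.1 ++ x ++ c.2) '' {w | w ∈ G.extLanguage ∧ w ∈ p.1 ∧ ∀ K ∈ D p, w ∉ K}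
  have hstart : ∀ w ∈ start, w ∈ G.extLanguage := by
    rintro w (hw | hw)
    · exact G.startWords_subset hw
    · simp only [Set.mem_iUnion] at hw
      obtain ⟨p, hp, c, hc, x, ⟨hx, hxp, -⟩, rfl⟩ := hw
      exact G.extLanguage_step hx ⟨p, hp, hxp, c, hc, rfl⟩
  let G' : ContextualGrammar T :=
    { alphabet := G.alphabet
      pairs := ⋃ p ∈ G.pairs, (fun K => (K, p.2)) '' D p
      startWords := start
      pairs_finite := G.pairs_finite.biUnion fun p hp => (hD1 p hp).image _
      contexts_finite := by
        intro q hq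
        simp only [Set.mem_iUnion] at hq
        obtain ⟨p, hp, K, -, rfl⟩ := hq
        exact G.contexts_finite p hp
      contexts_over := by
        intro q hq
        simp only [Set.mem_iUnion] at hq
        obtain ⟨p, hp, K, -, rfl⟩ := hq
        exact G.contexts_over p hp
      startWords_finite := by
        refine G.startWords_finite.union (G.pairs_finite.biUnion fun p hp =>
          (G.contexts_finite p hp).biUnion fun c _ => ((hD3 p hp).subset ?_).image _)
        exact fun w hw => hw.2
      startWords_over := fun w hw => G.extLanguage_le (hstart w hw) }
  refine ⟨G', ?_, ?_⟩
  · intro q hq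
    obtain ⟨p, hp, K, hK, rfl⟩ : ∃ p ∈ G.pairs, ∃ K ∈ D p, (K, p.2) = q := by
      simpa [G'] using hq
    exact (hD2 p hp K hK).1
  · ext w
    constructor
    · refine ContextualGrammar.extLanguage_induction (G := G') hstart ?_
      rintro x y - hx ⟨q, hq, hxq, c, hc, rfl⟩
      obtain ⟨p, hp, K, hK, rfl⟩ : ∃ p ∈ G.pairs, ∃ K ∈ D p, (K, p.2) = q := by
        simpa [G'] using hq
      exact G.extLanguage_step hx ⟨p, hp, (hD2 p hp K hK).2 x hxq, c, hc, rfl⟩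
    · refine ContextualGrammar.extLanguage_induction
        (fun x hx => G'.startWords_subset (Or.inl hx)) ?_
      rintro x y hxG hx ⟨p, hp, hxp, c, hc, rfl⟩
      -- A derivation step is either simulated by a piece that contains x, or x is one of the missed
      -- words and the result is already a start word.
      by_cases hK : ∃ K ∈ D p, x ∈ K
      · obtain ⟨K, hK, hxK⟩ := hK
        refine G'.extLanguage_step hx ⟨(K, p.2), ?_, hxK, c, hc, rfl⟩
        exact Set.mem_biUnion hp ⟨K, hK, rfl⟩
      · push Not at hK
        refine G'.startWords_subset (Or.inr ?_)
        simp only [Set.mem_iUnion]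
        exact ⟨p, hp, c, hc, x, ⟨hxG, hxp, hK⟩, rfl⟩

theorem EC_mono {F F' : LangFamily T} (h : ∀ U L, L ∈ F U → L ∈ F' U) : EC F ⊆ EC F' := by
  rintro _ ⟨G, hG, rfl⟩
  refine ⟨G, fun p hp => ?_, rfl⟩
  obtain ⟨U, hU, hpU⟩ := hG p hp
  exact ⟨U, hU, h U _ hpU⟩

/-- A selection language may be replaced by a sublanguage with finite difference. -/
theorem EC_subset_of_cofinite {F F' : LangFamily T}
    (h : ∀ U L, L ∈ F U → ∃ K ∈ F' U, (∀ w ∈ K, w ∈ L) ∧ {w : List T | w ∈ L ∧ w ∉ K}.Finite) :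
    EC F ⊆ EC F' := by
  refine EC_subset_of_cofinite_cover fun U L hL => ?_
  obtain ⟨K, hK, h1, h2⟩ := h U L hL
  exact ⟨{K}, Set.finite_singleton K, by simpa using ⟨hK, h1⟩, by simpa using h2⟩

end Grammars

/-! ### Regular languages as finite unions of union-free languages -/

section Regular

variable {T : Type*}

/-- The counting tool for Myhill–Nerode arguments: to bound the number of left quotients it suffices
to attach to each word a datum with finitely many values that determines its quotient. -/
theorem finite_image_of_factor {α β γ : Type*} {S : Set α} {f : α → γ} (σ : α → β)
    (hσ : (σ '' S).Finite) (h : ∀ x ∈ S, ∀ y ∈ S, σ x = σ y → f x = f y) : (f '' S).Finite := by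
  have hs : ∀ b ∈ σ '' S, ∃ x ∈ S, σ x = b := fun b hb => hb
  rcases S.eq_empty_or_nonempty with rfl | ⟨x₀, -⟩
  · simp
  have : Nonempty α := ⟨x₀⟩
  choose! s hs1 hs2 using hs
  refine (hσ.image (f ∘ s)).subset ?_
  rintro _ ⟨x, hx, rfl⟩
  have hb : σ x ∈ σ '' S := ⟨x, hx, rfl⟩
  exact ⟨σ x, hb, h _ (hs1 _ hb) _ hx (hs2 _ hb)⟩

/-- The words over `V` of length at least `n`. -/
def longWords (V : Finset T) (n : ℕ) : Language T := {w | w ∈ wordsOver V ∧ n ≤ w.length}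

theorem mem_longWords {V : Finset T} {n : ℕ} {w : List T} :
    w ∈ longWords V n ↔ w ∈ wordsOver V ∧ n ≤ w.length := Iff.rfl

theorem isRegular_longWords (V : Finset T) (n : ℕ) : (longWords V n).IsRegular := by
  refine .of_finite_range_leftQuotient ?_
  refine (((Set.finite_Iic n).image (longWords V)).insert 0).subset ?_
  rintro _ ⟨w, rfl⟩
  by_cases hw : w ∈ wordsOver V
  -- Truncated subtraction is intended: once w has length n, the quotient is all of V*.
  · refine Or.inr ⟨n - w.length, Nat.sub_le _ _, ?_⟩
    ext y
    rw [Language.mem_leftQuotient, mem_longWords, mem_longWords, append_mem_wordsOver,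
      List.length_append]
    constructor
    · rintro ⟨h1, h2⟩
      exact ⟨⟨hw, h1⟩, by omega⟩
    · rintro ⟨h1, h2⟩
      exact ⟨h1.2, by omega⟩
  · refine Or.inl ?_
    ext y
    rw [Language.mem_leftQuotient, mem_longWords, append_mem_wordsOver]
    exact ⟨fun h => absurd h.1.1 hw, fun h => absurd h (Language.notMem_zero y)⟩

theorem isRegular_wordsOver (V : Finset T) : (wordsOver V).IsRegular := by
  have h := isRegular_longWords V 0
  have e : longWords V 0 = wordsOver V := by
    ext w
    simp [mem_longWords]
  rwa [e] at h

/-- The words over `V` that are accepted by the automaton `M`. -/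
def acceptsOver {Z : Type*} (V : Finset T) (M : DFA T Z) : Language T :=
  {w | w ∈ wordsOver V ∧ w ∈ M.accepts}

theorem mem_acceptsOver {Z : Type*} {V : Finset T} {M : DFA T Z} {w : List T} :
    w ∈ acceptsOver V M ↔ w ∈ wordsOver V ∧ M.eval w ∈ M.accept := Iff.rfl

theorem isRegular_acceptsOver {Z : Type*} [Fintype Z] (V : Finset T) (M : DFA T Z) :
    (acceptsOver V M).IsRegular := by
  have h : (wordsOver V ⊓ M.accepts).IsRegular :=
    (isRegular_wordsOver V).inf (Language.isRegular_iff.2 ⟨Z, inferInstance, M, rfl⟩)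
  exact h

theorem isRegular_zero : (0 : Language T).IsRegular := by
  refine ⟨Unit, inferInstance, ⟨fun _ _ => (), (), ∅⟩, ?_⟩
  ext w
  exact ⟨fun h => absurd h (Set.notMem_empty _), fun h => absurd h (Language.notMem_zero w)⟩

theorem isRegular_one : (1 : Language T).IsRegular := by
  have h := isRegular_wordsOver (∅ : Finset T)
  have e : wordsOver (∅ : Finset T) = 1 := by
    ext w
    rw [Language.mem_one]
    cases w with
    | nil => simp [mem_wordsOver]
    | cons a w => simp [cons_mem_wordsOver]
  rwa [e] at h

theorem isRegular_singleton_letter (a : T) : ({[a]} : Language T).IsRegular := by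
  refine .of_finite_range_leftQuotient ?_
  refine (Set.toFinite ({0, 1, {[a]}} : Set (Language T))).subset ?_
  rintro _ ⟨w, rfl⟩
  have key : ∀ y, y ∈ ({[a]} : Language T).leftQuotient w ↔ w ++ y = [a] := fun y => Iff.rfl
  rcases w with _ | ⟨b, w⟩
  · exact Or.inr (Or.inr rfl)
  · by_cases h : b = a ∧ w = []
    · refine Or.inr (Or.inl ?_)
      ext y
      rw [key, Language.mem_one, h.1, h.2]
      simp
    · refine Or.inl ?_
      ext y
      rw [key]
      refine ⟨fun hy => absurd ?_ h, fun h => absurd h (Language.notMem_zero y)⟩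
      simp only [List.cons_append, List.cons.injEq, List.append_eq_nil_iff] at hy
      exact ⟨hy.1, hy.2.1⟩

/-- The quotient of PQ by w is (w⁻¹P)Q together with all v⁻¹Q where w = uv and u ∈ P. Hence it is
determined by one quotient of P and a set of quotients of Q, and there are finitely many such data.
-/
theorem IsRegular.mul {P Q : Language T} (hP : P.IsRegular) (hQ : Q.IsRegular) :
    (P * Q).IsRegular := by
  refine .of_finite_range_leftQuotient ?_
  have hfin := (hP.finite_range_leftQuotient.prod hQ.finite_range_leftQuotient.finite_subsets)
  rw [← Set.image_univ]
  refine finite_image_of_factor (fun w => (P.leftQuotient w,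
    {K | ∃ u v, w = u ++ v ∧ u ∈ P ∧ K = Q.leftQuotient v})) (hfin.subset ?_) ?_
  · rintro _ ⟨w, -, rfl⟩
    refine ⟨⟨w, rfl⟩, ?_⟩
    rintro _ ⟨u, v, -, -, rfl⟩
    exact ⟨v, rfl⟩
  · have key : ∀ w y, y ∈ (P * Q).leftQuotient w ↔
        (∃ p q, p ∈ P.leftQuotient w ∧ q ∈ Q ∧ y = p ++ q) ∨
        ∃ K, (∃ u v, w = u ++ v ∧ u ∈ P ∧ K = Q.leftQuotient v) ∧ y ∈ K := by
      intro w y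
      rw [Language.mem_leftQuotient, Language.mem_mul]
      constructor
      · rintro ⟨p, hp, q, hq, e⟩
        rcases List.append_eq_append_iff.1 e with ⟨r, rfl, rfl⟩ | ⟨r, rfl, rfl⟩
        · exact Or.inr ⟨_, ⟨p, r, rfl, hp, rfl⟩, hq⟩
        · exact Or.inl ⟨r, q, hp, hq, rfl⟩
      · rintro (⟨p, q, hp, hq, rfl⟩ | ⟨_, ⟨u, v, rfl, hu, rfl⟩, hy⟩)
        · exact ⟨w ++ p, hp, q, hq, by simp⟩
        · exact ⟨u, hu, v ++ y, hy, by simp⟩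
    intro w _ w' _ h
    have h1 := congrArg Prod.fst h
    have h2 := congrArg Prod.snd h
    dsimp only at h1 h2
    ext y
    rw [key, key, h1]
    refine or_congr Iff.rfl (exists_congr fun K => and_congr ?_ Iff.rfl)
    exact Set.ext_iff.1 h2 K

/-- In a factorisation of wy over P, one factor vp contains the last letter of w and possibly runs
over into y. This needs w to have a last letter. -/
theorem append_mem_kstar_iff {P : Language T} {w y : List T} (hw : w ≠ []) :
    w ++ y ∈ KStar.kstar P ↔ ∃ u v, w = u ++ v ∧ u ∈ KStar.kstar P ∧
      ∃ p q, p ∈ P.leftQuotient v ∧ q ∈ KStar.kstar P ∧ y = p ++ q := by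
  constructor
  · intro h
    obtain ⟨l, hl, hlP⟩ := Language.mem_kstar.1 h
    clear h
    induction l generalizing w with
    | nil => exact absurd (List.append_eq_nil_iff.1 hl).1 hw
    | cons x l ih =>
      have hx := hlP x (List.mem_cons_self ..)
      have hl' : ∀ z ∈ l, z ∈ P := fun z hz => hlP z (List.mem_cons_of_mem _ hz)
      rw [List.flatten_cons] at hl
      rcases List.append_eq_append_iff.1 hl with ⟨r, rfl, hr⟩ | ⟨r, rfl, hr⟩
      · exact ⟨[], w, rfl, Language.nil_mem_kstar P, r, l.flatten, hx,
          Language.join_mem_kstar hl', hr⟩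
      -- If w ends exactly with the factor x, nothing is left of w for the induction hypothesis, so
      -- x itself is the straddling factor with an empty overhang.
      · rcases eq_or_ne r [] with rfl | hr0
        · refine ⟨[], x ++ [], rfl, Language.nil_mem_kstar P, [], y, ?_, ?_, rfl⟩
          · simpa using hx
          · rw [List.nil_append] at hr
            rw [← hr]
            exact Language.join_mem_kstar hl'
        · obtain ⟨u, v, rfl, hu, p, q, hp, hq, rfl⟩ := ih hr0 hr.symm hl'
          refine ⟨x ++ u, v, by simp, ?_, p, q, hp, hq, rfl⟩
          obtain ⟨m, rfl, hm⟩ := Language.mem_kstar.1 hu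
          exact Language.join_mem_kstar (L := x :: m) (by simpa using ⟨hx, hm⟩)
  · rintro ⟨u, v, rfl, hu, p, q, hp, hq, rfl⟩
    obtain ⟨m, rfl, hm⟩ := Language.mem_kstar.1 hu
    obtain ⟨n, rfl, hn⟩ := Language.mem_kstar.1 hq
    refine Language.mem_kstar.2 ⟨m ++ (v ++ p) :: n, by simp, ?_⟩
    intro z hz
    rcases List.mem_append.1 hz with hz | hz
    · exact hm z hz
    · rcases List.mem_cons.1 hz with rfl | hz
      · exact hp
      · exact hn z hz

theorem IsRegular.kstar {P : Language T} (hP : P.IsRegular) : (KStar.kstar P).IsRegular := by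
  refine .of_finite_range_leftQuotient ?_
  have hfin := hP.finite_range_leftQuotient.finite_subsets
  have hne : ((KStar.kstar P).leftQuotient '' {w | w ≠ []}).Finite := by
    refine finite_image_of_factor (fun w =>
      {K | ∃ u v, w = u ++ v ∧ u ∈ KStar.kstar P ∧ K = P.leftQuotient v}) (hfin.subset ?_) ?_
    · rintro _ ⟨w, -, rfl⟩ _ ⟨u, v, -, -, rfl⟩
      exact ⟨v, rfl⟩
    · have key : ∀ w y, w ≠ [] → (y ∈ (KStar.kstar P).leftQuotient w ↔
          ∃ K ∈ {K | ∃ u v, w = u ++ v ∧ u ∈ KStar.kstar P ∧ K = P.leftQuotient v},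
            ∃ p q, p ∈ K ∧ q ∈ KStar.kstar P ∧ y = p ++ q) := by
        intro w y hw
        rw [Language.mem_leftQuotient, append_mem_kstar_iff hw]
        constructor
        · rintro ⟨u, v, h1, h2, h3⟩
          exact ⟨_, ⟨u, v, h1, h2, rfl⟩, h3⟩
        · rintro ⟨_, ⟨u, v, h1, h2, rfl⟩, h3⟩
          exact ⟨u, v, h1, h2, h3⟩
      intro w hw w' hw' h
      ext y
      rw [key w y hw, key w' y hw', h]
  -- The empty word, excluded from the factor analysis, contributes one more quotient.
  refine (hne.insert (KStar.kstar P)).subset ?_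
  rintro _ ⟨w, rfl⟩
  rcases eq_or_ne w [] with rfl | hw
  · exact Or.inl rfl
  · exact Or.inr ⟨w, hw, rfl⟩

theorem UnionFreeExpr.isRegular {V : Finset T} {R : RegularExpression T} (h : UnionFreeExpr V R) :
    R.matches'.IsRegular := by
  induction h with
  | zero => exact isRegular_zero
  | epsilon => exact isRegular_one
  | char a _ => exact isRegular_singleton_letter a
  | comp P Q _ _ ihP ihQ => exact IsRegular.mul ihP ihQ
  | star P _ ihP => exact IsRegular.kstar ihP

/-- A finite union of union-free languages over `V`. -/
def IsUnionOfUnionFree (V : Finset T) (L : Language T) : Prop :=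
  ∃ l : List (RegularExpression T), (∀ R ∈ l, UnionFreeExpr V R) ∧
    ∀ w, w ∈ L ↔ ∃ R ∈ l, w ∈ R.matches'

theorem UnionFreeExpr.isUnionOfUnionFree {V : Finset T} {R : RegularExpression T}
    (h : UnionFreeExpr V R) : IsUnionOfUnionFree V R.matches' :=
  ⟨[R], by simpa using h, by simp⟩

theorem IsUnionOfUnionFree.add {V : Finset T} {P Q : Language T} (hP : IsUnionOfUnionFree V P)
    (hQ : IsUnionOfUnionFree V Q) : IsUnionOfUnionFree V (P + Q) := by
  obtain ⟨l, hl, hP⟩ := hP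
  obtain ⟨m, hm, hQ⟩ := hQ
  refine ⟨l ++ m, fun R hR => (List.mem_append.1 hR).elim (hl R) (hm R), fun w => ?_⟩
  rw [Language.mem_add, hP, hQ]
  simp only [List.mem_append, or_and_right, exists_or]

theorem IsUnionOfUnionFree.mul {V : Finset T} {P Q : Language T} (hP : IsUnionOfUnionFree V P)
    (hQ : IsUnionOfUnionFree V Q) : IsUnionOfUnionFree V (P * Q) := by
  obtain ⟨l, hl, hP⟩ := hP
  obtain ⟨m, hm, hQ⟩ := hQ
  refine ⟨(l ×ˢ m).map fun p => RegularExpression.comp p.1 p.2, ?_, fun w => ?_⟩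
  · intro R hR
    obtain ⟨p, hp, rfl⟩ := List.mem_map.1 hR
    rw [List.mem_product] at hp
    exact .comp _ _ (hl _ hp.1) (hm _ hp.2)
  · rw [Language.mem_mul]
    constructor
    · rintro ⟨p, hp, q, hq, rfl⟩
      obtain ⟨R, hR, hpR⟩ := (hP p).1 hp
      obtain ⟨S, hS, hqS⟩ := (hQ q).1 hq
      exact ⟨_, List.mem_map.2 ⟨(R, S), List.mem_product.2 ⟨hR, hS⟩, rfl⟩,
        Language.mem_mul.2 ⟨p, hpR, q, hqS, rfl⟩⟩
    · rintro ⟨R, hR, hw⟩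
      obtain ⟨⟨R, S⟩, hp, rfl⟩ := List.mem_map.1 hR
      rw [List.mem_product] at hp
      obtain ⟨p, hpR, q, hqS, rfl⟩ := Language.mem_mul.1 hw
      exact ⟨p, (hP p).2 ⟨R, hp.1, hpR⟩, q, (hQ q).2 ⟨S, hp.2, hqS⟩, rfl⟩

/-- The union-free expression `(R₁* R₂* ⋯ Rₙ*)`. -/
def starProduct : List (RegularExpression T) → RegularExpression T
  | [] => RegularExpression.epsilon
  | R :: l => RegularExpression.comp (RegularExpression.star R) (starProduct l)

theorem unionFreeExpr_starProduct {V : Finset T} {l : List (RegularExpression T)}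
    (h : ∀ R ∈ l, UnionFreeExpr V R) : UnionFreeExpr V (starProduct l) := by
  induction l with
  | nil => exact .epsilon
  | cons R l ih =>
    exact .comp _ _ (.star _ (h R (List.mem_cons_self ..)))
      (ih fun S hS => h S (List.mem_cons_of_mem _ hS))

theorem nil_mem_starProduct (l : List (RegularExpression T)) : [] ∈ (starProduct l).matches' := by
  induction l with
  | nil => exact Language.nil_mem_one
  | cons R l ih => exact Language.mem_mul.2 ⟨[], Language.nil_mem_kstar _, [], ih, rfl⟩

theorem mem_starProduct_of_mem {l : List (RegularExpression T)} {R : RegularExpression T}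
    (hR : R ∈ l) {w : List T} (hw : w ∈ R.matches') : w ∈ (starProduct l).matches' := by
  induction l with
  | nil => simp at hR
  | cons S l ih =>
    rcases List.mem_cons.1 hR with rfl | hR
    · exact Language.mem_mul.2 ⟨w, le_kstar (a := R.matches') hw, [], nil_mem_starProduct l,
        List.append_nil w⟩
    · exact Language.mem_mul.2 ⟨[], Language.nil_mem_kstar _, w, ih hR, rfl⟩

theorem starProduct_le {l : List (RegularExpression T)} {L : Language T}
    (h : ∀ R ∈ l, ∀ w ∈ R.matches', w ∈ L) {w : List T} (hw : w ∈ (starProduct l).matches') :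
    w ∈ KStar.kstar L := by
  induction l generalizing w with
  | nil =>
    have : w = [] := hw
    rw [this]
    exact Language.nil_mem_kstar L
  | cons R l ih =>
    obtain ⟨p, hp, q, hq, rfl⟩ := Language.mem_mul.1 hw
    obtain ⟨m, rfl, hm⟩ := Language.mem_kstar.1 hp
    obtain ⟨n, rfl, hn⟩ := Language.mem_kstar.1
      (ih (fun S hS => h S (List.mem_cons_of_mem _ hS)) hq)
    refine Language.mem_kstar.2 ⟨m ++ n, List.flatten_append.symm, fun y hy => ?_⟩
    rcases List.mem_append.1 hy with hy | hy
    · exact h R (List.mem_cons_self ..) y (hm y hy)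
    · exact hn y hy

/-- The star absorbs unions: (R₁ ∪ ... ∪ Rₙ)* = (R₁* ... Rₙ*)*. Each Rᵢ lies in the product because
the other stars may contribute the empty word, and the product lies in the star of the union. The
result is even a single union-free expression. -/
theorem IsUnionOfUnionFree.kstar {V : Finset T} {P : Language T} (hP : IsUnionOfUnionFree V P) :
    IsUnionOfUnionFree V (KStar.kstar P) := by
  obtain ⟨l, hl, hP⟩ := hP
  have e : KStar.kstar P = (RegularExpression.star (starProduct l)).matches' := by
    ext w
    constructor
    · intro hw
      obtain ⟨m, rfl, hm⟩ := Language.mem_kstar.1 hw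
      refine Language.mem_kstar.2 ⟨m, rfl, fun y hy => ?_⟩
      obtain ⟨R, hR, hyR⟩ := (hP y).1 (hm y hy)
      exact mem_starProduct_of_mem hR hyR
    · intro hw
      obtain ⟨m, rfl, hm⟩ := Language.mem_kstar.1 hw
      have h : ∀ y ∈ m, y ∈ KStar.kstar P := fun y hy =>
        starProduct_le (fun R hR w hw => (hP w).2 ⟨R, hR, hw⟩) (hm y hy)
      rw [← kstar_idem]
      exact Language.join_mem_kstar h
  rw [e]
  exact (UnionFreeExpr.star _ (unionFreeExpr_starProduct hl)).isUnionOfUnionFree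

theorem isUnionOfUnionFree_zero (V : Finset T) : IsUnionOfUnionFree V (0 : Language T) :=
  ⟨[], by simp, fun w => by simp⟩

theorem isUnionOfUnionFree_one (V : Finset T) : IsUnionOfUnionFree V (1 : Language T) :=
  UnionFreeExpr.epsilon.isUnionOfUnionFree

theorem IsUnionOfUnionFree.biUnion {V : Finset T} {ι : Type*} (s : Finset ι) (f : ι → Language T)
    (h : ∀ i ∈ s, IsUnionOfUnionFree V (f i)) :
    IsUnionOfUnionFree V (∑ i ∈ s, f i) := by
  classical
  induction s using Finset.induction_on with
  | empty => simpa using isUnionOfUnionFree_zero V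
  | insert i s hi ih =>
    rw [Finset.sum_insert hi]
    exact (h i (Finset.mem_insert_self i s)).add
      (ih fun j hj => h j (Finset.mem_insert_of_mem hj))

theorem mem_sum_language {ι : Type*} (s : Finset ι) (f : ι → Language T) (w : List T) :
    w ∈ ∑ i ∈ s, f i ↔ ∃ i ∈ s, w ∈ f i := by
  classical
  induction s using Finset.induction_on with
  | empty => simp
  | insert i s hi ih => rw [Finset.sum_insert hi, Language.mem_add, ih]; simp

/-- Kleene's construction: words that lead from `p` to `q` with intermediate states in a list. -/
noncomputable def pathLanguage {Z : Type*} (V : Finset T) (M : DFA T Z) :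
    List Z → Z → Z → Language T
  | [], p, q => by
      classical
      exact (if p = q then 1 else 0) + ∑ a ∈ V with M.step p a = q, ({[a]} : Language T)
  | k :: S, p, q => pathLanguage V M S p q +
      pathLanguage V M S p k * KStar.kstar (pathLanguage V M S k k) * pathLanguage V M S k q

variable {Z : Type*} {V : Finset T} {M : DFA T Z}

theorem isUnionOfUnionFree_pathLanguage (S : List Z) (p q : Z) :
    IsUnionOfUnionFree V (pathLanguage V M S p q) := by
  induction S generalizing p q with
  | nil =>
    classical
    refine IsUnionOfUnionFree.add ?_ (IsUnionOfUnionFree.biUnion _ _ fun a ha => ?_)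
    · split_ifs
      · exact isUnionOfUnionFree_one V
      · exact isUnionOfUnionFree_zero V
    · exact (UnionFreeExpr.char a (Finset.mem_filter.1 ha).1).isUnionOfUnionFree
  | cons k S ih => exact (ih p q).add (((ih p k).mul (ih k k).kstar).mul (ih k q))

theorem pathLanguage_sound (S : List Z) (p q : Z) {w : List T} (hw : w ∈ pathLanguage V M S p q) :
    w ∈ wordsOver V ∧ M.evalFrom p w = q := by
  induction S generalizing p q w with
  | nil =>
    classical
    rw [pathLanguage, Language.mem_add, mem_sum_language] at hw
    rcases hw with hw | ⟨a, ha, hw⟩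
    · split_ifs at hw with h
      · rw [Language.mem_one] at hw
        subst hw
        exact ⟨nil_mem_wordsOver V, h⟩
      · exact absurd hw (Language.notMem_zero w)
    · have hwa : w = [a] := hw
      rw [Finset.mem_filter] at ha
      subst hwa
      exact ⟨cons_mem_wordsOver.2 ⟨ha.1, nil_mem_wordsOver V⟩, ha.2⟩
  | cons k S ih =>
    rw [pathLanguage, Language.mem_add, Language.mem_mul] at hw
    rcases hw with hw | ⟨y, hy, z, hz, rfl⟩
    · exact ih p q hw
    · obtain ⟨x, hx, y', hy', rfl⟩ := Language.mem_mul.1 hy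
      have h1 := ih p k hx
      have h3 := ih k q hz
      obtain ⟨m, rfl, hm⟩ := Language.mem_kstar.1 hy'
      have h2 : m.flatten ∈ wordsOver V ∧ M.evalFrom k m.flatten = k := by
        clear hy hy'
        induction m with
        | nil => exact ⟨nil_mem_wordsOver V, rfl⟩
        | cons a m ihm =>
          have ha := ih k k (hm a (List.mem_cons_self ..))
          have hm' := ihm fun y hy => hm y (List.mem_cons_of_mem _ hy)
          rw [List.flatten_cons, append_mem_wordsOver, DFA.evalFrom_of_append, ha.2]
          exact ⟨⟨ha.1, hm'.1⟩, hm'.2⟩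
      rw [append_mem_wordsOver, append_mem_wordsOver, DFA.evalFrom_of_append,
        DFA.evalFrom_of_append, h1.2, h2.2]
      exact ⟨⟨⟨h1.1, h2.1⟩, h3.1⟩, h3.2⟩

/-- Paths may be joined at `k` because `k` is allowed as an intermediate state: in Kleene algebra,
(A + AB*B)(C + BB*C) ≤ AB*B*C = AB*C. -/
theorem pathLanguage_mul_le (S : List Z) (p k q : Z) :
    pathLanguage V M (k :: S) p k * pathLanguage V M (k :: S) k q ≤
      pathLanguage V M (k :: S) p q := by
  simp only [pathLanguage]
  set A := pathLanguage V M S p k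
  set B := pathLanguage V M S k k
  set C := pathLanguage V M S k q
  have h1 : A + A * KStar.kstar B * B ≤ A * KStar.kstar B := by
    refine sup_le ?_ ?_
    · calc A = A * 1 := (mul_one A).symm
        _ ≤ A * KStar.kstar B := mul_le_mul_right one_le_kstar A
    · rw [mul_assoc]
      exact mul_le_mul_right kstar_mul_le_kstar A
  have h2 : C + B * KStar.kstar B * C ≤ KStar.kstar B * C := by
    refine sup_le ?_ ?_
    · calc C = 1 * C := (one_mul C).symm
        _ ≤ KStar.kstar B * C := mul_le_mul_left one_le_kstar C
    · exact mul_le_mul_left mul_kstar_le_kstar C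
  refine (mul_le_mul' h1 h2).trans (le_trans (le_of_eq ?_) le_sup_right)
  rw [mul_assoc, ← mul_assoc (KStar.kstar B), kstar_mul_kstar, mul_assoc]

theorem pathLanguage_complete (S : List Z) (p q : Z) {w : List T} (hw : w ∈ wordsOver V)
    (hq : M.evalFrom p w = q)
    (hS : ∀ u v, w = u ++ v → u ≠ [] → v ≠ [] → M.evalFrom p u ∈ S) :
    w ∈ pathLanguage V M S p q := by
  induction S generalizing p q w with
  | nil =>
    classical
    rw [pathLanguage, Language.mem_add, mem_sum_language]
    rcases w with _ | ⟨a, _ | ⟨b, w⟩⟩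
    · left
      rw [if_pos (show p = q from hq)]
      exact Language.nil_mem_one
    · exact Or.inr ⟨a, Finset.mem_filter.2 ⟨(cons_mem_wordsOver.1 hw).1, hq⟩, rfl⟩
    · exact absurd (hS [a] (b :: w) rfl (by simp) (by simp)) (by simp)
  | cons k S ih =>
    induction hn : w.length using Nat.strong_induction_on generalizing p q w with
    | _ n ihn =>
    subst hn
    -- A visit to k at an inner position splits w into two shorter words for the induction on the
    -- length. Without such a visit, k is not needed as an intermediate state.
    by_cases hk : ∃ u v, w = u ++ v ∧ u ≠ [] ∧ v ≠ [] ∧ M.evalFrom p u = k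
    · obtain ⟨u, v, rfl, hu, hv, huk⟩ := hk
      rw [append_mem_wordsOver] at hw
      rw [DFA.evalFrom_of_append, huk] at hq
      refine pathLanguage_mul_le S p k q (Language.mem_mul.2 ⟨u, ?_, v, ?_, rfl⟩)
      · refine ihn _ ?_ p k hw.1 huk ?_ rfl
        · simpa using List.length_pos_iff.2 hv
        · rintro x y rfl hx hy
          exact hS x (y ++ v) (by simp) hx (by simp [hy])
      · refine ihn _ ?_ k q hw.2 hq ?_ rfl
        · simpa using List.length_pos_iff.2 hu
        · rintro x y rfl hx hy
          have := hS (u ++ x) y (by simp) (by simp [hx]) hy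
          rwa [DFA.evalFrom_of_append, huk] at this
    · refine Or.inl (ih p q hw hq fun u v h hu hv => ?_)
      refine (List.mem_cons.1 (hS u v h hu hv)).resolve_left fun h' => hk ⟨u, v, h, hu, hv, h'⟩

/-- Each regular language over `V` is a finite union of union-free languages. -/
theorem isUnionOfUnionFree_of_isRegular {L : Language T} (hL : L ≤ wordsOver V)
    (hreg : L.IsRegular) : IsUnionOfUnionFree V L := by
  classical
  obtain ⟨Z, _, M, rfl⟩ := hreg
  have e : M.accepts = ∑ q : Z with q ∈ M.accept,
      pathLanguage V M Finset.univ.toList M.start q := by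
    ext w
    rw [mem_sum_language]
    constructor
    · intro hw
      exact ⟨M.eval w, Finset.mem_filter.2 ⟨Finset.mem_univ _, hw⟩,
        pathLanguage_complete _ _ _ (hL hw) rfl (by simp)⟩
    · rintro ⟨q, hq, hw⟩
      have := (pathLanguage_sound _ _ _ hw).2
      rw [Finset.mem_filter] at hq
      rw [DFA.mem_accepts, DFA.eval, this]
      exact hq.2
  rw [e]
  exact IsUnionOfUnionFree.biUnion _ _ fun q _ => isUnionOfUnionFree_pathLanguage _ _ _

theorem EC_REG_eq_EC_UF : EC (REG T) = EC (UF T) := by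
  refine Set.Subset.antisymm (EC_subset_of_cofinite_cover fun U L hL => ?_)
    (EC_mono fun U L hL => ⟨hL.1, ?_⟩)
  · obtain ⟨l, hl, hw⟩ := isUnionOfUnionFree_of_isRegular hL.1 hL.2
    refine ⟨RegularExpression.matches' '' {R | R ∈ l}, l.finite_toSet.image _, ?_, ?_⟩
    · rintro _ ⟨R, hR, rfl⟩
      have hle : ∀ w ∈ R.matches', w ∈ L := fun w h => (hw w).2 ⟨R, hR, h⟩
      exact ⟨⟨fun w h => hL.1 (hle w h), R, hl R hR, rfl⟩, hle⟩
    · convert Set.finite_empty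
      refine Set.eq_empty_iff_forall_notMem.2 ?_
      rintro w ⟨h1, h2⟩
      obtain ⟨R, hR, h⟩ := (hw w).1 h1
      exact h2 _ ⟨R, hR, rfl⟩ h
  · obtain ⟨-, R, hR, rfl⟩ := hL
    exact hR.isRegular

end Regular

/-! ### Inclusions between the basic families -/

section Inclusions

variable {T : Type*}

theorem EC_FIN_subset (F : LangFamily T) : EC (FIN T) ⊆ EC F :=
  EC_subset_of_cofinite_cover fun U L hL =>
    ⟨∅, Set.finite_empty, by simp, hL.2.subset fun w hw => hw.1⟩

theorem finite_diff_longWords (U : Finset T) (n : ℕ) {L : Language T} (hL : L ≤ wordsOver U) :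
    {w : List T | w ∈ L ∧ w ∉ longWords U n}.Finite := by
  refine (finite_wordsOver_length_le U n).subset ?_
  rintro w ⟨h1, h2⟩
  refine ⟨hL h1, ?_⟩
  by_contra h
  exact h2 ⟨hL h1, by omega⟩

/-- Up to finitely many words, a nilpotent language is empty or consists of all words from some
length on, so no other selection languages are needed. -/
theorem EC_NIL_subset {F : LangFamily T} (h : ∀ U n, longWords U n ∈ F U) :
    EC (NIL T) ⊆ EC F := by
  refine EC_subset_of_cofinite_cover fun U L hL => ?_
  rcases hL.2 with hfin | hfin
  · exact ⟨∅, Set.finite_empty, by simp, hfin.subset fun w hw => hw.1⟩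
  · obtain ⟨n, hn⟩ := (hfin.image List.length).bddAbove
    refine ⟨{longWords U (n + 1)}, Set.finite_singleton _, ?_, ?_⟩
    · rintro _ rfl
      refine ⟨h U _, fun w hw => ?_⟩
      by_contra hwL
      have := hn ⟨w, ⟨hw.1, hwL⟩, rfl⟩
      have := hw.2
      omega
    · simpa using finite_diff_longWords U (n + 1) hL.1

theorem longWords_mem_DEF (U : Finset T) (n : ℕ) : longWords U n ∈ DEF T U := by
  have hfin : {w : List T | w ∈ wordsOver U ∧ w.length = n}.Finite :=
    (finite_wordsOver_length_le U n).subset fun w hw => ⟨hw.1, hw.2.le⟩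
  -- The long words are V*B, where B consists of all words of length exactly n.
  refine ⟨fun w hw => hw.1, ∅, hfin.toFinset, by simp, by simp +contextual, fun w => ?_⟩
  simp only [Finset.notMem_empty, false_or, Set.Finite.mem_toFinset, Set.mem_ofPred_eq]
  constructor
  · rintro ⟨h1, h2⟩
    rw [← List.take_append_drop (w.length - n) w, append_mem_wordsOver] at h1
    refine ⟨_, h1.1, _, ⟨h1.2, ?_⟩, (List.take_append_drop _ _).symm⟩
    rw [List.length_drop]
    omega
  · rintro ⟨x, hx, b, hb, rfl⟩
    refine ⟨append_mem_wordsOver.2 ⟨hx, hb.1⟩, ?_⟩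
    rw [List.length_append]
    omega

theorem longWords_mem_COMM (U : Finset T) (n : ℕ) : longWords U n ∈ COMM T U := by
  refine ⟨fun w hw => hw.1, isRegular_longWords U n, ?_⟩
  rintro v w hp ⟨h1, h2⟩
  exact ⟨fun a ha => h1 a (hp.mem_iff.2 ha), hp.length_eq ▸ h2⟩

theorem EC_NIL_subset_DEF : EC (NIL T) ⊆ EC (DEF T) := EC_NIL_subset longWords_mem_DEF

theorem EC_NIL_subset_COMM : EC (NIL T) ⊆ EC (COMM T) := EC_NIL_subset longWords_mem_COMM

theorem EC_MON_subset_NIL : EC (MON T) ⊆ EC (NIL T) := by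
  refine EC_mono fun U L hL => ⟨hL.1, Or.inr ?_⟩
  rw [hL.2]
  convert Set.finite_empty
  exact Set.eq_empty_iff_forall_notMem.2 fun w hw => hw.2 hw.1

theorem wordsOver_mem_SUF (U : Finset T) : wordsOver U ∈ SUF T U :=
  ⟨le_rfl, isRegular_wordsOver U, fun _ _ _ hy _ => hy⟩

theorem EC_MON_subset_SUF : EC (MON T) ⊆ EC (SUF T) := by
  refine EC_mono fun U L hL => ?_
  rw [hL.2]
  exact wordsOver_mem_SUF U

/-- Only the empty word separates V* from the combinational language V*V. -/
theorem EC_MON_subset_COMB : EC (MON T) ⊆ EC (COMB T) := by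
  refine EC_subset_of_cofinite fun U L hL => ⟨longWords U 1, ⟨fun w hw => hw.1, U, subset_rfl,
    fun w => ?_⟩, fun w hw => by rw [hL.2]; exact hw.1, finite_diff_longWords U 1 hL.1⟩
  constructor
  · rintro ⟨h1, h2⟩
    rcases List.eq_nil_or_concat' w with rfl | ⟨x, a, rfl⟩
    · simp at h2
    · rw [append_mem_wordsOver] at h1
      exact ⟨x, h1.1, a, (cons_mem_wordsOver.1 h1.2).1, rfl⟩
  · rintro ⟨x, hx, a, ha, rfl⟩
    exact ⟨append_mem_wordsOver.2 ⟨hx, cons_mem_wordsOver.2 ⟨ha, nil_mem_wordsOver U⟩⟩, by simp⟩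

theorem EC_COMB_subset_DEF : EC (COMB T) ⊆ EC (DEF T) := by
  classical
  refine EC_mono fun U L hL => ⟨hL.1, ?_⟩
  obtain ⟨X, hX, h⟩ := hL.2
  refine ⟨∅, X.image fun a => [a], by simp, ?_, fun w => ?_⟩
  · intro w hw
    obtain ⟨a, ha, rfl⟩ := Finset.mem_image.1 hw
    exact cons_mem_wordsOver.2 ⟨hX ha, nil_mem_wordsOver U⟩
  · rw [h]
    simp

/-- The states reached by powers of x are eventually periodic, so one sufficiently high accepted
power produces arbitrarily high accepted powers. Every power of x is a suffix of one of these, hence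
accepted as well. -/
theorem EC_SUF_subset_PS : EC (SUF T) ⊆ EC (PS T) := by
  refine EC_mono fun U L hL => ⟨hL.1, hL.2.1, ?_⟩
  obtain ⟨Z, _, M, rfl⟩ := hL.2.1
  refine ⟨Fintype.card Z + 1, by omega, fun x hx => ?_⟩
  by_cases h : ∀ n, Fintype.card Z + 1 ≤ n → wordPow x n ∉ M.accepts
  · exact Or.inl h
  right
  push Not at h
  obtain ⟨n, hn, hnL⟩ := h
  obtain ⟨i, j, hij, he⟩ := Fintype.exists_ne_map_eq_of_card_lt
    (fun i : Fin (Fintype.card Z + 1) => M.eval (wordPow x i)) (by simp)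
  wlog hlt : i < j generalizing i j
  · exact this j i hij.symm he.symm (lt_of_le_of_ne (not_lt.1 hlt) hij.symm)
  have hlt' : (i : ℕ) < j := hlt
  have heval : ∀ a b, M.eval (wordPow x (a + b)) = M.evalFrom (M.eval (wordPow x a)) (wordPow x b) :=
    fun a b => by rw [wordPow_add, DFA.eval, DFA.evalFrom_of_append]
  have hstep : ∀ m, (i : ℕ) ≤ m → M.eval (wordPow x (m + (j - i))) = M.eval (wordPow x m) := by
    intro m hm
    have e1 : m + (j - i) = j + (m - i) := by omega
    have e2 : m = i + (m - i) := by omega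
    rw [e1, heval]
    conv_rhs => rw [e2, heval]
    exact congrArg (fun z => M.evalFrom z _) he.symm
  have hiter : ∀ t, wordPow x (n + t * (j - i)) ∈ M.accepts := by
    intro t
    induction t with
    | zero => simpa using hnL
    | succ t ih =>
      have e : n + (t + 1) * (j - i) = n + t * (j - i) + (j - i) := by ring
      have hi : (i : ℕ) ≤ n + t * (j - i) := le_trans (by omega) (Nat.le_add_right _ _)
      rw [DFA.mem_accepts, e, hstep _ hi]
      exact ih
  -- The accepted exponent n + m(j - i) is at least m, because the period j - i is positive.
  intro m _
  have hm : m ≤ n + m * (j - i) :=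
    (Nat.le_mul_of_pos_right m (by omega)).trans (Nat.le_add_left _ _)
  have hd := hiter m
  rw [← Nat.sub_add_cancel hm, wordPow_add] at hd
  exact hL.2.2 _ (wordPow_mem_wordsOver hx _) _ (wordPow_mem_wordsOver hx _) hd

theorem EC_NC_subset_PS : EC (NC T) ⊆ EC (PS T) := by
  refine EC_mono fun U L hL => ⟨hL.1, hL.2.1, ?_⟩
  obtain ⟨k, hk, h⟩ := hL.2.2
  refine ⟨k, hk, fun x hx => ?_⟩
  have key : ∀ n, k ≤ n → (wordPow x n ∈ L ↔ wordPow x k ∈ L) := by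
    intro n hn
    induction n, hn using Nat.le_induction with
    | base => rfl
    | succ n hn ih =>
      rw [← ih]
      have := h (wordPow x (n - k)) (wordPow_mem_wordsOver hx _) x hx [] (nil_mem_wordsOver U)
      rw [List.append_nil, List.append_nil, ← wordPow_add, ← wordPow_add] at this
      rw [show n + 1 = n - k + (k + 1) by omega, ← this, Nat.sub_add_cancel hn]
  by_cases hx : wordPow x k ∈ L
  · exact Or.inr fun n hn => (key n hn).2 hx
  · exact Or.inl fun n hn h => hx ((key n hn).1 h)

theorem EC_PS_subset_REG : EC (PS T) ⊆ EC (REG T) :=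
  EC_mono fun _ _ hL => ⟨hL.1, hL.2.1⟩

theorem EC_CIRC_subset_REG : EC (CIRC T) ⊆ EC (REG T) :=
  EC_mono fun _ _ hL => ⟨hL.1, hL.2.1⟩

theorem EC_COMM_subset_CIRC : EC (COMM T) ⊆ EC (CIRC T) :=
  EC_mono fun _ _ hL => ⟨hL.1, hL.2.1, fun _ _ h => hL.2.2 _ _ List.perm_append_comm h⟩

theorem EC_SLTk_subset_SLT (k : ℕ) (hk : 1 ≤ k) : EC (SLTk T k) ⊆ EC (SLT T) :=
  EC_mono fun _ _ hL => ⟨hL.1, k, hk, hL.2⟩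

theorem evalFrom_monotone {V : Finset T} {Z : Type*} [LinearOrder Z] {M : DFA T Z}
    (hM : ∀ a ∈ V, Monotone fun z : Z => M.step z a) {w : List T} (hw : w ∈ wordsOver V) :
    Monotone fun z : Z => M.evalFrom z w := by
  induction w with
  | nil => exact fun _ _ h => h
  | cons a w ih =>
    rw [cons_mem_wordsOver] at hw
    exact fun x y h => ih hw.2 (hM a hw.1 h)

/-- Since z and f z are comparable, the orbit of z is a monotone or antitone sequence. A repetition
among its first card + 1 members forces it to be constant in between, hence to have reached a fixed
point. -/
theorem iterate_card_eq_of_monotone {Z : Type*} [Fintype Z] [LinearOrder Z] {f : Z → Z}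
    (hf : Monotone f) (z : Z) : f^[Fintype.card Z] z = f^[Fintype.card Z + 1] z := by
  obtain ⟨i, j, hij, he⟩ := Fintype.exists_ne_map_eq_of_card_lt
    (fun i : Fin (Fintype.card Z + 1) => f^[i] z) (by simp)
  wlog hlt : i < j generalizing i j
  · exact this j i hij.symm he.symm (lt_of_le_of_ne (not_lt.1 hlt) hij.symm)
  have hlt' : (i : ℕ) + 1 ≤ j := hlt
  have hfix : f^[i] z = f^[i + 1] z := by
    rcases le_total z (f z) with h | h
    · have hm := hf.monotone_iterate_of_le_map h
      exact le_antisymm (hm (Nat.le_succ _)) ((hm hlt').trans he.ge)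
    · have hm := hf.antitone_iterate_of_map_le h
      exact le_antisymm (he.le.trans (hm hlt')) (hm (Nat.le_succ _))
  have hi : Fintype.card Z = (Fintype.card Z - i) + i := by omega
  rw [hi, Function.iterate_add_apply, hfix, ← Function.iterate_add_apply]
  rfl

theorem evalFrom_wordPow {Z : Type*} (M : DFA T Z) (y : List T) (n : ℕ) (z : Z) :
    M.evalFrom z (wordPow y n) = (fun z => M.evalFrom z y)^[n] z := by
  induction n generalizing z with
  | zero => rfl
  | succ n ih => rw [wordPow_succ, DFA.evalFrom_of_append, ih, Function.iterate_succ_apply]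

theorem EC_ORD_subset_NC : EC (ORD T) ⊆ EC (NC T) := by
  refine EC_mono fun U L hL => ⟨hL.1, ?_⟩
  obtain ⟨Z, _, _, M, hM, h⟩ := hL.2
  have e : L = acceptsOver U M := Set.ext h
  -- The number of states would already suffice as exponent. Adding one makes the bound 1 ≤ k
  -- immediate.
  refine ⟨e ▸ isRegular_acceptsOver U M, Fintype.card Z + 1, by omega, fun x hx y hy z hz => ?_⟩
  rw [e]
  simp only [mem_acceptsOver, append_mem_wordsOver, hx, hz, wordPow_mem_wordsOver hy, true_and]
  rw [DFA.eval, DFA.evalFrom_of_append, DFA.evalFrom_of_append, DFA.evalFrom_of_append,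
    DFA.evalFrom_of_append, evalFrom_wordPow, evalFrom_wordPow, Function.iterate_succ_apply,
    Function.iterate_succ_apply _ (Fintype.card Z + 1),
    iterate_card_eq_of_monotone (evalFrom_monotone hM hy), Function.iterate_succ_apply _ (Fintype.card Z)]

end Inclusions

/-! ### Strictly locally testable languages -/

section LocallyTestable

variable {T : Type*}

theorem take_drop_append_left {x y : List T} {j k : ℕ} (h : j + k ≤ x.length) :
    ((x ++ y).drop j).take k = (x.drop j).take k := by
  rw [List.drop_append_of_le_length (by omega),
    List.take_append_of_le_length (by rw [List.length_drop]; omega)]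

theorem drop_append_right {x y : List T} {j : ℕ} (h : x.length ≤ j) :
    (x ++ y).drop j = y.drop (j - x.length) := by
  rw [List.drop_append, List.drop_eq_nil_of_le h, List.nil_append]

/-- The form in which local testability is used: membership passes to a word with the same two ends
and no new interior factors. The sets B, I, E disappear from view. -/
theorem IsStrictlyLocallyTestable.mem_of_factors {k : ℕ} {V : Finset T} {L : Language T}
    (hL : IsStrictlyLocallyTestable k V L) {w w' : List T} (hw : w ∈ wordsOver V)
    (hw' : w' ∈ wordsOver V) (hk : k ≤ w.length) (hk' : k ≤ w'.length)
    (hpre : w'.take k = w.take k)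
    (hsuf : w'.drop (w'.length - k) = w.drop (w.length - k))
    (hint : ∀ j, 1 ≤ j → j + k + 1 ≤ w'.length → ∃ i, 1 ≤ i ∧ i + k + 1 ≤ w.length ∧
      (w'.drop j).take k = (w.drop i).take k)
    (h : w ∈ L) : w' ∈ L := by
  obtain ⟨B, I, E, -, -, -, hL⟩ := hL
  rw [hL w hw hk] at h
  rw [hL w' hw' hk', hpre, hsuf]
  refine ⟨h.1, fun j h1 h2 => ?_, h.2.2⟩
  obtain ⟨i, h3, h4, h5⟩ := hint j h1 h2
  rw [h5]
  exact h.2.1 i h3 h4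

/-- One more copy of y in a long power p creates no new window of length k: a window lies inside the
common prefix xp or, after a shift by |y|, inside the common suffix pz. -/
theorem isNonCounting_of_isStrictlyLocallyTestable {k : ℕ} {V : Finset T} {L : Language T}
    (hL : IsStrictlyLocallyTestable k V L) : IsNonCounting V L := by
  -- With k + 2 copies of a non-empty y, the power has length at least k + 1 + |y|. A window that
  -- leaves xp on the right can then be shifted back by |y| without leaving pz.
  refine ⟨k + 2, by omega, fun x hx y hy z hz => ?_⟩
  rcases eq_or_ne y [] with rfl | hy0
  · simp [wordPow]
  have hlen : 1 ≤ y.length := List.length_pos_iff.2 hy0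
  obtain ⟨p, hp⟩ : ∃ p, p = wordPow y (k + 2) := ⟨_, rfl⟩
  have hpV : p ∈ wordsOver V := hp ▸ wordPow_mem_wordsOver hy _
  have hpl : k + 1 + y.length ≤ p.length := by
    rw [hp, length_wordPow]
    nlinarith
  have e1 : x ++ wordPow y (k + 2 + 1) ++ z = x ++ p ++ (y ++ z) := by
    rw [wordPow_add, show wordPow y 1 = y by simp [wordPow]]
    simp [hp]
  -- Since p is a power of y, the additional copy may be read on either side of p. This gives both
  -- the common prefix and the common suffix.
  have e2 : x ++ p ++ (y ++ z) = x ++ y ++ (p ++ z) := by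
    rw [← e1, wordPow_succ]
    simp [hp]
  rw [e1, ← hp]
  have hA : x ++ p ++ z ∈ wordsOver V := by simp only [append_mem_wordsOver, hx, hz, hpV, and_self]
  have hB : x ++ p ++ (y ++ z) ∈ wordsOver V := by
    simp only [append_mem_wordsOver, hx, hy, hz, hpV, and_self]
  have lA : (x ++ p ++ z).length = x.length + p.length + z.length := by
    simp only [List.length_append]
  have lB : (x ++ p ++ (y ++ z)).length = x.length + p.length + y.length + z.length := by
    simp only [List.length_append]
    omega
  have hleft : ∀ j q, j + k ≤ x.length + p.length →
      ((x ++ p ++ q).drop j).take k = ((x ++ p).drop j).take k := fun j q hj =>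
    take_drop_append_left (by rwa [List.length_append])
  have hright : ∀ j, x.length ≤ j →
      (x ++ p ++ (y ++ z)).drop (j + y.length) = (x ++ p ++ z).drop j := by
    intro j hj
    have hj' : (x ++ y).length ≤ j + y.length := by rw [List.length_append]; omega
    rw [e2, drop_append_right hj', List.append_assoc x p z, drop_append_right hj,
      List.length_append]
    congr 1
    omega
  have hpre : (x ++ p ++ (y ++ z)).take k = (x ++ p ++ z).take k :=
    (hleft 0 _ (by omega)).trans (hleft 0 _ (by omega)).symm
  have hsuf : (x ++ p ++ (y ++ z)).drop ((x ++ p ++ (y ++ z)).length - k) =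
      (x ++ p ++ z).drop ((x ++ p ++ z).length - k) := by
    rw [← hright _ (by omega)]
    congr 1
    omega
  constructor
  · refine hL.mem_of_factors hA hB (by omega) (by omega) hpre hsuf fun j h1 h2 => ?_
    by_cases hj : j + k + 1 ≤ x.length + p.length
    · exact ⟨j, h1, by omega, (hleft j _ (by omega)).trans (hleft j _ (by omega)).symm⟩
    · refine ⟨j - y.length, by omega, by omega, ?_⟩
      rw [← hright (j - y.length) (by omega), Nat.sub_add_cancel (by omega)]
  · refine hL.mem_of_factors hB hA (by omega) (by omega) hpre.symm hsuf.symm fun j h1 h2 => ?_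
    by_cases hj : j + k ≤ x.length + p.length
    · exact ⟨j, h1, by omega, (hleft j _ hj).trans (hleft j _ hj).symm⟩
    · exact ⟨j + y.length, by omega, by omega, by rw [hright j (by omega)]⟩

/-- The quotient by a word of length above k is determined by its first k letters, its last k
letters and its set of interior factors. Shorter words over V are finite in number, and words not
over V have an empty quotient. -/
theorem isRegular_of_isStrictlyLocallyTestable {k : ℕ} {V : Finset T} {L : Language T}
    (hle : L ≤ wordsOver V) (hL : IsStrictlyLocallyTestable k V L) : L.IsRegular := by
  refine .of_finite_range_leftQuotient ?_
  have hshort := (finite_wordsOver_length_le V k).image L.leftQuotient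
  have hwin := finite_wordsOver_length_le V k
  have htake : ∀ w ∈ wordsOver V, ∀ i, ((w.drop i).take k) ∈
      {w : List T | w ∈ wordsOver V ∧ w.length ≤ k} := fun w hw i =>
    ⟨fun a ha => hw a (List.mem_of_mem_drop (List.mem_of_mem_take ha)), List.length_take_le _ _⟩
  have hlong : (L.leftQuotient '' longWords V (k + 1)).Finite := by
    refine finite_image_of_factor (fun w => (w.take k, w.drop (w.length - k),
      {v | ∃ j, 1 ≤ j ∧ j + k + 1 ≤ w.length ∧ v = (w.drop j).take k}))
      ((hwin.prod (hwin.prod hwin.finite_subsets)).subset ?_) ?_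
    · rintro _ ⟨w, hw, rfl⟩
      refine ⟨htake w hw.1 0, ⟨fun a ha => hw.1 a (List.mem_of_mem_drop ha), ?_⟩, ?_⟩
      · simp only [List.length_drop]
        omega
      · rintro _ ⟨j, -, -, rfl⟩
        exact htake w hw.1 j
    · have key : ∀ w ∈ longWords V (k + 1), ∀ w' ∈ longWords V (k + 1), w'.take k = w.take k →
          w'.drop (w'.length - k) = w.drop (w.length - k) →
          (∀ v, (∃ j, 1 ≤ j ∧ j + k + 1 ≤ w'.length ∧ v = (w'.drop j).take k) →
            ∃ j, 1 ≤ j ∧ j + k + 1 ≤ w.length ∧ v = (w.drop j).take k) →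
          ∀ y, w ++ y ∈ L → w' ++ y ∈ L := by
        intro w hw w' hw' hpre hsuf hint y hy
        have hl := hw.2
        have hl' := hw'.2
        have hyV : w ++ y ∈ wordsOver V := hle hy
        rw [append_mem_wordsOver] at hyV
        have hdrop : ∀ i, (w' ++ y).drop (w'.length - k + i) = (w ++ y).drop (w.length - k + i) := by
          intro i
          rw [← List.drop_drop, ← List.drop_drop,
            List.drop_append_of_le_length (Nat.sub_le w'.length k),
            List.drop_append_of_le_length (Nat.sub_le w.length k), hsuf]
        refine hL.mem_of_factors (append_mem_wordsOver.2 hyV)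
          (append_mem_wordsOver.2 ⟨hw'.1, hyV.2⟩) (by simp; omega) (by simp; omega) ?_ ?_ ?_ hy
        · rw [List.take_append_of_le_length (by omega), List.take_append_of_le_length (by omega),
            hpre]
        · have := hdrop y.length
          rw [List.length_append, List.length_append]
          convert this using 2 <;> omega
        · intro j h1 h2
          rw [List.length_append] at h2
          by_cases hj : j + k + 1 ≤ w'.length
          · obtain ⟨i, h3, h4, h5⟩ := hint _ ⟨j, h1, hj, rfl⟩
            refine ⟨i, h3, by simp; omega, ?_⟩
            rw [take_drop_append_left (by omega), take_drop_append_left (by omega), h5]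
          -- Such a window starts within the last k letters of w' or later, so it is matched with
          -- the window at the same distance from the end of w.
          · refine ⟨w.length - k + (j - (w'.length - k)), by omega, by simp; omega, ?_⟩
            rw [← hdrop, Nat.add_sub_cancel' (by omega)]
      intro w hw w' hw' h
      simp only [Prod.mk.injEq] at h
      ext y
      exact ⟨key w hw w' hw' h.1.symm h.2.1.symm (fun v hv => (Set.ext_iff.1 h.2.2 v).2 hv) y,
        key w' hw' w hw h.1 h.2.1 (fun v hv => (Set.ext_iff.1 h.2.2 v).1 hv) y⟩
  refine ((hshort.union hlong).insert 0).subset ?_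
  rintro _ ⟨w, rfl⟩
  by_cases hw : w ∈ wordsOver V
  · rcases Nat.lt_or_ge k w.length with h | h
    · exact Or.inr (Or.inr ⟨w, ⟨hw, h⟩, rfl⟩)
    · exact Or.inr (Or.inl ⟨w, ⟨hw, h⟩, rfl⟩)
  · left
    ext y
    exact ⟨fun h => absurd (append_mem_wordsOver.1 (hle h)).1 hw,
      fun h => absurd h (Language.notMem_zero y)⟩

theorem EC_SLT_subset_NC : EC (SLT T) ⊆ EC (NC T) := by
  refine EC_mono fun U L hL => ⟨hL.1, ?_⟩
  obtain ⟨hle, k, -, h⟩ := hL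
  exact ⟨isRegular_of_isStrictlyLocallyTestable hle h,
    isNonCounting_of_isStrictlyLocallyTestable h⟩

/-- A window of length k + 1 checks two overlapping windows of length k: the first window tests B
then I, an interior one I then I, the last one I then E. -/
theorem EC_SLTk_subset_succ (k : ℕ) : EC (SLTk T k) ⊆ EC (SLTk T (k + 1)) := by
  refine EC_subset_of_cofinite fun U L hL => ?_
  obtain ⟨B, I, E, -, -, -, h⟩ := hL.2
  let N : Set (List T) → Set (List T) → Set (List T) := fun P Q =>
    {v | (v ∈ wordsOver U ∧ v.length = k + 1) ∧ v.take k ∈ P ∧ v.drop 1 ∈ Q}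
  have hdrop : ∀ (w : List T) j, ((w.drop j).take (k + 1)).drop 1 = (w.drop (j + 1)).take k := by
    intro w j
    rw [List.drop_take, List.drop_drop, Nat.add_sub_cancel]
  have htake : ∀ w : List T, (w.take (k + 1)).take k = w.take k := fun w => by
    rw [List.take_take, min_eq_left (Nat.le_succ k)]
  let K : Language T := {w | w ∈ wordsOver U ∧ k + 1 ≤ w.length ∧ w.take (k + 1) ∈ N B I ∧
    (∀ j, 1 ≤ j → j + (k + 1) + 1 ≤ w.length → (w.drop j).take (k + 1) ∈ N I I) ∧
    w.drop (w.length - (k + 1)) ∈ N I E}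
  refine ⟨K, ⟨fun w hw => hw.1, N B I, N I I, N I E, fun w hw => hw.1, fun w hw => hw.1,
    fun w hw => hw.1, fun w hw hk => ⟨fun h => h.2.2, fun h => ⟨hw, hk, h⟩⟩⟩, ?_, ?_⟩
  · rintro w ⟨hw, hk, h1, h2, h3⟩
    rw [h w hw (by omega)]
    refine ⟨htake w ▸ h1.2.1, fun j hj1 hj2 => ?_, ?_⟩
    · obtain ⟨i, rfl⟩ : ∃ i, j = i + 1 := ⟨j - 1, by omega⟩
      rw [← hdrop]
      rcases Nat.eq_zero_or_pos i with rfl | hi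
      · exact h1.2.2
      · exact (h2 i hi (by omega)).2.2
    · have := h3.2.2
      rw [List.drop_drop] at this
      convert this using 2
      omega
  -- From length k + 2 on, the second and the penultimate window of length k are interior, so the
  -- combined tests are no stronger than the old ones. Words of length k + 1 may be lost.
  · refine (finite_diff_longWords U (k + 2) hL.1).subset fun w hw => ⟨hw.1, fun hl => hw.2 ?_⟩
    have hw' := hw.1
    have hlen := hl.2
    rw [h w hl.1 (by omega)] at hw'
    obtain ⟨h1, h2, h3⟩ := hw'
    have hsub : ∀ j, (w.drop j).take (k + 1) ∈ wordsOver U := fun j a ha =>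
      hl.1 a (List.mem_of_mem_drop (List.mem_of_mem_take ha))
    refine ⟨hl.1, by omega, ⟨⟨hsub 0, ?_⟩, ?_, ?_⟩, fun j hj1 hj2 => ⟨⟨hsub j, ?_⟩, ?_, ?_⟩,
      ⟨⟨fun a ha => hl.1 a (List.mem_of_mem_drop ha), ?_⟩, ?_, ?_⟩⟩
    · rw [List.length_take]
      omega
    · rwa [htake]
    · exact hdrop w 0 ▸ h2 1 le_rfl (by omega)
    · rw [List.length_take, List.length_drop]
      omega
    · rw [htake]
      exact h2 j hj1 (by omega)
    · rw [hdrop]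
      exact h2 (j + 1) (by omega) (by omega)
    · rw [List.length_drop]
      omega
    · exact h2 _ (by omega) (by omega)
    · rw [List.drop_drop]
      convert h3 using 2
      omega

theorem singleton_suffix_mem_SLTk (U : Finset T) {b : List T} (hb : b ∈ wordsOver U) {k : ℕ}
    (hk : b.length = k) : {w | ∃ x ∈ wordsOver U, w = x ++ b} ∈ SLTk T k U := by
  subst hk
  refine ⟨?_, {w | w ∈ wordsOver U ∧ w.length = b.length},
    {w | w ∈ wordsOver U ∧ w.length = b.length}, {b}, fun w hw => hw, fun w hw => hw, ?_, ?_⟩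
  · rintro w ⟨x, hx, rfl⟩
    exact append_mem_wordsOver.2 ⟨hx, hb⟩
  · rintro w rfl
    exact ⟨hb, rfl⟩
  · intro w hw hl
    have hsub : ∀ i, (w.drop i).take b.length ∈ wordsOver U := fun i a ha =>
      hw a (List.mem_of_mem_drop (List.mem_of_mem_take ha))
    constructor
    · rintro ⟨x, hx, rfl⟩
      refine ⟨⟨hsub 0, by rw [List.length_take, min_eq_left hl]⟩, fun j h1 h2 => ⟨hsub j, ?_⟩, ?_⟩
      · rw [List.length_take, List.length_drop, min_eq_left (by omega)]
      · simp
    · rintro ⟨-, -, h⟩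
      refine ⟨w.take (w.length - b.length), fun a ha => hw a (List.mem_of_mem_take ha), ?_⟩
      conv_lhs => rw [← List.take_append_drop (w.length - b.length) w]
      rw [show w.drop (w.length - b.length) = b from h]

theorem wordsOver_mem_SLTk_one (U : Finset T) : wordsOver U ∈ SLTk T 1 U := by
  refine ⟨le_rfl, {w | w ∈ wordsOver U ∧ w.length = 1}, {w | w ∈ wordsOver U ∧ w.length = 1},
    {w | w ∈ wordsOver U ∧ w.length = 1}, fun w hw => hw, fun w hw => hw, fun w hw => hw, ?_⟩
  intro w hw hl
  refine ⟨fun _ => ⟨⟨fun a ha => hw a (List.mem_of_mem_take ha), by simpa using hl⟩,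
    fun j h1 h2 => ⟨fun a ha => hw a (List.mem_of_mem_drop (List.mem_of_mem_take ha)), ?_⟩,
    ⟨fun a ha => hw a (List.mem_of_mem_drop ha), ?_⟩⟩, fun _ => hw⟩
  · rw [List.length_take, List.length_drop, min_eq_left (by omega)]
  · rw [List.length_drop]
    omega

/-- It suffices to consider the definite languages `V* b` with a single word `b`. -/
theorem EC_DEF_subset {F : LangFamily T}
    (h : ∀ U, ∀ b ∈ wordsOver U, {w : List T | ∃ x ∈ wordsOver U, w = x ++ b} ∈ F U) :
    EC (DEF T) ⊆ EC F := by
  refine EC_subset_of_cofinite_cover fun U L hL => ?_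
  obtain ⟨A, B, hA, hB, hw⟩ := hL.2
  refine ⟨(fun b => {w : List T | ∃ x ∈ wordsOver U, w = x ++ b}) '' B, B.finite_toSet.image _,
    ?_, A.finite_toSet.subset ?_⟩
  · rintro _ ⟨b, hb, rfl⟩
    refine ⟨h U b (hB b hb), ?_⟩
    rintro w ⟨x, hx, rfl⟩
    exact (hw _).2 (Or.inr ⟨x, hx, b, hb, rfl⟩)
  · rintro w ⟨h1, h2⟩
    refine ((hw w).1 h1).resolve_right ?_
    rintro ⟨x, hx, b, hb, rfl⟩
    exact h2 _ ⟨b, hb, rfl⟩ ⟨x, hx, rfl⟩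

theorem EC_DEF_subset_SLT : EC (DEF T) ⊆ EC (SLT T) := by
  refine EC_DEF_subset fun U b hb => ?_
  -- Windows of length |b| work only for non-empty b. For the empty word the language is V*, which
  -- is tested with windows of length 1.
  rcases eq_or_ne b [] with rfl | h0
  · have h := wordsOver_mem_SLTk_one U
    have e : {w : List T | ∃ x ∈ wordsOver U, w = x ++ []} = wordsOver U :=
      Set.ext fun w => ⟨fun ⟨x, hx, h⟩ => by rw [h, List.append_nil]; exact hx,
        fun hw => ⟨w, hw, (List.append_nil w).symm⟩⟩
    refine ⟨?_, 1, le_rfl, ?_⟩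
    · rw [e]
    · rw [e]
      exact h.2
  · have h := singleton_suffix_mem_SLTk U hb rfl
    exact ⟨h.1, _, List.length_pos_iff.2 h0, h.2⟩

theorem EC_COMB_subset_SLTk_one : EC (COMB T) ⊆ EC (SLTk T 1) := by
  refine EC_mono fun U L hL => ⟨hL.1, ?_⟩
  obtain ⟨X, hX, h⟩ := hL.2
  refine ⟨{w | w ∈ wordsOver U ∧ w.length = 1}, {w | w ∈ wordsOver U ∧ w.length = 1},
    {w | ∃ a ∈ X, w = [a]}, fun w hw => hw, fun w hw => hw, ?_, fun w hw hl => ?_⟩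
  · rintro w ⟨a, ha, rfl⟩
    exact ⟨cons_mem_wordsOver.2 ⟨hX ha, nil_mem_wordsOver U⟩, rfl⟩
  · rw [h]
    constructor
    · rintro ⟨x, hx, a, ha, rfl⟩
      refine ⟨⟨fun a ha => hw a (List.mem_of_mem_take ha), by simp⟩,
        fun j h1 h2 => ⟨fun a ha => hw a (List.mem_of_mem_drop (List.mem_of_mem_take ha)), ?_⟩,
        ⟨a, ha, by simp⟩⟩
      rw [List.length_take, List.length_drop]
      omega
    · rintro ⟨-, -, a, ha, h⟩
      refine ⟨w.take (w.length - 1), fun a ha => hw a (List.mem_of_mem_take ha), a, ha, ?_⟩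
      rw [← h, List.take_append_drop]

end LocallyTestable

/-! ### Ordered automata for local and definite conditions -/

section Ordered

variable {T : Type*}

open Classical in
/-- The state reached by reading `a` from a live state of `localAutomaton`. -/
noncomputable def localStep (I E : Set (List T)) (a : T) : Fin 7 :=
  if [a] ∈ I then (if [a] ∈ E then 3 else 2) else (if [a] ∈ E then 1 else 0)

open Classical in
/-- An ordered automaton for the words of length at least two with first letter in `B`, last letter
in `E` and all other letters in `I`. -/
noncomputable def localAutomaton (B I E : Set (List T)) : DFA T (Fin 7) where
  step z a :=
    if z = 6 then 6 else if z = 5 then (if [a] ∈ B then 4 else 6) else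
      if z ≤ 1 then 0 else localStep I E a
  start := 5
  accept := {1, 3}

/-- All letters of a word belong to `I`. -/
def AllLetters (I : Set (List T)) (w : List T) : Prop := ∀ c ∈ w, [c] ∈ I

theorem localStep_lt (I E : Set (List T)) (a : T) : localStep I E a < 4 := by
  unfold localStep
  split_ifs <;> decide

/-- The states are arranged by their future: 0 and 1 (from which every letter leads to rejection) go
to 0; the live states 2, 3, 4 go to a common value between 0 and 3; the start state 5 and the sink 6
go to 4 or 6. The images therefore increase from block to block. -/
theorem monotone_localAutomaton (B I E : Set (List T)) (a : T) :
    Monotone fun z => (localAutomaton B I E).step z a := by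
  have h := localStep_lt I E a
  revert h
  unfold localAutomaton
  dsimp only
  generalize localStep I E a = s
  split_ifs <;> revert s <;> decide

open Classical in
theorem eval_localAutomaton (B I E : Set (List T)) (a : T) (w : List T) (b : T) :
    (localAutomaton B I E).eval (a :: (w ++ [b])) =
      if [a] ∈ B then (if AllLetters I w then localStep I E b else 0) else 6 := by
  induction w using List.reverseRecOn generalizing b with
  | nil =>
    rw [← List.cons_append, DFA.eval_append_singleton, DFA.eval_singleton]
    unfold localAutomaton
    by_cases ha : [a] ∈ B <;> simp [ha, AllLetters]
  | append_singleton w c ih =>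
    rw [← List.cons_append, DFA.eval_append_singleton, ih]
    unfold localAutomaton
    have e : AllLetters I (w ++ [c]) ↔ AllLetters I w ∧ [c] ∈ I := by
      simp [AllLetters, or_imp, forall_and]
    simp only [e]
    by_cases ha : [a] ∈ B
    · by_cases hw : AllLetters I w
      · by_cases hc : [c] ∈ I <;> by_cases hcE : [c] ∈ E <;> simp [ha, hw, hc, hcE, localStep]
      · simp [ha, hw]
    · simp [ha]

/-- The conditions on first, interior and last letters involve distinct positions once the length is
two, so `localAutomaton` represents the language up to finitely many short words. -/
theorem EC_SLTk_one_subset_ORD : EC (SLTk T 1) ⊆ EC (ORD T) := by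
  refine EC_subset_of_cofinite fun U L hL => ?_
  obtain ⟨B, I, E, -, -, -, h⟩ := hL.2
  have key : ∀ w ∈ longWords U 2, (w ∈ L ↔ w ∈ (localAutomaton B I E).accepts) := by
    rintro w ⟨hw, hl⟩
    rw [h w hw (by omega), DFA.mem_accepts]
    rcases w with _ | ⟨a, w⟩
    · simp at hl
    rcases List.eq_nil_or_concat' w with rfl | ⟨w, b, rfl⟩
    · simp at hl
    rw [eval_localAutomaton]
    have hint : (∀ j, 1 ≤ j → j + 1 + 1 ≤ (a :: (w ++ [b])).length →
        ((a :: (w ++ [b])).drop j).take 1 ∈ I) ↔ AllLetters I w := by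
      have hget : ∀ i (hi : i < w.length),
          ((a :: (w ++ [b])).drop (i + 1)).take 1 = [w[i]] := by
        intro i hi
        rw [List.drop_succ_cons, List.drop_append_of_le_length hi.le,
          List.drop_eq_getElem_cons hi]
        rfl
      constructor
      · intro hj c hc
        obtain ⟨i, hi, rfl⟩ := List.mem_iff_getElem.1 hc
        rw [← hget i hi]
        exact hj _ (by omega) (by simp; omega)
      · intro hc j h1 h2
        obtain ⟨i, rfl⟩ : ∃ i, j = i + 1 := ⟨j - 1, by omega⟩
        have hi : i < w.length := by
          simp at h2
          omega
        rw [hget i hi]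
        exact hc _ (List.getElem_mem hi)
    rw [hint]
    have hlast : (a :: (w ++ [b])).drop ((a :: (w ++ [b])).length - 1) = [b] := by simp
    rw [hlast]
    change [a] ∈ B ∧ _ ∧ _ ↔ _
    by_cases ha : [a] ∈ B
    · by_cases hw : AllLetters I w
      · by_cases hc : [b] ∈ I <;> by_cases hcE : [b] ∈ E <;>
          simp [ha, hw, hc, hcE, localStep, localAutomaton]
      · simp [ha, hw, localAutomaton]
    · simp [ha, localAutomaton]
  have hstart : ∀ w, w.length < 2 → w ∉ (localAutomaton B I E).accepts := by
    intro w hw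
    rw [DFA.mem_accepts]
    rcases w with _ | ⟨a, _ | ⟨b, w⟩⟩
    · simp [localAutomaton]
    · rw [DFA.eval_singleton]
      by_cases ha : [a] ∈ B <;> simp [localAutomaton, ha]
    · simp at hw
  refine ⟨acceptsOver U (localAutomaton B I E), ⟨fun w hw => hw.1, Fin 7, inferInstance,
    inferInstance, localAutomaton B I E, fun a _ => monotone_localAutomaton B I E a,
    fun w => Iff.rfl⟩, fun w hw => ?_, (finite_diff_longWords U 2 hL.1).subset fun w hw =>
    ⟨hw.1, fun hl => hw.2 ⟨hl.1, (key w hl).1 hw.1⟩⟩⟩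
  by_cases hl : 2 ≤ w.length
  · exact (key w ⟨hw.1, hl⟩).2 hw.2
  · exact absurd hw.2 (hstart w (by omega))

/-- The automaton that stores the last `N + 1` letters as the digits of a number in base `M`, the
most recent letter being the most significant digit; the least significant digit is ignored for
acceptance. -/
def bufferAutomaton (c : T → ℕ) (M N : ℕ) (hM : 0 < M) (hc : ∀ a, c a < M) (d : ℕ) :
    DFA T (Fin (M ^ (N + 1))) where
  step z a := ⟨c a * M ^ N + z / M, by
    have h1 : (z : ℕ) / M < M ^ N := by
      rw [Nat.div_lt_iff_lt_mul hM, ← pow_succ]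
      exact z.2
    calc c a * M ^ N + z / M < c a * M ^ N + M ^ N := by omega
      _ = (c a + 1) * M ^ N := by ring
      _ ≤ M * M ^ N := Nat.mul_le_mul_right _ (hc a)
      _ = M ^ (N + 1) := by ring⟩
  start := ⟨0, Nat.pow_pos hM⟩
  accept := {z | (z : ℕ) / M = d}

/-- The number with the given digits, the most significant digit first. -/
def digitsValue (c : T → ℕ) (M : ℕ) : List T → ℕ
  | [] => 0
  | a :: r => c a * M ^ r.length + digitsValue c M r

theorem digitsValue_lt {c : T → ℕ} {M : ℕ} (hc : ∀ a, c a < M) (r : List T) :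
    digitsValue c M r < M ^ r.length := by
  induction r with
  | nil => simp [digitsValue]
  | cons a r ih =>
    calc c a * M ^ r.length + digitsValue c M r < c a * M ^ r.length + M ^ r.length := by omega
      _ = (c a + 1) * M ^ r.length := by ring
      _ ≤ M * M ^ r.length := Nat.mul_le_mul_right _ (hc a)
      _ = M ^ (r.length + 1) := by ring

/-- Division by a power of M extracts the |β| leading digits, which encode the most recent letters,
newest first. For this reason the input word is reversed. The digit 0 stands for a place not yet
filled and must differ from the digits of letters of U. -/
theorem eval_bufferAutomaton {c : T → ℕ} {M N : ℕ} (hM : 0 < M) (hc : ∀ a, c a < M) (d : ℕ)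
    {U : Finset T} (hpos : ∀ a ∈ U, 0 < c a) (hinj : ∀ a ∈ U, ∀ b ∈ U, c a = c b → a = b)
    (β r : List T) (hβ : β ∈ wordsOver U) (hr : r ∈ wordsOver U) (hN : β.length ≤ N + 1) :
    ((bufferAutomaton c M N hM hc d).eval r.reverse : ℕ) / M ^ (N + 1 - β.length) =
      digitsValue c M β ↔ β <+: r := by
  induction β generalizing r with
  | nil =>
    simp only [List.length_nil, Nat.sub_zero, digitsValue, List.nil_prefix, iff_true]
    exact Nat.div_eq_of_lt (Fin.is_lt _)
  | cons a β ih =>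
    rw [cons_mem_wordsOver] at hβ
    rw [List.length_cons] at hN ⊢
    cases r with
    | nil =>
      have h0 : ((bufferAutomaton c M N hM hc d).eval ([] : List T).reverse : ℕ) = 0 := rfl
      rw [h0, Nat.zero_div, digitsValue]
      have := Nat.mul_pos (hpos a hβ.1) (Nat.pow_pos hM (n := β.length))
      simp only [List.prefix_nil, reduceCtorEq, iff_false]
      omega
    | cons b r =>
      rw [cons_mem_wordsOver] at hr
      have ih' := ih r hβ.2 hr.2 (by omega)
      rw [List.reverse_cons, DFA.eval_append_singleton]
      generalize (bufferAutomaton c M N hM hc d).eval r.reverse = z at ih' ⊢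
      have hstep : (((bufferAutomaton c M N hM hc d).step z b : Fin _) : ℕ) =
        c b * M ^ N + z / M := rfl
      have hpow : M ^ N = M ^ (N - β.length) * M ^ β.length := by
        rw [← pow_add]
        congr 1
        omega
      have hpow' : M ^ (N + 1 - β.length) = M * M ^ (N - β.length) := by
        rw [← pow_succ']
        congr 1
        omega
      rw [hstep, show N + 1 - (β.length + 1) = N - β.length by omega, hpow, Nat.mul_comm (M ^ _),
        ← Nat.mul_assoc, Nat.add_comm, Nat.add_mul_div_right _ _ (Nat.pow_pos hM),
        Nat.div_div_eq_div_mul, ← hpow', digitsValue, List.cons_prefix_cons, ← ih']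
      have hq : (z : ℕ) / M ^ (N + 1 - β.length) < M ^ β.length := by
        rw [Nat.div_lt_iff_lt_mul (Nat.pow_pos hM), ← pow_add]
        convert z.2 using 2
        omega
      have hd := digitsValue_lt hc β
      generalize (z : ℕ) / M ^ (N + 1 - β.length) = q at hq ⊢
      generalize digitsValue c M β = e at hd ⊢
      constructor
      · intro h
        -- Quotient and remainder modulo this power separate the leading digit from the remaining
        -- digits.
        have hdiv := congrArg (· / M ^ β.length) h
        have hmod := congrArg (· % M ^ β.length) h
        simp only [Nat.add_mul_div_right _ _ (Nat.pow_pos hM), Nat.add_comm (c a * _),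
          Nat.div_eq_of_lt hq, Nat.div_eq_of_lt hd, Nat.add_mul_mod_self_right,
          Nat.mod_eq_of_lt hq, Nat.mod_eq_of_lt hd] at hdiv hmod
        exact ⟨hinj a hβ.1 b hr.1 (by omega), hmod⟩
      · rintro ⟨rfl, rfl⟩
        exact Nat.add_comm _ _

theorem singleton_suffix_mem_ORD (U : Finset T) {b : List T} (hb : b ∈ wordsOver U) :
    {w | ∃ x ∈ wordsOver U, w = x ++ b} ∈ ORD T U := by
  classical
  let c : T → ℕ := fun a => if h : a ∈ U then (U.equivFin ⟨a, h⟩ : ℕ) + 1 else 0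
  have hcU : ∀ a (h : a ∈ U), c a = (U.equivFin ⟨a, h⟩ : ℕ) + 1 := fun a h => dif_pos h
  have hc : ∀ a, c a < U.card + 1 := by
    intro a
    by_cases h : a ∈ U
    · rw [hcU a h]
      have := (U.equivFin ⟨a, h⟩).2
      omega
    · simp [c, h]
  have hpos : ∀ a ∈ U, 0 < c a := fun a h => by
    rw [hcU a h]
    omega
  have hinj : ∀ a ∈ U, ∀ b ∈ U, c a = c b → a = b := by
    intro a ha b hb h
    rw [hcU a ha, hcU b hb, Nat.add_right_cancel_iff, Fin.val_inj] at h
    exact congrArg Subtype.val (U.equivFin.injective h)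
  refine ⟨?_, _, inferInstance, inferInstance,
    bufferAutomaton c (U.card + 1) b.length (Nat.succ_pos _) hc
      (digitsValue c (U.card + 1) b.reverse), fun a _ x y h => ?_, fun w => ?_⟩
  · rintro w ⟨x, hx, rfl⟩
    exact append_mem_wordsOver.2 ⟨hx, hb⟩
  -- Reading a letter adds a constant to z / M, which is monotone in z; hence the natural order of
  -- the numbers is preserved.
  · exact Nat.add_le_add_left (Nat.div_le_div_right h) _
  · have key := fun (hw : w ∈ wordsOver U) =>
      eval_bufferAutomaton (N := b.length) (Nat.succ_pos _) hc
        (digitsValue c (U.card + 1) b.reverse) hpos hinj b.reverse w.reverse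
        (fun a ha => hb a (List.mem_reverse.1 ha)) (fun a ha => hw a (List.mem_reverse.1 ha))
        (by rw [List.length_reverse]; omega)
    simp only [List.reverse_reverse, List.length_reverse, Nat.add_sub_cancel_left, pow_one,
      List.reverse_prefix] at key
    rw [DFA.mem_accepts]
    constructor
    · rintro ⟨x, hx, rfl⟩
      have hw := append_mem_wordsOver.2 ⟨hx, hb⟩
      exact ⟨hw, (key hw).2 (List.suffix_append x b)⟩
    · rintro ⟨hw, h⟩
      obtain ⟨x, rfl⟩ := (key hw).1 h
      exact ⟨x, (append_mem_wordsOver.1 hw).1, rfl⟩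

theorem EC_DEF_subset_ORD : EC (DEF T) ⊆ EC (ORD T) :=
  EC_DEF_subset fun U _ hb => singleton_suffix_mem_ORD U hb

end Ordered

/-! ### Framed languages: the test languages for the separations -/

section Framed

variable {T : Type*}

/-- The words of `R` together with the words of `Q` enclosed between two letters `c`. -/
def framed (c : T) (R Q : Language T) : Language T :=
  {w | w ∈ R ∨ ∃ x ∈ Q, w = c :: (x ++ [c])}

theorem ContextualGrammar.mem_extLanguage_cases {G : ContextualGrammar T} {w : List T}
    (hw : w ∈ G.extLanguage) : w ∈ G.startWords ∨ ∃ p ∈ G.pairs, ∃ k ∈ p.2, ∃ x ∈ G.extLanguage,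
      x ∈ p.1 ∧ w = k.1 ++ x ++ k.2 ∧ x ≠ w := by
  refine ContextualGrammar.extLanguage_induction (P := fun w => w ∈ G.startWords ∨
    ∃ p ∈ G.pairs, ∃ k ∈ p.2, ∃ x ∈ G.extLanguage, x ∈ p.1 ∧ w = k.1 ++ x ++ k.2 ∧ x ≠ w)
    (fun x hx => Or.inl hx) ?_ hw
  rintro x y hxG hx ⟨p, hp, hxp, k, hk, h⟩
  by_cases hxy : x = y
  · exact hxy ▸ hx
  · exact Or.inr ⟨p, hp, k, hk, x, hxG, hxp, h, hxy⟩

/-- A criterion for framed languages to be generated: `R` is generated from `A` by pairs of a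
selection language and a context, and `S` selects `Q` from `R`. -/
theorem framed_mem_EC {F : LangFamily T} {V : Finset T} {c : T} (hc : c ∉ V) {R Q : Language T}
    (hRV : R ≤ wordsOver V) (A : Set (List T)) (hA : A.Finite) (hAR : ∀ w ∈ A, w ∈ R)
    (P : List (Language T × List T × List T))
    (hP : ∀ p ∈ P, p.1 ∈ F V ∧ p.1 ≤ wordsOver V ∧ p.2.1 ∈ wordsOver V ∧ p.2.2 ∈ wordsOver V)
    (hclosed : ∀ p ∈ P, ∀ x ∈ R, x ∈ p.1 → p.2.1 ++ x ++ p.2.2 ∈ R)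
    (hgen : ∀ w ∈ R, w ∈ A ∨ ∃ p ∈ P, ∃ x ∈ R, x ∈ p.1 ∧ w = p.2.1 ++ x ++ p.2.2 ∧
      x.length < w.length)
    (S : Language T) (hS : S ∈ F V) (hSV : S ≤ wordsOver V) (hQR : ∀ w ∈ Q, w ∈ R)
    (hSQ : ∀ w ∈ R, (w ∈ S ↔ w ∈ Q)) : framed c R Q ∈ EC F := by
  classical
  have hVc : V ⊆ insert c V := Finset.subset_insert c V
  let G : ContextualGrammar T :=
    { alphabet := insert c V
      pairs := (fun p : Language T × List T × List T => (p.1, {p.2})) '' {p | p ∈ P} ∪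
        {(S, {([c], [c])})}
      startWords := A
      pairs_finite := (P.finite_toSet.image _).union (Set.finite_singleton _)
      contexts_finite := by
        rintro p (⟨p, hp, rfl⟩ | rfl)
        · exact Set.finite_singleton _
        · exact Set.finite_singleton _
      contexts_over := by
        rintro p (⟨p, hp, rfl⟩ | rfl) k rfl
        · exact ⟨wordsOver_mono hVc (hP p hp).2.2.1, wordsOver_mono hVc (hP p hp).2.2.2⟩
        · have : [c] ∈ wordsOver (insert c V) :=
            cons_mem_wordsOver.2 ⟨Finset.mem_insert_self c V, nil_mem_wordsOver _⟩
          exact ⟨this, this⟩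
      startWords_finite := hA
      startWords_over := fun w hw => wordsOver_mono hVc (hRV (hAR w hw)) }
  refine ⟨G, ?_, ?_⟩
  · rintro p (⟨p, hp, rfl⟩ | rfl)
    · exact ⟨V, hVc, (hP p hp).1⟩
    · exact ⟨V, hVc, hS⟩
  · have hR : ∀ n, ∀ w ∈ R, w.length = n → w ∈ G.extLanguage := by
      intro n
      induction n using Nat.strong_induction_on with
      | _ n ih =>
        rintro w hw rfl
        rcases hgen w hw with h | ⟨p, hp, x, hx, hxp, rfl, hlen⟩
        · exact G.startWords_subset h
        · exact G.extLanguage_step (ih _ hlen x hx rfl)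
            ⟨_, Or.inl ⟨p, hp, rfl⟩, hxp, p.2, rfl, rfl⟩
    -- All selection languages are over V and c is outside of V, so a framed word is never selected
    -- again.
    have hmem : ∀ x ∈ framed c R Q, x ∈ wordsOver V → x ∈ R := by
      rintro x (hx | ⟨x, -, rfl⟩) hV
      · exact hx
      · exact absurd (hV c (List.mem_cons_self ..)) hc
    ext w
    constructor
    · refine ContextualGrammar.extLanguage_induction (P := fun w => w ∈ framed c R Q)
        (fun x hx => Or.inl (hAR x hx)) ?_
      rintro x y - hx ⟨p, ⟨p, hp, rfl⟩ | rfl, hxp, k, rfl, rfl⟩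
      · exact Or.inl (hclosed p hp x (hmem x hx ((hP p hp).2.1 hxp)) hxp)
      · have hxR := hmem x hx (hSV hxp)
        exact Or.inr ⟨x, (hSQ x hxR).1 hxp, rfl⟩
    · rintro (hw | ⟨x, hx, rfl⟩)
      · exact hR _ w hw rfl
      · have hxR := hQR x hx
        exact G.extLanguage_step (hR _ x hxR rfl)
          ⟨_, Or.inr rfl, (hSQ x hxR).2 hx, _, rfl, rfl⟩

/-- A word of R contains no c, so both frame letters come from the context; a word framed by c
inside cwc would be all of cwc. The length bound forces x to have at least two letters, which rules
out degenerate splittings. -/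
theorem framed_split {V : Finset T} {c : T} (hc : c ∉ V) {R Q : Language T}
    (hRV : R ≤ wordsOver V) {u v w x : List T} (hw : w ∈ wordsOver V)
    (h : c :: (w ++ [c]) = u ++ x ++ v) (hx : x ∈ framed c R Q) (hne : x ≠ c :: (w ++ [c]))
    (hlen : u.length + v.length ≤ w.length) :
    ∃ y z, u = c :: y ∧ v = z ++ [c] ∧ x ∈ R ∧ w = y ++ x ++ z := by
  have hcw : c ∉ w := fun h => hc (hw c h)
  have hcR : ∀ x ∈ R, c ∉ x := fun x hx h => hc (hRV hx c h)
  have hxlen : 2 ≤ x.length := by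
    have := congrArg List.length h
    simp at this
    omega
  rcases u with _ | ⟨d, y⟩
  · exfalso
    rcases hx with hx | ⟨x, -, rfl⟩
    · rcases x with _ | ⟨e, x⟩
      · simp at hxlen
      · simp only [List.nil_append, List.cons_append, List.cons.injEq] at h
        exact hcR _ hx (h.1 ▸ List.mem_cons_self ..)
    · rcases List.eq_nil_or_concat' v with rfl | ⟨v, e, rfl⟩
      · simp only [List.nil_append, List.append_nil] at h
        exact hne h.symm
      · simp only [List.nil_append, List.cons_append, List.cons.injEq, true_and,
          ← List.append_assoc] at h
        have := (List.append_inj' h rfl).1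
        exact hcw (this ▸ by simp)
  · simp only [List.cons_append, List.cons.injEq] at h
    obtain ⟨rfl, h⟩ := h
    rcases List.eq_nil_or_concat' v with rfl | ⟨z, e, rfl⟩
    · exfalso
      rw [List.append_nil] at h
      rcases hx with hx | ⟨x, -, rfl⟩
      · rcases List.eq_nil_or_concat' x with rfl | ⟨x, e, rfl⟩
        · simp at hxlen
        · rw [← List.append_assoc] at h
          have := (List.append_inj' h rfl).2
          simp only [List.cons.injEq, and_true] at this
          exact hcR _ hx (this ▸ by simp)
      · rw [← List.cons_append, ← List.append_assoc] at h
        have := (List.append_inj' h rfl).1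
        exact hcw (this ▸ by simp)
    · rw [← List.append_assoc] at h
      obtain ⟨h1, h2⟩ := List.append_inj' h rfl
      simp only [List.cons.injEq, and_true] at h2
      refine ⟨y, z, rfl, by rw [h2], ?_, h1⟩
      rcases hx with hx | ⟨x, -, rfl⟩
      · exact hx
      · exact absurd (h1 ▸ by simp) hcw

/-- If a framed language is generated, then a single context accounts for the last steps of
infinitely many words of a given sequence. -/
theorem exists_context_of_framed_mem_EC {F : LangFamily T} {V : Finset T} {c : T} (hc : c ∉ V)
    {R Q : Language T} (hRV : R ≤ wordsOver V) (hQR : ∀ w ∈ Q, w ∈ R)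
    (h : framed c R Q ∈ EC F) (w : ℕ → List T) (hw : ∀ n, w n ∈ Q) (hlen : ∀ n, n ≤ (w n).length) :
    ∃ U, ∃ S ∈ F U, ∃ y z, (∀ m, ∃ n, m ≤ n ∧ ∃ x ∈ R, x ∈ S ∧ w n = y ++ x ++ z) ∧
      ∀ x ∈ R, x ∈ S → y ++ x ++ z ∈ Q := by
  obtain ⟨G, hG, hL⟩ := h
  obtain ⟨N, hN⟩ := (G.startWords_finite.image List.length).bddAbove
  let C : Set ((Language T × Set (List T × List T)) × (List T × List T)) :=
    ⋃ p ∈ G.pairs, (fun k => (p, k)) '' p.2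
  have hC : C.Finite := G.pairs_finite.biUnion fun p hp => (G.contexts_finite p hp).image _
  have hmemC : ∀ q, q ∈ C → q.1 ∈ G.pairs ∧ q.2 ∈ q.1.2 := by
    intro q hq
    simp only [C, Set.mem_iUnion] at hq
    obtain ⟨p, hp, k, hk, rfl⟩ := hq
    exact ⟨hp, hk⟩
  let good : (Language T × Set (List T × List T)) × (List T × List T) → ℕ → Prop := fun q n =>
    ∃ x ∈ framed c R Q, x ∈ q.1.1 ∧ c :: (w n ++ [c]) = q.2.1 ++ x ++ q.2.2 ∧
      x ≠ c :: (w n ++ [c])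
  -- Beyond the maximal length of a start word, the framed words need a genuine last derivation
  -- step.
  have hgood : ∀ n, N ≤ n → ∃ q ∈ C, good q n := by
    intro n hn
    have hmem : c :: (w n ++ [c]) ∈ G.extLanguage := by
      rw [hL]
      exact Or.inr ⟨w n, hw n, rfl⟩
    rcases ContextualGrammar.mem_extLanguage_cases hmem with hs | ⟨p, hp, k, hk, x, hx, h⟩
    · have h1 := hN ⟨_, hs, rfl⟩
      have h2 := hlen n
      simp only [List.length_cons, List.length_append] at h1
      omega
    · rw [hL] at hx
      exact ⟨(p, k), Set.mem_biUnion hp ⟨k, hk, rfl⟩, x, hx, h⟩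
  -- Pigeonhole: there are only finitely many choices of a selection pair with one of its contexts,
  -- so one of them occurs for arbitrarily large n.
  obtain ⟨q, hq, hfreq⟩ : ∃ q ∈ C, ∀ m, ∃ n, m ≤ n ∧ good q n := by
    by_contra hcon
    push Not at hcon
    choose! m hm using hcon
    obtain ⟨M, hM⟩ := (hC.image m).bddAbove
    obtain ⟨q, hq, hg⟩ := hgood (max M N) (le_max_right _ _)
    exact hm q hq _ ((hM ⟨q, hq, rfl⟩).trans (le_max_left _ _)) hg
  obtain ⟨hq1, hq2⟩ := hmemC q hq
  obtain ⟨U, -, hS⟩ := hG q.1 hq1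
  have hsplit : ∀ m, ∃ n, m ≤ n ∧ ∃ x ∈ q.1.1, ∃ y z, q.2.1 = c :: y ∧ q.2.2 = z ++ [c] ∧ x ∈ R ∧
      w n = y ++ x ++ z := by
    intro m
    obtain ⟨n, hn, x, hx, hxS, h1, h2⟩ := hfreq (max m (q.2.1.length + q.2.2.length))
    refine ⟨n, (le_max_left _ _).trans hn, x, hxS, ?_⟩
    exact framed_split hc hRV (hRV (hQR _ (hw n))) h1 hx h2
      (((le_max_right _ _).trans hn).trans (hlen n))
  obtain ⟨-, -, -, -, y, z, hy, hz, -, -⟩ := hsplit 0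
  refine ⟨U, q.1.1, hS, y, z, fun m => ?_, fun x hx hxS => ?_⟩
  · obtain ⟨n, hn, x, hxS, y', z', hy', hz', hx, h⟩ := hsplit m
    rw [hy, List.cons.injEq] at hy'
    have hzz := (List.append_inj' (hz.symm.trans hz') rfl).1
    exact ⟨n, hn, x, hx, hxS, by rw [h, hy'.2, hzz]⟩
  · have hmem : q.2.1 ++ x ++ q.2.2 ∈ G.extLanguage :=
      G.extLanguage_step (by rw [hL]; exact Or.inl hx) ⟨q.1, hq1, hxS, q.2, hq2, rfl⟩
    rw [hL, hy, hz] at hmem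
    -- The context inserts the letter c, so the derived word cannot belong to R; it is framed and
    -- its core lies in Q.
    rcases hmem with hmem | ⟨x', hx', h⟩
    · exact absurd (hRV hmem c (by simp)) hc
    · simp only [List.cons_append, List.cons.injEq, true_and, ← List.append_assoc] at h
      rw [(List.append_inj' h rfl).1]
      exact hx'

end Framed

/-! ### Separating languages over three letters -/

open List (replicate)

/-- Three distinct letters, two of which form the alphabet `V`. -/
structure Letters (T : Type*) where
  V : Finset T
  a : T
  b : T
  c : T
  ha : a ∈ V
  hb : b ∈ V
  hV : ∀ x ∈ V, x = a ∨ x = b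
  hab : a ≠ b
  hc : c ∉ V

section Separations

variable {T : Type*}

theorem nonempty_letters (T : Type*) [Infinite T] : Nonempty (Letters T) := by
  classical
  obtain ⟨a, -⟩ := Infinite.exists_notMem_finset (∅ : Finset T)
  obtain ⟨b, hb⟩ := Infinite.exists_notMem_finset ({a} : Finset T)
  obtain ⟨c, hc⟩ := Infinite.exists_notMem_finset ({a, b} : Finset T)
  exact ⟨⟨{a, b}, a, b, c, by simp, by simp, by simp, fun h => hb (by simp [h]), hc⟩⟩

theorem Letters.hba (l : Letters T) : l.b ≠ l.a := l.hab.symm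

theorem Letters.replicate_a_mem (l : Letters T) (n : ℕ) : replicate n l.a ∈ wordsOver l.V :=
  replicate_mem_wordsOver l.ha n

theorem Letters.replicate_b_mem (l : Letters T) (n : ℕ) : replicate n l.b ∈ wordsOver l.V :=
  replicate_mem_wordsOver l.hb n

theorem Letters.singleton_a_mem (l : Letters T) : [l.a] ∈ wordsOver l.V := l.replicate_a_mem 1

theorem Letters.singleton_b_mem (l : Letters T) : [l.b] ∈ wordsOver l.V := l.replicate_b_mem 1

theorem notMem_replicate {a b : T} (h : b ≠ a) (n : ℕ) : b ∉ replicate n a :=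
  fun hb => h (List.eq_of_mem_replicate hb)

/-! ### Selection of non-empty words -/

/-- The words `a^n b`. -/
def Letters.powB (l : Letters T) : Language T := {w | ∃ n, w = replicate n l.a ++ [l.b]}

theorem Letters.powB_le (l : Letters T) : l.powB ≤ wordsOver l.V := by
  rintro w ⟨n, rfl⟩
  exact append_mem_wordsOver.2 ⟨l.replicate_a_mem n, l.singleton_b_mem⟩

theorem Letters.framed_nil_powB_mem (l : Letters T) {F : LangFamily T} {S : Language T}
    (hS : S ∈ F l.V) (hSV : S ≤ wordsOver l.V) (hnil : [] ∉ S) (hpow : ∀ w ∈ l.powB, w ∈ S) :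
    framed l.c (1 + l.powB) l.powB ∈ EC F := by
  refine framed_mem_EC l.hc ?_ {[], [l.b]} (Set.toFinite _) ?_ [(S, [l.a], [])] ?_ ?_ ?_ S hS hSV
    (fun w hw => Or.inr hw) ?_
  · rintro w (rfl | hw)
    · exact nil_mem_wordsOver _
    · exact l.powB_le hw
  · rintro w (rfl | rfl)
    · exact Or.inl rfl
    · exact Or.inr ⟨0, rfl⟩
  · simpa using ⟨hS, hSV, l.singleton_a_mem, nil_mem_wordsOver _⟩
  · simp only [List.mem_singleton, forall_eq]
    rintro x (rfl | ⟨n, rfl⟩) hxS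
    · exact absurd hxS hnil
    · exact Or.inr ⟨n + 1, by simp [List.replicate_succ]⟩
  · rintro w (rfl | ⟨n, rfl⟩)
    · exact Or.inl (Or.inl rfl)
    · rcases n with _ | n
      · exact Or.inl (Or.inr rfl)
      · exact Or.inr ⟨_, List.mem_singleton_self _, replicate n l.a ++ [l.b], Or.inr ⟨n, rfl⟩,
          hpow _ ⟨n, rfl⟩, by simp [List.replicate_succ], by simp⟩
  · rintro w (rfl | hw)
    · refine iff_of_false hnil ?_
      rintro ⟨n, h⟩
      simp at h
    · exact iff_of_true (hpow w hw) hw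

/-- A suffix-closed selection that picks some aʲb also picks the empty word, which forces yz ∈ a*b.
Then y aʲb z contains two occurrences of b and cannot be aⁿb. -/
theorem Letters.framed_nil_powB_notMem_SUF (l : Letters T) :
    framed l.c (1 + l.powB) l.powB ∉ EC (SUF T) := by
  classical
  intro h
  obtain ⟨U, S, hS, y, z, hfreq, hcl⟩ := exists_context_of_framed_mem_EC l.hc (V := l.V)
    (by
      rintro w (rfl | hw)
      · exact nil_mem_wordsOver _
      · exact l.powB_le hw) (fun w hw => Or.inr hw) h
    (fun n => replicate n l.a ++ [l.b]) (fun n => ⟨n, rfl⟩) (fun n => by simp)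
  obtain ⟨n, hn, x, hx, hxS, e⟩ := hfreq (y.length + z.length)
  have hnil : [] ∈ S := by
    have := hS.2.2 x (hS.1 hxS) [] (nil_mem_wordsOver U)
    rw [List.append_nil] at this
    exact this hxS
  obtain ⟨m, hm⟩ := hcl [] (Or.inl rfl) hnil
  have h1 := congrArg List.length e
  have h2 := congrArg (List.count l.b) e
  have h3 := congrArg (List.count l.b) hm
  rcases hx with rfl | ⟨j, rfl⟩
  · simp at h1
    omega
  · simp [List.count_replicate, l.hab] at h2 h3
    omega

theorem longWords_mem_NIL (U : Finset T) (n : ℕ) : longWords U n ∈ NIL T U := by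
  refine ⟨fun w hw => hw.1, Or.inr ((finite_wordsOver_length_le U n).subset ?_)⟩
  rintro w ⟨h1, h2⟩
  refine ⟨h1, ?_⟩
  by_contra h
  exact h2 ⟨h1, by omega⟩

/-- The words over `V` that end with the letter `b`. -/
def endingWith (V : Finset T) (b : T) : Language T := {w | ∃ x ∈ wordsOver V, w = x ++ [b]}

theorem endingWith_mem_COMB {V : Finset T} {b : T} (hb : b ∈ V) : endingWith V b ∈ COMB T V := by
  refine ⟨?_, {b}, by simpa using hb, fun w => ?_⟩
  · rintro w ⟨x, hx, rfl⟩
    exact append_mem_wordsOver.2 ⟨hx, cons_mem_wordsOver.2 ⟨hb, nil_mem_wordsOver V⟩⟩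
  · simp only [Finset.mem_singleton, exists_eq_left]
    rfl

theorem not_EC_NIL_subset_EC_SUF [Infinite T] : ¬ EC (NIL T) ⊆ EC (SUF T) := by
  obtain ⟨l⟩ := nonempty_letters T
  refine fun h => l.framed_nil_powB_notMem_SUF (h (l.framed_nil_powB_mem
    (longWords_mem_NIL l.V 1) (fun w hw => hw.1) (fun h => by simpa using h.2) ?_))
  rintro w ⟨n, rfl⟩
  exact ⟨l.powB_le ⟨n, rfl⟩, by simp⟩

theorem not_EC_COMB_subset_EC_SUF [Infinite T] : ¬ EC (COMB T) ⊆ EC (SUF T) := by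
  obtain ⟨l⟩ := nonempty_letters T
  refine fun h => l.framed_nil_powB_notMem_SUF (h (l.framed_nil_powB_mem
    (endingWith_mem_COMB l.hb) (endingWith_mem_COMB l.hb).1 ?_ ?_))
  · rintro ⟨x, -, h⟩
    simp at h
  · rintro w ⟨n, rfl⟩
    exact ⟨_, l.replicate_a_mem n, rfl⟩

/-! ### Selection that is not invariant under circular shifts -/

/-- The words `b a^n`. -/
def Letters.bPow (l : Letters T) : Language T := {w | ∃ n, w = l.b :: replicate n l.a}

theorem Letters.bPow_le (l : Letters T) : l.bPow ≤ wordsOver l.V := by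
  rintro w ⟨n, rfl⟩
  exact cons_mem_wordsOver.2 ⟨l.hb, l.replicate_a_mem n⟩

theorem Letters.powB_add_bPow_le (l : Letters T) : l.powB + l.bPow ≤ wordsOver l.V := by
  rintro w (hw | hw)
  · exact l.powB_le hw
  · exact l.bPow_le hw

theorem Letters.framed_powB_bPow_mem (l : Letters T) {F : LangFamily T} {S₁ S₂ : Language T}
    (hS₁ : S₁ ∈ F l.V) (hSV₁ : S₁ ≤ wordsOver l.V) (hS₂ : S₂ ∈ F l.V) (hSV₂ : S₂ ≤ wordsOver l.V)
    (h₁ : ∀ n, replicate n l.a ++ [l.b] ∈ S₁) (h₁' : ∀ n, l.b :: replicate (n + 1) l.a ∉ S₁)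
    (h₂ : ∀ n, l.b :: replicate (n + 1) l.a ∈ S₂) (h₂' : ∀ n, replicate (n + 1) l.a ++ [l.b] ∉ S₂) :
    framed l.c (l.powB + l.bPow) l.powB ∈ EC F := by
  refine framed_mem_EC l.hc l.powB_add_bPow_le {[l.b], [l.b, l.a]} (Set.toFinite _) ?_
    [(S₁, [l.a], []), (S₂, [], [l.a])] ?_ ?_ ?_ S₁ hS₁ hSV₁ (fun w hw => Or.inl hw) ?_
  · rintro w (rfl | rfl)
    · exact Or.inl ⟨0, rfl⟩
    · exact Or.inr ⟨1, rfl⟩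
  · simpa using ⟨⟨hS₁, hSV₁, l.singleton_a_mem, nil_mem_wordsOver _⟩,
      hS₂, hSV₂, nil_mem_wordsOver _, l.singleton_a_mem⟩
  · simp only [List.mem_cons, List.not_mem_nil, or_false, forall_eq_or_imp, forall_eq]
    constructor
    · rintro x (⟨n, rfl⟩ | ⟨n, rfl⟩) hx
      · exact Or.inl ⟨n + 1, by simp [List.replicate_succ]⟩
      · rcases n with _ | n
        · exact Or.inl ⟨1, rfl⟩
        · exact absurd hx (h₁' n)
    · rintro x (⟨n, rfl⟩ | ⟨n, rfl⟩) hx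
      · rcases n with _ | n
        · exact Or.inr ⟨1, rfl⟩
        · exact absurd hx (h₂' n)
      · exact Or.inr ⟨n + 1, by simp [List.replicate_succ']⟩
  · rintro w (⟨n, rfl⟩ | ⟨n, rfl⟩)
    · rcases n with _ | n
      · exact Or.inl (Or.inl rfl)
      · exact Or.inr ⟨_, List.mem_cons_self .., replicate n l.a ++ [l.b], Or.inl ⟨n, rfl⟩,
          h₁ n, by simp [List.replicate_succ], by simp⟩
    · rcases n with _ | _ | n
      · exact Or.inl (Or.inl rfl)
      · exact Or.inl (Or.inr rfl)
      · exact Or.inr ⟨_, List.mem_cons_of_mem _ (List.mem_cons_self ..),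
          l.b :: replicate (n + 1) l.a, Or.inr ⟨n + 1, rfl⟩, h₂ n,
          by rw [List.replicate_succ']; simp, by simp⟩
  · rintro w (⟨n, rfl⟩ | ⟨n, rfl⟩)
    · exact iff_of_true (h₁ n) ⟨n, rfl⟩
    · rcases n with _ | n
      · exact iff_of_true (h₁ 0) ⟨0, rfl⟩
      · refine iff_of_false (h₁' n) ?_
        rintro ⟨m, hm⟩
        have := (List.append_cons_inj_of_notMem (x₂ := []) (z₂ := replicate (n + 1) l.a)
          (notMem_replicate l.hba m) (z₁ := []) (by simp)).1 hm.symm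
        simp at this

/-- A circular selection that picks aʲb also picks baʲ. Placing this word between y and z keeps
letters a behind b, so the result is not in a*b for j > 0. A source word baʲ is impossible for large
n, since y would have to supply all letters in front of b. -/
theorem Letters.framed_powB_bPow_notMem_CIRC (l : Letters T) :
    framed l.c (l.powB + l.bPow) l.powB ∉ EC (CIRC T) := by
  intro h
  obtain ⟨U, S, hS, y, z, hfreq, hcl⟩ := exists_context_of_framed_mem_EC l.hc
    l.powB_add_bPow_le (fun w hw => Or.inl hw) h
    (fun n => replicate n l.a ++ [l.b]) (fun n => ⟨n, rfl⟩) (fun n => by simp)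
  obtain ⟨n, hn, x, hx, hxS, e⟩ := hfreq (y.length + z.length + 1)
  have hlen := congrArg List.length e
  have hna := notMem_replicate l.hba
  rcases hx with ⟨j, rfl⟩ | ⟨j, rfl⟩
  · obtain ⟨m, hm⟩ := hcl (l.b :: replicate j l.a) (Or.inr ⟨j, rfl⟩) (hS.2.2 _ _ hxS)
    have := (List.append_cons_inj_of_notMem (hna m) (z₁ := []) (a₁ := l.b) (x₂ := y)
      (z₂ := replicate j l.a ++ z) (by simp)).1 (by rw [← hm]; simp)
    have hj := (List.append_eq_nil_iff.1 this.2.2.symm)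
    simp [hj.2] at hj hlen
    simp [hj] at hlen
    omega
  · have := (List.append_cons_inj_of_notMem (hna n) (z₁ := []) (a₁ := l.b) (x₂ := y)
      (z₂ := replicate j l.a ++ z) (by simp)).1 (by rw [e]; simp)
    have hy := congrArg List.length this.1
    simp at hy
    omega

theorem not_EC_COMB_subset_EC_CIRC [Infinite T] : ¬ EC (COMB T) ⊆ EC (CIRC T) := by
  obtain ⟨l⟩ := nonempty_letters T
  have hb := endingWith_mem_COMB l.hb
  have ha := endingWith_mem_COMB l.ha
  refine fun h => l.framed_powB_bPow_notMem_CIRC (h (l.framed_powB_bPow_mem hb hb.1 ha ha.1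
    (fun n => ⟨_, l.replicate_a_mem n, rfl⟩) ?_
    (fun n => ⟨l.b :: replicate n l.a, cons_mem_wordsOver.2 ⟨l.hb, l.replicate_a_mem n⟩,
      by simp [List.replicate_succ']⟩) ?_))
  · rintro n ⟨x, -, h⟩
    rw [List.replicate_succ', ← List.cons_append] at h
    exact l.hab (List.singleton_injective (List.append_inj' h rfl).2)
  · rintro n ⟨x, -, h⟩
    exact l.hba (List.singleton_injective (List.append_inj' h rfl).2)

/-- An automaton accepts a suffix-closed language if a relation between the states reached with and
without a prefix is preserved and compatible with acceptance. -/
theorem acceptsOver_mem_SUF {Z : Type*} [Fintype Z] (V : Finset T) (M : DFA T Z)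
    (r : Z → Z → Prop) (hstart : ∀ z, r z M.start)
    (hstep : ∀ z z' a, r z z' → r (M.step z a) (M.step z' a))
    (haccept : ∀ z z', r z z' → z ∈ M.accept → z' ∈ M.accept) : acceptsOver V M ∈ SUF T V := by
  refine ⟨fun w hw => hw.1, isRegular_acceptsOver V M, fun x hx y hy h => ⟨hy, ?_⟩⟩
  have key : ∀ z z', r z z' → r (M.evalFrom z y) (M.evalFrom z' y) := by
    clear h hy
    induction y with
    | nil => exact fun _ _ h => h
    | cons a y ih => exact fun z z' h => ih _ _ (hstep z z' a h)
  refine haccept (M.evalFrom (M.eval x) y) _ (key _ _ (hstart _)) ?_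
  have := h.2
  rwa [DFA.mem_accepts, DFA.eval, DFA.evalFrom_of_append] at this

open Classical in
/-- An automaton that rejects the words in which some letter other than `b` follows the letter
`b`. -/
noncomputable def sortedAutomaton (b : T) : DFA T (Fin 3) where
  step z x := if z = 2 then 2 else if x = b then 1 else if z = 1 then 2 else 0
  start := 0
  accept := {0, 1}

/-- A prefix can only move the state upwards, that is, closer to the rejecting sink 2. -/
theorem sortedAutomaton_mem_SUF (V : Finset T) (b : T) :
    acceptsOver V (sortedAutomaton b) ∈ SUF T V := by
  refine acceptsOver_mem_SUF V _ (fun z z' => z' ≤ z) (fun z => Fin.zero_le z) ?_ ?_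
  · intro z z' x
    by_cases hx : x = b <;> simp only [sortedAutomaton, hx, ↓reduceIte] <;> revert z z' <;> decide
  · intro z z'
    change _ → z = 0 ∨ z = 1 → z' = 0 ∨ z' = 1
    revert z z'
    decide

theorem evalFrom_sortedAutomaton_replicate_ne {a b : T} (h : a ≠ b) (n : ℕ) :
    (sortedAutomaton b).evalFrom 0 (replicate n a) = 0 := by
  induction n with
  | zero => rfl
  | succ n ih =>
    rw [List.replicate_succ, DFA.evalFrom_cons]
    simpa [sortedAutomaton, h] using ih

theorem evalFrom_sortedAutomaton_replicate (b : T) (n : ℕ) :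
    (sortedAutomaton b).evalFrom 1 (replicate n b) = 1 := by
  induction n with
  | zero => rfl
  | succ n ih =>
    rw [List.replicate_succ, DFA.evalFrom_cons]
    simpa [sortedAutomaton] using ih

theorem eval_sortedAutomaton {a b : T} (h : a ≠ b) (m n : ℕ) :
    (sortedAutomaton b).eval (replicate m a ++ replicate (n + 1) b) = 1 := by
  rw [DFA.eval, DFA.evalFrom_of_append]
  change (sortedAutomaton b).evalFrom ((sortedAutomaton b).evalFrom 0 _) _ = _
  rw [evalFrom_sortedAutomaton_replicate_ne h, List.replicate_succ, DFA.evalFrom_cons]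
  simpa [sortedAutomaton] using evalFrom_sortedAutomaton_replicate b n

theorem eval_sortedAutomaton_append {a b : T} (h : a ≠ b) (n : ℕ) :
    (sortedAutomaton b).eval (replicate (n + 1) b ++ [a]) = 2 := by
  have := eval_sortedAutomaton h 0 n
  rw [List.replicate_zero, List.nil_append] at this
  rw [DFA.eval_append_singleton, this]
  simp [sortedAutomaton, h]

theorem eval_sortedAutomaton_cons {a b : T} (h : a ≠ b) (n : ℕ) :
    (sortedAutomaton b).eval (b :: replicate (n + 1) a) = 2 := by
  induction n with
  | zero => simp [DFA.eval, DFA.evalFrom, sortedAutomaton, h]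
  | succ n ih =>
    rw [List.replicate_succ', ← List.cons_append, DFA.eval_append_singleton, ih]
    simp [sortedAutomaton]

theorem not_EC_SUF_subset_EC_CIRC [Infinite T] : ¬ EC (SUF T) ⊆ EC (CIRC T) := by
  obtain ⟨l⟩ := nonempty_letters T
  have hb := sortedAutomaton_mem_SUF l.V l.b
  have ha := sortedAutomaton_mem_SUF l.V l.a
  refine fun h => l.framed_powB_bPow_notMem_CIRC (h (l.framed_powB_bPow_mem hb hb.1 ha ha.1
    (fun n => ⟨l.powB_le ⟨n, rfl⟩, ?_⟩) (fun n h => ?_)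
    (fun n => ⟨l.bPow_le ⟨n + 1, rfl⟩, ?_⟩) (fun n h => ?_)))
  · rw [DFA.mem_accepts, show [l.b] = replicate (0 + 1) l.b from rfl, eval_sortedAutomaton l.hab]
    exact Or.inr rfl
  · have := h.2
    rw [DFA.mem_accepts, eval_sortedAutomaton_cons l.hab] at this
    exact absurd this (by simp [sortedAutomaton])
  · have := eval_sortedAutomaton l.hba 1 n
    rw [DFA.mem_accepts]
    exact Or.inr this
  · have := h.2
    rw [DFA.mem_accepts, eval_sortedAutomaton_append l.hba] at this
    exact absurd this (by simp [sortedAutomaton])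

/-! ### Selection that detects two close occurrences of a letter -/

theorem getElem?_replicate_append_cons (a b : T) (n : ℕ) (s : List T) (t : ℕ) :
    (replicate n a ++ b :: s)[t]? =
      if t < n then some a else if t = n then some b else s[t - (n + 1)]? := by
  rw [List.getElem?_append, List.length_replicate, List.getElem?_replicate]
  split_ifs with h1 h2
  · rfl
  · simp [h2]
  · rw [List.getElem?_cons, if_neg (by omega)]
    congr 1

theorem getElem?_one_block (a b : T) (i j t : ℕ) : (replicate i a ++ b :: replicate j a)[t]? =
    if t < i + j + 1 then (if t = i then some b else some a) else none := by
  rw [getElem?_replicate_append_cons, List.getElem?_replicate]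
  split_ifs <;> first | rfl | omega

theorem getElem?_two_blocks (a b : T) (p m q t : ℕ) :
    (replicate p a ++ b :: (replicate m a ++ b :: replicate q a))[t]? =
      if t < p + m + q + 2 then (if t = p ∨ t = p + m + 1 then some b else some a) else none := by
  rw [getElem?_replicate_append_cons, getElem?_one_block]
  split_ifs <;> first | rfl | omega

/-- If the gap between the two letters b has length at least k - 1, a window of length k sees at
most one of them, and every such window already occurs in the word with a single b. -/
theorem IsStrictlyLocallyTestable.two_blocks_mem {k : ℕ} {U : Finset T} {S : Language T}
    (hS : IsStrictlyLocallyTestable k U S) {a b : T} (ha : a ∈ U) (hb : b ∈ U) {i j p m q : ℕ}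
    (hi : k + 1 ≤ i) (hj : k + 1 ≤ j) (hp : k ≤ p) (hq : k ≤ q) (hm : k ≤ m + 1)
    (h : replicate i a ++ b :: replicate j a ∈ S) :
    replicate p a ++ b :: (replicate m a ++ b :: replicate q a) ∈ S := by
  have hV : ∀ n, replicate n a ∈ wordsOver U := replicate_mem_wordsOver ha
  have hpre : ∀ n t, k ≤ n → (replicate n a ++ t).take k = replicate k a := by
    intro n t hn
    rw [List.take_append_of_le_length (by simpa using hn), List.take_replicate, min_eq_left hn]
  have hsuf : ∀ n t, k ≤ n → (t ++ replicate n a).drop ((t ++ replicate n a).length - k) =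
      replicate k a := by
    intro n t hn
    rw [drop_append_right (by simp; omega), List.drop_replicate]
    congr 1
    simp
    omega
  have e1 : replicate i a ++ b :: replicate j a = (replicate i a ++ [b]) ++ replicate j a := by simp
  have e2 : replicate p a ++ b :: (replicate m a ++ b :: replicate q a) =
      (replicate p a ++ b :: (replicate m a ++ [b])) ++ replicate q a := by simp
  have hl1 : (replicate i a ++ b :: replicate j a).length = i + j + 1 := by simp; omega
  have hl2 : (replicate p a ++ b :: (replicate m a ++ b :: replicate q a)).length =
      p + m + q + 2 := by simp; omega
  refine hS.mem_of_factors (w := replicate i a ++ b :: replicate j a) ?_ ?_ (by omega) (by omega)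
    ?_ ?_ ?_ h
  · exact append_mem_wordsOver.2 ⟨hV i, cons_mem_wordsOver.2 ⟨hb, hV j⟩⟩
  · exact append_mem_wordsOver.2 ⟨hV p, cons_mem_wordsOver.2 ⟨hb, append_mem_wordsOver.2
      ⟨hV m, cons_mem_wordsOver.2 ⟨hb, hV q⟩⟩⟩⟩
  · rw [hpre i _ (by omega), hpre p _ hp]
  · rw [e1, e2, hsuf j _ (by omega), hsuf q _ hq]
  · intro t ht1 ht2
    rw [hl2] at ht2
    rw [hl1]
    -- The window is shifted so that its visible b falls on position i. A window without b is
    -- matched with the one at position 1, which lies in the first block because i ≥ k + 1.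
    have key : ∃ s, 1 ≤ s ∧ s + k + 1 ≤ i + j + 1 ∧ ∀ r, r < k →
        ((t + r = p ∨ t + r = p + m + 1) ↔ s + r = i) := by
      by_cases h1 : t ≤ p ∧ p < t + k
      · exact ⟨i - (p - t), by omega, by omega, fun r hr => by omega⟩
      · by_cases h2 : t ≤ p + m + 1 ∧ p + m + 1 < t + k
        · exact ⟨i - (p + m + 1 - t), by omega, by omega, fun r hr => by omega⟩
        · exact ⟨1, le_rfl, by omega, fun r hr => by omega⟩
    obtain ⟨s, hs1, hs2, hs⟩ := key
    refine ⟨s, hs1, hs2, List.ext_getElem? fun r => ?_⟩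
    rw [List.getElem?_take, List.getElem?_take, List.getElem?_drop, List.getElem?_drop,
      getElem?_one_block, getElem?_two_blocks]
    by_cases hr : r < k
    · simp only [hr, if_true, hs r hr, show t + r < p + m + q + 2 by omega,
        show s + r < i + j + 1 by omega]
    · simp [hr]

/-- The words `a^n b a^n`. -/
def Letters.sym (l : Letters T) : Language T :=
  {w | ∃ n, w = replicate n l.a ++ l.b :: replicate n l.a}

/-- The word `a^k b a^(k-1) b a^k`. -/
def Letters.twoB (l : Letters T) (k : ℕ) : List T :=
  replicate k l.a ++ l.b :: (replicate (k - 1) l.a ++ l.b :: replicate k l.a)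

theorem Letters.sym_le (l : Letters T) : l.sym ≤ wordsOver l.V := by
  rintro w ⟨n, rfl⟩
  exact append_mem_wordsOver.2 ⟨l.replicate_a_mem n, cons_mem_wordsOver.2
    ⟨l.hb, l.replicate_a_mem n⟩⟩

theorem Letters.twoB_mem (l : Letters T) (k : ℕ) : l.twoB k ∈ wordsOver l.V :=
  append_mem_wordsOver.2 ⟨l.replicate_a_mem k, cons_mem_wordsOver.2 ⟨l.hb,
    append_mem_wordsOver.2 ⟨l.replicate_a_mem _, cons_mem_wordsOver.2
      ⟨l.hb, l.replicate_a_mem k⟩⟩⟩⟩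

open Classical in
theorem Letters.count_sym (l : Letters T) {w : List T} (hw : w ∈ l.sym) : w.count l.b = 1 := by
  obtain ⟨n, rfl⟩ := hw
  simp [List.count_replicate, l.hab]

open Classical in
theorem Letters.count_twoB (l : Letters T) (k : ℕ) : (l.twoB k).count l.b = 2 := by
  simp [twoB, List.count_replicate, l.hab]

/-- The words `a^n b a^n` and `a^k b a^(k-1) b a^k`. -/
def Letters.symTwoB (l : Letters T) (k : ℕ) : Language T := {w | w ∈ l.sym ∨ w = l.twoB k}

theorem Letters.symTwoB_le (l : Letters T) (k : ℕ) : l.symTwoB k ≤ wordsOver l.V := by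
  rintro w (hw | rfl)
  · exact l.sym_le hw
  · exact l.twoB_mem k

theorem Letters.framed_symTwoB_mem (l : Letters T) (k : ℕ) {F : LangFamily T} {S : Language T}
    (hS : S ∈ F l.V) (hSV : S ≤ wordsOver l.V) (h₁ : ∀ w ∈ l.sym, w ∈ S) (h₂ : l.twoB k ∉ S) :
    framed l.c (l.symTwoB k) l.sym ∈ EC F := by
  classical
  refine framed_mem_EC l.hc (l.symTwoB_le k) {[l.b], l.twoB k} (Set.toFinite _) ?_
    [(S, [l.a], [l.a])] ?_ ?_ ?_ S hS hSV (fun w hw => Or.inl hw) ?_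
  · rintro w (rfl | rfl)
    · exact Or.inl ⟨0, rfl⟩
    · exact Or.inr rfl
  · simpa using ⟨hS, hSV, l.singleton_a_mem⟩
  · simp only [List.mem_singleton, forall_eq]
    rintro x (⟨n, rfl⟩ | rfl) hxS
    · exact Or.inl ⟨n + 1, by simp [List.replicate_succ, ← List.replicate_succ']⟩
    · exact absurd hxS h₂
  · rintro w (⟨n, rfl⟩ | rfl)
    · rcases n with _ | n
      · exact Or.inl (Or.inl rfl)
      · exact Or.inr ⟨_, List.mem_singleton_self _, replicate n l.a ++ l.b :: replicate n l.a,
          Or.inl ⟨n, rfl⟩, h₁ _ ⟨n, rfl⟩,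
          by simp [List.replicate_succ, ← List.replicate_succ'], by simp; omega⟩
    · exact Or.inl (Or.inr rfl)
  · rintro w (hw | rfl)
    · exact iff_of_true (h₁ w hw) hw
    · refine iff_of_false h₂ fun h => ?_
      have := l.count_sym h
      rw [l.count_twoB] at this
      omega

theorem replicate_append_split {a : T} {y t s : List T} {m : ℕ} (h : y ++ t = replicate m a ++ s)
    (hy : y.length ≤ m) :
    y = replicate y.length a ∧ t = replicate (m - y.length) a ++ s := by
  rw [← Nat.add_sub_cancel' hy, List.replicate_add, List.append_assoc] at h
  have := List.append_inj h (by simp)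
  simpa using this

theorem append_replicate_split {a : T} {t z s : List T} {m : ℕ} (h : t ++ z = s ++ replicate m a)
    (hz : z.length ≤ m) :
    t = s ++ replicate (m - z.length) a ∧ z = replicate z.length a := by
  rw [← Nat.sub_add_cancel hz, List.replicate_add, ← List.append_assoc] at h
  have := List.append_inj' h (by simp)
  simpa using this

/-- A factor of `a^m s a^m` obtained by removing short words at both ends. -/
theorem replicate_core_split {a : T} {x y z s : List T} {m : ℕ}
    (h : replicate m a ++ s ++ replicate m a = y ++ x ++ z) (hy : y.length ≤ m)
    (hz : z.length ≤ m) : y = replicate y.length a ∧ z = replicate z.length a ∧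
      x = replicate (m - y.length) a ++ s ++ replicate (m - z.length) a := by
  obtain ⟨h1, h2⟩ := append_replicate_split h.symm hz
  rw [List.append_assoc] at h1
  obtain ⟨h3, h4⟩ := replicate_append_split h1 hy
  exact ⟨h3, h2, by rw [h4, List.append_assoc]⟩

/-- Windows of length k cannot tell `twoB k` from aⁱbaʲ with long blocks, so the selection also
picks `twoB k`; but a word with two occurrences of b never extends to a word of Q. -/
theorem Letters.framed_symTwoB_notMem_SLTk (l : Letters T) {k : ℕ} (hk : 1 ≤ k) :
    framed l.c (l.symTwoB k) l.sym ∉ EC (SLTk T k) := by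
  classical
  intro h
  obtain ⟨U, S, hS, y, z, hfreq, hcl⟩ := exists_context_of_framed_mem_EC l.hc
    (l.symTwoB_le k) (fun w hw => Or.inl hw) h
    (fun n => replicate n l.a ++ l.b :: replicate n l.a) (fun n => ⟨n, rfl⟩)
    (fun n => by simp)
  obtain ⟨n, hn, x, -, hxS, e⟩ := hfreq (y.length + z.length + k + 1)
  obtain ⟨-, -, hx⟩ := replicate_core_split (s := [l.b]) (by simpa using e) (by omega) (by omega)
  rw [List.append_assoc, List.singleton_append] at hx
  subst hx
  have hU := hS.1 hxS
  have ha : l.a ∈ U := hU l.a (by simp; omega)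
  have hb : l.b ∈ U := hU l.b (by simp)
  have htwo : l.twoB k ∈ S := hS.2.two_blocks_mem ha hb (by omega) (by omega) le_rfl le_rfl
    (by omega) hxS
  have := l.count_sym (hcl _ (Or.inr rfl) htwo)
  rw [List.count_append, List.count_append, l.count_twoB] at this
  omega

theorem not_EC_NIL_subset_EC_SLTk [Infinite T] {k : ℕ} (hk : 1 ≤ k) :
    ¬ EC (NIL T) ⊆ EC (SLTk T k) := by
  classical
  obtain ⟨l⟩ := nonempty_letters T
  let S : Language T := {w | w ∈ wordsOver l.V ∧ w ≠ l.twoB k}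
  have hS : S ∈ NIL T l.V := by
    refine ⟨fun w hw => hw.1, Or.inr ((Set.finite_singleton (l.twoB k)).subset ?_)⟩
    rintro w ⟨h1, h2⟩
    by_contra h
    exact h2 ⟨h1, h⟩
  refine fun h => l.framed_symTwoB_notMem_SLTk hk (h (l.framed_symTwoB_mem k hS hS.1 ?_ ?_))
  · refine fun w hw => ⟨l.sym_le hw, ?_⟩
    rintro rfl
    have := l.count_sym hw
    rw [l.count_twoB] at this
    omega
  · exact fun h => h.2 rfl

/-- In `twoB k` the two letters b bound a factor of length exactly k + 1. Windows of that length,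
each allowed at most one b, therefore reject it, while windows of length k are blind to it. -/
theorem not_EC_SLTk_succ_subset_EC_SLTk [Infinite T] {k : ℕ} (hk : 1 ≤ k) :
    ¬ EC (SLTk T (k + 1)) ⊆ EC (SLTk T k) := by
  classical
  obtain ⟨l⟩ := nonempty_letters T
  let B : Set (List T) := {v | (v ∈ wordsOver l.V ∧ v.length = k + 1) ∧ v.count l.b ≤ 1}
  let S : Language T := {w | w ∈ wordsOver l.V ∧ ∀ j, j + (k + 1) ≤ w.length →
    ((w.drop j).take (k + 1)).count l.b ≤ 1}
  have hS : S ∈ SLTk T (k + 1) l.V := by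
    refine ⟨fun w hw => hw.1, B, B, B, fun w hw => hw.1, fun w hw => hw.1, fun w hw => hw.1,
      fun w hw hl => ?_⟩
    have hsub : ∀ j, j + (k + 1) ≤ w.length → (w.drop j).take (k + 1) ∈ wordsOver l.V ∧
        ((w.drop j).take (k + 1)).length = k + 1 := fun j hj =>
      ⟨fun a ha => hw a (List.mem_of_mem_drop (List.mem_of_mem_take ha)), by
        rw [List.length_take, List.length_drop]
        omega⟩
    have hend : (w.drop (w.length - (k + 1))).take (k + 1) = w.drop (w.length - (k + 1)) :=
      List.take_of_length_le (by rw [List.length_drop]; omega)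
    constructor
    · intro h
      refine ⟨⟨hsub 0 (by omega), h.2 0 (by omega)⟩, fun j _ hj => ⟨hsub j (by omega),
        h.2 j (by omega)⟩, ?_⟩
      rw [← hend]
      exact ⟨hsub _ (by omega), h.2 _ (by omega)⟩
    · rintro ⟨h1, h2, h3⟩
      refine ⟨hw, fun j hj => ?_⟩
      rcases Nat.eq_zero_or_pos j with rfl | hj0
      · exact h1.2
      · by_cases hj' : j + (k + 1) + 1 ≤ w.length
        · exact (h2 j hj0 hj').2
        · rw [← hend] at h3
          rw [show j = w.length - (k + 1) by omega]
          exact h3.2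
  refine fun h => l.framed_symTwoB_notMem_SLTk hk (h (l.framed_symTwoB_mem k hS hS.1 ?_ ?_))
  · refine fun w hw => ⟨l.sym_le hw, fun j _ => ?_⟩
    rw [← l.count_sym hw]
    exact ((List.take_sublist _ _).trans (List.drop_sublist _ _)).count_le _
  · intro h
    have := h.2 k (by simp [Letters.twoB]; omega)
    have e : ((l.twoB k).drop k).take (k + 1) = l.b :: (replicate (k - 1) l.a ++ [l.b]) := by
      rw [Letters.twoB, drop_append_right (by simp)]
      obtain ⟨k, rfl⟩ : ∃ j, k = j + 1 := ⟨k - 1, by omega⟩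
      simp [List.take_append]
    rw [e] at this
    simp at this

/-! ### Selection that counts modulo two -/

/-- The words `b a^(2n)`. -/
def Letters.bPowEven (l : Letters T) : Language T := {w | ∃ n, w = l.b :: replicate (2 * n) l.a}

open Classical in
/-- An automaton for the words in which each occurrence of `b` is followed by an even number of
other letters before the next occurrence of `b` or the end of the word. -/
noncomputable def evenGapAutomaton (b : T) : DFA T (Fin 4) where
  step z x := if x = b then (if z = 0 ∨ z = 1 then 1 else 3) else
    (if z = 1 then 2 else if z = 2 then 1 else z)
  start := 0
  accept := {0, 1}

/-- Dropping a prefix drops demands: state 0, where no b has yet been read, simulates every other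
state, and the sink 3 is simulated by every state. -/
theorem evenGapAutomaton_mem_SUF (V : Finset T) (b : T) :
    acceptsOver V (evenGapAutomaton b) ∈ SUF T V := by
  refine acceptsOver_mem_SUF V _ (fun z z' => z' = 0 ∨ z = 3 ∨ z = z') (fun z => Or.inl rfl) ?_ ?_
  · intro z z' x
    by_cases hx : x = b <;> simp only [evenGapAutomaton, hx, ↓reduceIte] <;> revert z z' <;> decide
  · intro z z'
    change _ → z = 0 ∨ z = 1 → z' = 0 ∨ z' = 1
    revert z z'
    decide

theorem eval_evenGapAutomaton {a b : T} (h : a ≠ b) (n : ℕ) :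
    (evenGapAutomaton b).eval (b :: replicate n a) = if Even n then 1 else 2 := by
  induction n with
  | zero => simp [DFA.eval, DFA.evalFrom, evenGapAutomaton]
  | succ n ih =>
    rw [List.replicate_succ', ← List.cons_append, DFA.eval_append_singleton, ih]
    by_cases hn : Even n
    · simp [evenGapAutomaton, h, hn, Nat.even_add_one]
    · simp [evenGapAutomaton, h, hn, Nat.even_add_one]

/-- A non-counting selection that picks baʲ with large j also picks baʲ⁺¹, so the same context would
yield words of Q whose lengths differ by one. All words of Q have odd length. -/
theorem not_EC_SUF_subset_EC_NC [Infinite T] : ¬ EC (SUF T) ⊆ EC (NC T) := by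
  obtain ⟨l⟩ := nonempty_letters T
  have hQR : ∀ w ∈ l.bPowEven, w ∈ l.bPow := fun w ⟨n, h⟩ => ⟨2 * n, h⟩
  have hmem : framed l.c l.bPow l.bPowEven ∈ EC (SUF T) := by
    have hV := wordsOver_mem_SUF l.V
    have hS := evenGapAutomaton_mem_SUF l.V l.b
    refine framed_mem_EC l.hc l.bPow_le {[l.b]} (Set.toFinite _) ?_
      [(wordsOver l.V, [], [l.a])] ?_ ?_ ?_ _ hS hS.1 hQR ?_
    · rintro w rfl
      exact ⟨0, rfl⟩
    · simpa using ⟨hV, nil_mem_wordsOver _, l.singleton_a_mem⟩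
    · simp only [List.mem_singleton, forall_eq]
      rintro x ⟨n, rfl⟩ -
      exact ⟨n + 1, by simp [List.replicate_succ']⟩
    · rintro w ⟨n, rfl⟩
      rcases n with _ | n
      · exact Or.inl rfl
      · exact Or.inr ⟨_, List.mem_singleton_self _, l.b :: replicate n l.a, ⟨n, rfl⟩,
          l.bPow_le ⟨n, rfl⟩, by simp [List.replicate_succ'], by simp⟩
    · rintro w ⟨n, rfl⟩
      rw [mem_acceptsOver, eval_evenGapAutomaton l.hab]
      constructor
      · rintro ⟨-, h⟩
        by_cases hn : Even n
        · obtain ⟨m, rfl⟩ := hn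
          exact ⟨m, by rw [two_mul]⟩
        · rw [if_neg hn] at h
          exact absurd h (by simp [evenGapAutomaton])
      · rintro ⟨m, hm⟩
        have hnm : n = 2 * m := by simpa using congrArg List.length hm
        refine ⟨l.bPow_le ⟨n, rfl⟩, ?_⟩
        rw [if_pos (hnm ▸ even_two_mul m)]
        exact Or.inr rfl
  intro h
  obtain ⟨U, S, hS, y, z, hfreq, hcl⟩ := exists_context_of_framed_mem_EC l.hc l.bPow_le hQR
    (h hmem) (fun n => l.b :: replicate (2 * n) l.a) (fun n => ⟨n, rfl⟩)
    (fun n => by simp; omega)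
  obtain ⟨k, hk, hSk⟩ := hS.2.2
  obtain ⟨n, hn, x, ⟨j, rfl⟩, hxS, e⟩ := hfreq (y.length + z.length + k + 1)
  have hlen := congrArg List.length e
  simp only [List.length_cons, List.length_append, List.length_replicate] at hlen
  have hU := hS.1 hxS
  have ha : l.a ∈ U := hU l.a (by simp; omega)
  have hb : l.b ∈ U := hU l.b (by simp)
  have hnext : l.b :: replicate (j + 1) l.a ∈ S := by
    have := hSk [l.b] (replicate_mem_wordsOver hb 1) [l.a] (replicate_mem_wordsOver ha 1)
      (replicate (j - k) l.a) (replicate_mem_wordsOver ha _)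
    rw [wordPow_singleton, wordPow_singleton, List.append_assoc, List.append_assoc,
      ← List.replicate_add, ← List.replicate_add] at this
    rw [show k + (j - k) = j by omega, show k + 1 + (j - k) = j + 1 by omega] at this
    exact this.1 hxS
  obtain ⟨m, hm⟩ := hcl _ ⟨j + 1, rfl⟩ hnext
  have hlen' := congrArg List.length hm
  simp only [List.length_cons, List.length_append, List.length_replicate] at hlen'
  omega

/-- The words `a^n`. -/
def Letters.aPow (l : Letters T) : Language T := {w | ∃ n, w = replicate n l.a}

/-- The words `a^(2n)`. -/
def Letters.aPowEven (l : Letters T) : Language T := {w | ∃ n, w = replicate (2 * n) l.a}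

theorem Letters.aPow_le (l : Letters T) : l.aPow ≤ wordsOver l.V := by
  rintro w ⟨n, rfl⟩
  exact l.replicate_a_mem n

/-- An automaton for the words of even length. -/
def evenLengthAutomaton (T : Type*) : DFA T Bool where
  step z _ := !z
  start := true
  accept := {true}

theorem eval_evenLengthAutomaton (w : List T) :
    (evenLengthAutomaton T).eval w = decide (Even w.length) := by
  induction w using List.reverseRecOn with
  | nil => simp [evenLengthAutomaton]
  | append_singleton w a ih =>
    rw [DFA.eval_append_singleton, ih, List.length_append, List.length_singleton]
    change (!decide (Even w.length)) = _
    rw [← decide_not]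
    exact decide_eq_decide.2 Nat.even_add_one.symm

theorem mem_accepts_evenLengthAutomaton {w : List T} :
    w ∈ (evenLengthAutomaton T).accepts ↔ Even w.length := by
  rw [DFA.mem_accepts, eval_evenLengthAutomaton]
  simp [evenLengthAutomaton]

theorem wordsOver_mem_COMM (U : Finset T) : wordsOver U ∈ COMM T U :=
  ⟨le_rfl, isRegular_wordsOver U, fun _ _ hp hv a ha => hv a (hp.mem_iff.2 ha)⟩

/-- A power-separating selection that picks a high power aʲ also picks aʲ⁺¹, so the same context
would produce words of Q of both parities. -/
theorem not_EC_COMM_subset_EC_PS [Infinite T] : ¬ EC (COMM T) ⊆ EC (PS T) := by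
  obtain ⟨l⟩ := nonempty_letters T
  have hQR : ∀ w ∈ l.aPowEven, w ∈ l.aPow := fun w ⟨n, h⟩ => ⟨2 * n, h⟩
  have hmem : framed l.c l.aPow l.aPowEven ∈ EC (COMM T) := by
    have hV := wordsOver_mem_COMM l.V
    have hS : acceptsOver l.V (evenLengthAutomaton T) ∈ COMM T l.V := by
      refine ⟨fun w hw => hw.1, isRegular_acceptsOver _ _, ?_⟩
      rintro v w hp ⟨h1, h2⟩
      refine ⟨hV.2.2 v w hp h1, ?_⟩
      rw [mem_accepts_evenLengthAutomaton] at h2 ⊢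
      rwa [← hp.length_eq]
    refine framed_mem_EC l.hc l.aPow_le {[]} (Set.toFinite _) ?_
      [(wordsOver l.V, [], [l.a])] ?_ ?_ ?_ _ hS hS.1 hQR ?_
    · rintro w rfl
      exact ⟨0, rfl⟩
    · simpa using ⟨hV, nil_mem_wordsOver _, l.singleton_a_mem⟩
    · simp only [List.mem_singleton, forall_eq]
      rintro x ⟨n, rfl⟩ -
      exact ⟨n + 1, by simp [List.replicate_succ']⟩
    · rintro w ⟨n, rfl⟩
      rcases n with _ | n
      · exact Or.inl rfl
      · exact Or.inr ⟨_, List.mem_singleton_self _, replicate n l.a, ⟨n, rfl⟩,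
          l.aPow_le ⟨n, rfl⟩, by simp [List.replicate_succ'], by simp⟩
    · rintro w ⟨n, rfl⟩
      constructor
      · rintro ⟨-, h⟩
        rw [mem_accepts_evenLengthAutomaton, List.length_replicate] at h
        obtain ⟨m, rfl⟩ := h
        exact ⟨m, by rw [two_mul]⟩
      · rintro ⟨m, hm⟩
        refine ⟨l.aPow_le ⟨n, rfl⟩, ?_⟩
        rw [mem_accepts_evenLengthAutomaton, hm, List.length_replicate]
        exact even_two_mul m
  intro h
  obtain ⟨U, S, hS, y, z, hfreq, hcl⟩ := exists_context_of_framed_mem_EC l.hc l.aPow_le hQR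
    (h hmem) (fun n => replicate (2 * n) l.a) (fun n => ⟨n, rfl⟩) (fun n => by simp; omega)
  obtain ⟨k, hk, hSk⟩ := hS.2.2
  obtain ⟨n, hn, x, ⟨j, rfl⟩, hxS, e⟩ := hfreq (y.length + z.length + k + 1)
  have hlen := congrArg List.length e
  simp only [List.length_append, List.length_replicate] at hlen
  have ha : l.a ∈ U := hS.1 hxS l.a (by simp; omega)
  have hnext : replicate (j + 1) l.a ∈ S := by
    rcases hSk [l.a] (replicate_mem_wordsOver ha 1) with h | h
    · refine absurd hxS ?_
      rw [← wordPow_singleton]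
      exact h j (by omega)
    · rw [← wordPow_singleton]
      exact h _ (by omega)
  obtain ⟨m, hm⟩ := hcl _ ⟨j + 1, rfl⟩ hnext
  have hlen' := congrArg List.length hm
  simp only [List.length_append, List.length_replicate] at hlen'
  omega

/-! ### Selection from all words over `V` -/

theorem Letters.framed_wordsOver_mem (l : Letters T) {F : LangFamily T} {S : Language T}
    (hV : wordsOver l.V ∈ F l.V) (hS : S ∈ F l.V) (hSV : S ≤ wordsOver l.V) :
    framed l.c (wordsOver l.V) S ∈ EC F := by
  refine framed_mem_EC l.hc le_rfl {[]} (Set.toFinite _) ?_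
    [(wordsOver l.V, [], [l.a]), (wordsOver l.V, [], [l.b])] ?_ ?_ ?_ S hS hSV hSV
    (fun w _ => Iff.rfl)
  · rintro w rfl
    exact nil_mem_wordsOver _
  · simpa using ⟨⟨hV, nil_mem_wordsOver _, l.singleton_a_mem⟩, hV, nil_mem_wordsOver _,
      l.singleton_b_mem⟩
  · simp only [List.mem_cons, List.not_mem_nil, or_false, forall_eq_or_imp, forall_eq]
    exact ⟨fun x hx _ => append_mem_wordsOver.2 ⟨hx, l.singleton_a_mem⟩,
      fun x hx _ => append_mem_wordsOver.2 ⟨hx, l.singleton_b_mem⟩⟩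
  · intro w hw
    rcases List.eq_nil_or_concat' w with rfl | ⟨x, e, rfl⟩
    · exact Or.inl rfl
    · rw [append_mem_wordsOver, cons_mem_wordsOver] at hw
      right
      rcases l.hV e hw.2.1 with rfl | rfl
      · exact ⟨_, List.mem_cons_self .., x, hw.1, hw.1, rfl, by simp⟩
      · exact ⟨_, List.mem_cons_of_mem _ (List.mem_cons_self ..), x, hw.1, hw.1, rfl, by simp⟩

/-- Every word other than a start word arises in one step from a word of a finite selection
language. -/
theorem finite_of_mem_EC_FIN {L : Language T} (hL : L ∈ EC (FIN T)) : {w | w ∈ L}.Finite := by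
  obtain ⟨G, hG, rfl⟩ := hL
  refine (G.startWords_finite.union (G.pairs_finite.biUnion (t := fun p => ⋃ k ∈ p.2,
    (fun x => k.1 ++ x ++ k.2) '' {w | w ∈ p.1}) fun p hp =>
    (G.contexts_finite p hp).biUnion fun k _ => ?_)).subset ?_
  · obtain ⟨U, -, hU⟩ := hG p hp
    exact hU.2.image _
  · intro w hw
    rcases ContextualGrammar.mem_extLanguage_cases hw with h | ⟨p, hp, k, hk, x, -, hx, h, -⟩
    · exact Or.inl h
    · right
      simp only [Set.mem_iUnion]
      exact ⟨p, hp, k, hk, x, hx, h.symm⟩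

theorem not_EC_MON_subset_EC_FIN [Infinite T] : ¬ EC (MON T) ⊆ EC (FIN T) := by
  obtain ⟨l⟩ := nonempty_letters T
  have hV : wordsOver l.V ∈ MON T l.V := ⟨le_rfl, rfl⟩
  intro h
  have hfin := finite_of_mem_EC_FIN (h (l.framed_wordsOver_mem hV hV le_rfl))
  refine Set.infinite_of_injective_forall_mem (f := fun n => replicate n l.a) ?_ ?_ hfin
  · intro m n hmn
    simpa using congrArg List.length hmn
  · exact fun n => Or.inl (l.replicate_a_mem n)

open Classical in
/-- Two transpositions generating a non-abelian group. -/
noncomputable def letterPerm (b x : T) : Equiv.Perm (Fin 3) :=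
  if x = b then Equiv.swap 0 1 else Equiv.swap 1 2

/-- The permutation described by a word. -/
noncomputable def wordPerm (b : T) (w : List T) : Equiv.Perm (Fin 3) := (w.map (letterPerm b)).prod

theorem wordPerm_append (b : T) (v w : List T) :
    wordPerm b (v ++ w) = wordPerm b v * wordPerm b w := by
  simp [wordPerm]

theorem wordPerm_replicate {a b : T} (h : a ≠ b) (n : ℕ) :
    wordPerm b (replicate n a) = Equiv.swap 1 2 ^ n := by
  simp [wordPerm, letterPerm, h]

/-- The words over `V` that describe the trivial permutation. -/
def trivialPermWords (V : Finset T) (b : T) : Language T :=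
  {w | w ∈ wordsOver V ∧ wordPerm b w = 1}

/-- In a group, gh = 1 if and only if hg = 1; the finite group itself serves as the automaton. -/
theorem trivialPermWords_mem_CIRC (V : Finset T) (b : T) : trivialPermWords V b ∈ CIRC T V := by
  refine ⟨fun w hw => hw.1, ?_, ?_⟩
  · let M : DFA T (Equiv.Perm (Fin 3)) := ⟨fun z x => z * letterPerm b x, 1, {1}⟩
    have hM : ∀ w, M.eval w = wordPerm b w := by
      intro w
      induction w using List.reverseRecOn with
      | nil => rfl
      | append_singleton w x ih =>
        rw [DFA.eval_append_singleton, ih, wordPerm_append]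
        simp [wordPerm, M]
    have e : trivialPermWords V b = acceptsOver V M := by
      ext w
      rw [mem_acceptsOver, hM]
      rfl
    rw [e]
    exact isRegular_acceptsOver V M
  · rintro x y ⟨h1, h2⟩
    rw [append_mem_wordsOver] at h1
    rw [wordPerm_append] at h2
    refine ⟨append_mem_wordsOver.2 h1.symm, ?_⟩
    rw [wordPerm_append]
    exact mul_eq_one_comm.1 h2

theorem wordsOver_mem_CIRC (U : Finset T) : wordsOver U ∈ CIRC T U :=
  ⟨le_rfl, isRegular_wordsOver U, fun _ _ h => append_mem_wordsOver.2
    (append_mem_wordsOver.1 h).symm⟩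

/-- From a²ⁿ bb a²ⁿ, a commutative selection lets one letter a move between the two letters b. With
the involutions σ for a and τ for b, the derived word would represent τστσ = 1, although σ and τ do
not commute. -/
theorem not_EC_CIRC_subset_EC_COMM [Infinite T] : ¬ EC (CIRC T) ⊆ EC (COMM T) := by
  obtain ⟨l⟩ := nonempty_letters T
  have hQ := trivialPermWords_mem_CIRC l.V l.b
  have hmem := l.framed_wordsOver_mem (wordsOver_mem_CIRC l.V) hQ hQ.1
  intro h
  have hs : (Equiv.swap 1 2 : Equiv.Perm (Fin 3)) ^ 2 = 1 := by decide
  have hb : wordPerm l.b [l.b] = Equiv.swap 0 1 := by simp [wordPerm, letterPerm]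
  have hword : ∀ n, replicate (2 * n) l.a ++ [l.b, l.b] ++ replicate (2 * n) l.a ∈
      trivialPermWords l.V l.b := by
    refine fun n => ⟨append_mem_wordsOver.2 ⟨append_mem_wordsOver.2 ⟨l.replicate_a_mem _,
      l.replicate_b_mem 2⟩, l.replicate_a_mem _⟩, ?_⟩
    rw [wordPerm_append, wordPerm_append, wordPerm_replicate l.hab,
      show [l.b, l.b] = [l.b] ++ [l.b] from rfl, wordPerm_append, hb, pow_mul, hs]
    simp
  obtain ⟨U, S, hS, y, z, hfreq, hcl⟩ := exists_context_of_framed_mem_EC l.hc le_rfl hQ.1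
    (h hmem) _ hword (fun n => by simp; omega)
  obtain ⟨n, hn, x, -, hxS, e⟩ := hfreq (y.length + z.length + 1)
  obtain ⟨hy, hz, hx⟩ := replicate_core_split e (by omega) (by omega)
  -- The right block keeps at least one letter a, namely the one to be moved.
  obtain ⟨q, hq⟩ : ∃ q, 2 * n - z.length = q + 1 := ⟨2 * n - z.length - 1, by omega⟩
  obtain ⟨p, hp⟩ : ∃ p, 2 * n - y.length = p := ⟨_, rfl⟩
  rw [hq, hp] at hx
  have hperm : x.Perm (replicate p l.a ++ [l.b, l.a, l.b] ++ replicate q l.a) := by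
    rw [hx, List.append_assoc, List.append_assoc, List.replicate_succ]
    exact List.Perm.append_left _ ((List.Perm.swap _ _ _).cons _)
  have h1 := hcl _ (append_mem_wordsOver.2 ⟨append_mem_wordsOver.2 ⟨l.replicate_a_mem p,
    cons_mem_wordsOver.2 ⟨l.hb, cons_mem_wordsOver.2 ⟨l.ha, l.singleton_b_mem⟩⟩⟩,
    l.replicate_a_mem q⟩) (hS.2.2 _ _ hperm hxS)
  have h2 := h1.2
  rw [show [l.b, l.a, l.b] = [l.b] ++ replicate 1 l.a ++ [l.b] from rfl, hy, hz] at h2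
  simp only [wordPerm_append, wordPerm_replicate l.hab, hb] at h2
  have hleft : (Equiv.swap 1 2 : Equiv.Perm (Fin 3)) ^ y.length * Equiv.swap 1 2 ^ p = 1 := by
    rw [← pow_add, show y.length + p = 2 * n by omega, pow_mul, hs, one_pow]
  have hright : (Equiv.swap 1 2 : Equiv.Perm (Fin 3)) ^ q * Equiv.swap 1 2 ^ z.length =
      Equiv.swap 1 2 := by
    have : q + z.length = 2 * (n - 1) + 1 := by omega
    rw [← pow_add, this, pow_succ, pow_mul, hs, one_pow, one_mul]
  have h3 : (Equiv.swap 1 2 : Equiv.Perm (Fin 3)) ^ y.length * Equiv.swap 1 2 ^ p *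
      (Equiv.swap 0 1 * Equiv.swap 1 2 ^ 1 * Equiv.swap 0 1) *
      (Equiv.swap 1 2 ^ q * Equiv.swap 1 2 ^ z.length) = 1 := by
    rw [← h2]
    group
  rw [hleft, hright] at h3
  revert h3
  decide

open Classical in
/-- An ordered automaton for the words with at most one occurrence of `b`. -/
noncomputable def countAutomaton (b : T) : DFA T (Fin 3) where
  step z x := if x = b then (if z = 0 then 1 else 2) else z
  start := 0
  accept := {0, 1}

open Classical in
theorem mem_accepts_countAutomaton (b : T) (w : List T) :
    w ∈ (countAutomaton b).accepts ↔ w.count b ≤ 1 := by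
  have key : (countAutomaton b).eval w =
      if w.count b = 0 then 0 else if w.count b = 1 then 1 else 2 := by
    induction w using List.reverseRecOn with
    | nil => rfl
    | append_singleton w x ih =>
      rw [DFA.eval_append_singleton, ih, List.count_append]
      by_cases hx : x = b
      · subst hx
        by_cases h0 : w.count x = 0
        · simp [countAutomaton, h0]
        · by_cases h1 : w.count x = 1
          · simp [countAutomaton, h1]
          · simp [countAutomaton, h0, h1]
      · simp [countAutomaton, hx]
  rw [DFA.mem_accepts, key]
  split_ifs with h0 h1
  · exact iff_of_true (Or.inl rfl) (by omega)
  · exact iff_of_true (Or.inr rfl) (by omega)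
  · exact iff_of_false (by simp [countAutomaton]) (by omega)

theorem countAutomaton_mem_ORD (V : Finset T) (b : T) :
    acceptsOver V (countAutomaton b) ∈ ORD T V := by
  refine ⟨fun w hw => hw.1, Fin 3, inferInstance, inferInstance, countAutomaton b, ?_,
    fun w => Iff.rfl⟩
  intro x _ z z'
  by_cases hx : x = b <;> simp only [countAutomaton, hx, ↓reduceIte] <;> revert z z' <;> decide

theorem wordsOver_mem_ORD (U : Finset T) : wordsOver U ∈ ORD T U := by
  refine ⟨le_rfl, Fin 1, inferInstance, inferInstance, ⟨fun z _ => z, 0, Set.univ⟩,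
    fun _ _ _ _ h => h, fun w => ?_⟩
  exact ⟨fun hw => ⟨hw, Set.mem_univ _⟩, fun hw => hw.1⟩

/-- An ordered automaton counts up to one occurrence of b at arbitrary distance, whereas any window
length k overlooks a second b that is far enough away. -/
theorem not_EC_ORD_subset_EC_SLT [Infinite T] : ¬ EC (ORD T) ⊆ EC (SLT T) := by
  classical
  obtain ⟨l⟩ := nonempty_letters T
  have hQ := countAutomaton_mem_ORD l.V l.b
  have hmem := l.framed_wordsOver_mem (wordsOver_mem_ORD l.V) hQ hQ.1
  intro h
  obtain ⟨U, S, hS, y, z, hfreq, hcl⟩ := exists_context_of_framed_mem_EC l.hc le_rfl hQ.1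
    (h hmem) (fun n => replicate n l.a ++ [l.b] ++ replicate n l.a) (fun n => by
      refine ⟨append_mem_wordsOver.2 ⟨append_mem_wordsOver.2 ⟨l.replicate_a_mem n,
        l.singleton_b_mem⟩, l.replicate_a_mem n⟩, ?_⟩
      rw [mem_accepts_countAutomaton]
      simp [List.count_replicate, l.hab]) (fun n => by simp)
  obtain ⟨k, hk, hSk⟩ := hS.2
  obtain ⟨n, hn, x, -, hxS, e⟩ := hfreq (y.length + z.length + k + 1)
  obtain ⟨-, -, hx⟩ := replicate_core_split e (by omega) (by omega)
  rw [List.append_assoc, List.singleton_append] at hx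
  subst hx
  have hU := hS.1 hxS
  have ha : l.a ∈ U := hU l.a (by simp; omega)
  have hb : l.b ∈ U := hU l.b (by simp)
  have htwo := hSk.two_blocks_mem ha hb (p := k) (m := k) (q := k) (by omega) (by omega) le_rfl
    le_rfl (by omega) hxS
  have h1 := (hcl _ (append_mem_wordsOver.2 ⟨l.replicate_a_mem k, cons_mem_wordsOver.2 ⟨l.hb,
    append_mem_wordsOver.2 ⟨l.replicate_a_mem k, cons_mem_wordsOver.2
      ⟨l.hb, l.replicate_a_mem k⟩⟩⟩⟩) htwo).2
  rw [mem_accepts_countAutomaton] at h1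
  simp [List.count_replicate, l.hab] at h1
  omega

/-! ### Selection by the first letter -/

/-- The words `a b^n`. -/
def Letters.aPowB (l : Letters T) : Language T := {w | ∃ n, w = l.a :: replicate n l.b}

/-- The words `a b^n` and `b a b^n`. -/
def Letters.baPowB (l : Letters T) : Language T :=
  {w | ∃ n, w = l.a :: replicate n l.b ∨ w = l.b :: l.a :: replicate n l.b}

theorem Letters.baPowB_le (l : Letters T) : l.baPowB ≤ wordsOver l.V := by
  rintro w ⟨n, rfl | rfl⟩
  · exact cons_mem_wordsOver.2 ⟨l.ha, l.replicate_b_mem n⟩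
  · exact cons_mem_wordsOver.2 ⟨l.hb, cons_mem_wordsOver.2 ⟨l.ha, l.replicate_b_mem n⟩⟩

/-- The words over `V` that begin with the letter `a`. -/
def beginningWith (V : Finset T) (a : T) : Language T := {w | w ∈ wordsOver V ∧ w.take 1 = [a]}

theorem beginningWith_mem_SLTk_one {V : Finset T} {a : T} (ha : a ∈ V) :
    beginningWith V a ∈ SLTk T 1 V := by
  obtain ⟨-, B, I, E, -, hI, hE, h⟩ := wordsOver_mem_SLTk_one V
  refine ⟨fun w hw => hw.1, {[a]}, I, E, ?_, hI, hE, fun w hw hl => ?_⟩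
  · rintro w rfl
    exact ⟨cons_mem_wordsOver.2 ⟨ha, nil_mem_wordsOver V⟩, rfl⟩
  · have := (h w hw hl).1 hw
    exact ⟨fun h => ⟨h.2, this.2⟩, fun h => ⟨hw, h.1⟩⟩

/-- A definite language does not see the beginning of a long word: if it picks abʲ, it also picks
babʲ. Since abⁿ = yxz with x = abʲ forces y to be empty, the derived word starts with b and is not
in Q. -/
theorem not_EC_SLTk_one_subset_EC_DEF [Infinite T] : ¬ EC (SLTk T 1) ⊆ EC (DEF T) := by
  obtain ⟨l⟩ := nonempty_letters T
  have hQR : ∀ w ∈ l.aPowB, w ∈ l.baPowB := fun w ⟨n, h⟩ => ⟨n, Or.inl h⟩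
  have hmem : framed l.c l.baPowB l.aPowB ∈ EC (SLTk T 1) := by
    have hV := wordsOver_mem_SLTk_one l.V
    have hS := beginningWith_mem_SLTk_one l.ha
    refine framed_mem_EC l.hc l.baPowB_le {[l.a], [l.b, l.a]} (Set.toFinite _) ?_
      [(wordsOver l.V, [], [l.b])] ?_ ?_ ?_ _ hS hS.1 hQR ?_
    · rintro w (rfl | rfl)
      · exact ⟨0, Or.inl rfl⟩
      · exact ⟨0, Or.inr rfl⟩
    · simpa using ⟨hV, nil_mem_wordsOver _, l.singleton_b_mem⟩
    · simp only [List.mem_singleton, forall_eq]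
      rintro x ⟨n, rfl | rfl⟩ -
      · exact ⟨n + 1, Or.inl (by simp [List.replicate_succ'])⟩
      · exact ⟨n + 1, Or.inr (by simp [List.replicate_succ'])⟩
    · rintro w ⟨n, hw⟩
      rcases n with _ | n
      · exact Or.inl (hw.imp id id)
      · right
        rcases hw with rfl | rfl
        · exact ⟨_, List.mem_singleton_self _, l.a :: replicate n l.b, ⟨n, Or.inl rfl⟩,
            l.baPowB_le ⟨n, Or.inl rfl⟩, by simp [List.replicate_succ'], by simp⟩
        · exact ⟨_, List.mem_singleton_self _, l.b :: l.a :: replicate n l.b, ⟨n, Or.inr rfl⟩,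
            l.baPowB_le ⟨n, Or.inr rfl⟩, by simp [List.replicate_succ'], by simp⟩
    · rintro w ⟨n, rfl | rfl⟩
      · exact iff_of_true ⟨l.baPowB_le ⟨n, Or.inl rfl⟩, rfl⟩ ⟨n, rfl⟩
      · refine iff_of_false (fun h => ?_) ?_
        · exact l.hba (List.singleton_injective h.2)
        · rintro ⟨m, hm⟩
          exact l.hba (List.cons.inj hm).1
  intro h
  obtain ⟨U, S, hS, y, z, hfreq, hcl⟩ := exists_context_of_framed_mem_EC l.hc l.baPowB_le hQR
    (h hmem) (fun n => l.a :: replicate n l.b) (fun n => ⟨n, rfl⟩) (fun n => by simp)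
  obtain ⟨A, B, hA, hB, hw⟩ := hS.2
  -- A word longer than M is not in the finite part A, so it belongs to V*B and stays there under
  -- prepending letters.
  obtain ⟨M, hM⟩ := ((A.finite_toSet.union B.finite_toSet).image List.length).bddAbove
  obtain ⟨n, hn, x, ⟨j, hx⟩, hxS, e⟩ := hfreq (y.length + z.length + M + 1)
  have hlen := congrArg List.length e
  have hnb := notMem_replicate l.hab n
  rcases hx with rfl | rfl
  · have hy := (List.append_cons_inj_of_notMem (x₁ := []) (a₁ := l.a) (x₂ := y)
      (z₂ := replicate j l.b ++ z) (by simp) hnb).1 (by simpa using e)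
    have hy0 := hy.1.symm
    subst hy0
    simp only [List.length_cons, List.length_append, List.length_replicate, List.length_nil] at hlen hn
    have hbU : l.b ∈ U := hS.1 hxS l.b (by simp; omega)
    have hmem' : l.b :: l.a :: replicate j l.b ∈ S := by
      rcases (hw _).1 hxS with hxA | ⟨t, ht, β, hβ, ht'⟩
      · have := hM ⟨_, Or.inl hxA, rfl⟩
        simp at this
        omega
      · exact (hw _).2 (Or.inr ⟨l.b :: t, cons_mem_wordsOver.2 ⟨hbU, ht⟩, β, hβ, by
          rw [ht']; rfl⟩)
    obtain ⟨m, hm⟩ := hcl _ ⟨j, Or.inr rfl⟩ hmem'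
    exact l.hba (List.cons.inj hm).1
  · have hy := (List.append_cons_inj_of_notMem (x₁ := []) (a₁ := l.a) (x₂ := y ++ [l.b])
      (z₂ := replicate j l.b ++ z) (by simp) hnb).1 (by simpa using e)
    simp at hy

end Separations

/-! ### Combinatorics of the diagram -/

section Diagram

/-- Reachability in the diagram, described explicitly. -/
def Entry.le : Entry → Entry → Prop
  | .fin, _ => True
  | .mon, .fin => False
  | .mon, _ => True
  | .comb, .comb | .comb, .defi | .comb, .sltk _ | .comb, .slt | .comb, .ord | .comb, .nc
  | .comb, .ps | .comb, .reg => True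
  | .comb, _ => False
  | .nil, .nil | .nil, .defi | .nil, .comm | .nil, .circ | .nil, .slt | .nil, .ord | .nil, .nc
  | .nil, .ps | .nil, .reg => True
  | .nil, _ => False
  | .suf, .suf | .suf, .ps | .suf, .reg => True
  | .suf, _ => False
  | .defi, .defi | .defi, .slt | .defi, .ord | .defi, .nc | .defi, .ps | .defi, .reg => True
  | .defi, _ => False
  | .comm, .comm | .comm, .circ | .comm, .reg => True
  | .comm, _ => False
  | .circ, .circ | .circ, .reg => True
  | .circ, _ => False
  | .sltk j, .sltk k => j ≤ k
  | .sltk k, .ord => k = 1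
  | .sltk _, .slt | .sltk _, .nc | .sltk _, .ps | .sltk _, .reg => True
  | .sltk _, _ => False
  | .slt, .slt | .slt, .nc | .slt, .ps | .slt, .reg => True
  | .slt, _ => False
  | .ord, .ord | .ord, .nc | .ord, .ps | .ord, .reg => True
  | .ord, _ => False
  | .nc, .nc | .nc, .ps | .nc, .reg => True
  | .nc, _ => False
  | .ps, .ps | .ps, .reg => True
  | .ps, _ => False
  | .reg, .reg => True
  | .reg, _ => False

theorem hasPath_step {X Y Z : Entry} (h : SolidArrow X Y) (hp : HasPath Y Z) : HasPath X Z :=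
  .head (Or.inl h) hp

theorem hasPath_reg {Y : Entry} (h : Entry.le .reg Y) : HasPath .reg Y := by
  cases Y <;> first | exact h.elim | exact .refl

theorem hasPath_ps {Y : Entry} (h : Entry.le .ps Y) : HasPath .ps Y := by
  cases Y <;> first | exact h.elim | exact .refl | exact hasPath_step .ps_reg (hasPath_reg trivial)

theorem hasPath_suf {Y : Entry} (h : Entry.le .suf Y) : HasPath .suf Y := by
  cases Y <;> first | exact h.elim | exact .refl | exact hasPath_step .suf_ps (hasPath_ps trivial)

theorem hasPath_circ {Y : Entry} (h : Entry.le .circ Y) : HasPath .circ Y := by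
  cases Y <;> first | exact h.elim | exact .refl |
    exact hasPath_step .circ_reg (hasPath_reg trivial)

theorem hasPath_comm {Y : Entry} (h : Entry.le .comm Y) : HasPath .comm Y := by
  cases Y <;> first | exact h.elim | exact .refl |
    exact hasPath_step .comm_circ (hasPath_circ trivial)

theorem hasPath_nc {Y : Entry} (h : Entry.le .nc Y) : HasPath .nc Y := by
  cases Y <;> first | exact h.elim | exact .refl | exact hasPath_step .nc_ps (hasPath_ps trivial)

theorem hasPath_ord {Y : Entry} (h : Entry.le .ord Y) : HasPath .ord Y := by
  cases Y <;> first | exact h.elim | exact .refl |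
    exact .head (Or.inr ⟨rfl, rfl⟩) (hasPath_nc trivial)

theorem hasPath_slt {Y : Entry} (h : Entry.le .slt Y) : HasPath .slt Y := by
  cases Y <;> first | exact h.elim | exact .refl | exact hasPath_step .slt_nc (hasPath_nc trivial)

theorem hasPath_sltk_sltk (j k : ℕ+) (h : j ≤ k) : HasPath (.sltk j) (.sltk k) := by
  induction k using PNat.recOn with
  | one => rw [le_antisymm h one_le]; exact .refl
  | succ k ih =>
    rcases h.lt_or_eq with h | rfl
    · exact (ih (PNat.lt_add_one_iff.1 h)).tail (Or.inl (.sltk_succ k))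
    · exact .refl

theorem hasPath_sltk {k : ℕ+} {Y : Entry} (h : Entry.le (.sltk k) Y) : HasPath (.sltk k) Y := by
  cases Y with
  | sltk j => exact hasPath_sltk_sltk k j h
  | ord =>
    have hk : k = 1 := h
    subst hk
    exact hasPath_step .sltk_ord .refl
  | _ => first | exact h.elim | exact hasPath_step (.sltk_slt k) (hasPath_slt trivial)

theorem hasPath_defi {Y : Entry} (h : Entry.le .defi Y) : HasPath .defi Y := by
  cases Y <;> first | exact h.elim | exact .refl |
    exact hasPath_step .defi_ord (hasPath_ord trivial) |
    exact hasPath_step .defi_slt (hasPath_slt trivial)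

theorem hasPath_comb {Y : Entry} (h : Entry.le .comb Y) : HasPath .comb Y := by
  cases Y <;> first | exact h.elim | exact .refl |
    exact hasPath_step .comb_defi (hasPath_defi trivial) |
    exact hasPath_step .comb_sltk (hasPath_sltk_sltk _ _ one_le)

theorem hasPath_nil {Y : Entry} (h : Entry.le .nil Y) : HasPath .nil Y := by
  cases Y <;> first | exact h.elim | exact .refl |
    exact hasPath_step .nil_defi (hasPath_defi trivial) |
    exact hasPath_step .nil_comm (hasPath_comm trivial)

theorem hasPath_mon {Y : Entry} (h : Entry.le .mon Y) : HasPath .mon Y := by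
  cases Y <;> first | exact h.elim | exact .refl |
    exact hasPath_step .mon_comb (hasPath_comb trivial) |
    exact hasPath_step .mon_nil (hasPath_nil trivial) |
    exact hasPath_step .mon_suf (hasPath_suf trivial)

/-- Only this direction is needed: separations are transported along `Entry.le`, and absence of a
path excludes `Entry.le` by contraposition. -/
theorem hasPath_of_le {X Y : Entry} (h : X.le Y) : HasPath X Y := by
  cases X with
  | fin =>
    cases Y <;> first | exact .refl | exact hasPath_step .fin_mon (hasPath_mon trivial)
  | mon => exact hasPath_mon h
  | nil => exact hasPath_nil h
  | comb => exact hasPath_comb h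
  | defi => exact hasPath_defi h
  | suf => exact hasPath_suf h
  | ord => exact hasPath_ord h
  | comm => exact hasPath_comm h
  | circ => exact hasPath_circ h
  | nc => exact hasPath_nc h
  | ps => exact hasPath_ps h
  | reg => exact hasPath_reg h
  | slt => exact hasPath_slt h
  | sltk k => exact hasPath_sltk h

variable {T : Type*}

theorem EC_subset_of_solidArrow {X Y : Entry} (h : SolidArrow X Y) :
    EC (X.family T) ⊆ EC (Y.family T) := by
  cases h with
  | fin_mon => exact EC_FIN_subset _
  | mon_comb => exact EC_MON_subset_COMB
  | mon_nil => exact EC_MON_subset_NIL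
  | mon_suf => exact EC_MON_subset_SUF
  | nil_defi => exact EC_NIL_subset_DEF
  | nil_comm => exact EC_NIL_subset_COMM
  | comb_defi => exact EC_COMB_subset_DEF
  | comb_sltk => exact EC_COMB_subset_SLTk_one
  | sltk_succ k => exact EC_SLTk_subset_succ k
  | sltk_slt k => exact EC_SLTk_subset_SLT k k.2
  | sltk_ord => exact EC_SLTk_one_subset_ORD
  | defi_ord => exact EC_DEF_subset_ORD
  | defi_slt => exact EC_DEF_subset_SLT
  | slt_nc => exact EC_SLT_subset_NC
  | nc_ps => exact EC_NC_subset_PS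
  | suf_ps => exact EC_SUF_subset_PS
  | ps_reg => exact EC_PS_subset_REG
  | comm_circ => exact EC_COMM_subset_CIRC
  | circ_reg => exact EC_CIRC_subset_REG

theorem EC_subset_of_hasPath {X Y : Entry} (h : HasPath X Y) :
    EC (X.family T) ⊆ EC (Y.family T) := by
  induction h with
  | refl => exact subset_rfl
  | tail _ h ih =>
    rcases h with h | ⟨rfl, rfl⟩
    · exact ih.trans (EC_subset_of_solidArrow h)
    · exact ih.trans EC_ORD_subset_NC

theorem not_EC_subset_of_le {X₀ Y₀ X Y : Entry} (h : ¬ EC (X₀.family T) ⊆ EC (Y₀.family T))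
    (hX : X₀.le X) (hY : Y.le Y₀) : ¬ EC (X.family T) ⊆ EC (Y.family T) := fun h' =>
  h (((EC_subset_of_hasPath (hasPath_of_le hX)).trans h').trans
    (EC_subset_of_hasPath (hasPath_of_le hY)))

/-- Each missing comparison X ≤ Y lies above one of the basic separations X₀, Y₀, in the sense that
X₀ ≤ X and Y ≤ Y₀. The hypothesis `hex` removes the cases with Y = `ord` that the basic separations
do not settle. -/
theorem not_EC_subset_of_not_le [Infinite T] {X Y : Entry} (h : ¬ X.le Y)
    (hex : Y = .ord → X ≠ .slt ∧ X ≠ .nc ∧ ∀ k, X ≠ .sltk k) :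
    ¬ EC (X.family T) ⊆ EC (Y.family T) := by
  have mon_fin : ¬ EC (Entry.mon.family T) ⊆ EC (Entry.fin.family T) := not_EC_MON_subset_EC_FIN
  have comb_suf : ¬ EC (Entry.comb.family T) ⊆ EC (Entry.suf.family T) := not_EC_COMB_subset_EC_SUF
  have comb_circ : ¬ EC (Entry.comb.family T) ⊆ EC (Entry.circ.family T) :=
    not_EC_COMB_subset_EC_CIRC
  have nil_suf : ¬ EC (Entry.nil.family T) ⊆ EC (Entry.suf.family T) := not_EC_NIL_subset_EC_SUF
  have nil_sltk : ∀ k : ℕ+, ¬ EC (Entry.nil.family T) ⊆ EC ((Entry.sltk k).family T) := fun k =>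
    not_EC_NIL_subset_EC_SLTk k.2
  have suf_nc : ¬ EC (Entry.suf.family T) ⊆ EC (Entry.nc.family T) := not_EC_SUF_subset_EC_NC
  have suf_circ : ¬ EC (Entry.suf.family T) ⊆ EC (Entry.circ.family T) := not_EC_SUF_subset_EC_CIRC
  have comm_ps : ¬ EC (Entry.comm.family T) ⊆ EC (Entry.ps.family T) := not_EC_COMM_subset_EC_PS
  have circ_comm : ¬ EC (Entry.circ.family T) ⊆ EC (Entry.comm.family T) :=
    not_EC_CIRC_subset_EC_COMM
  have slt1_defi : ¬ EC ((Entry.sltk 1).family T) ⊆ EC (Entry.defi.family T) :=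
    not_EC_SLTk_one_subset_EC_DEF
  have sltk_sltk : ∀ k : ℕ+, ¬ EC ((Entry.sltk (k + 1)).family T) ⊆ EC ((Entry.sltk k).family T) :=
    fun k => not_EC_SLTk_succ_subset_EC_SLTk k.2
  have ord_slt : ¬ EC (Entry.ord.family T) ⊆ EC (Entry.slt.family T) := not_EC_ORD_subset_EC_SLT
  cases X with
  | sltk k =>
    cases Y with
    | sltk j =>
      have hjk : j + 1 ≤ k := PNat.add_one_le_iff.2 (not_le.1 h)
      exact not_EC_subset_of_le (sltk_sltk j) hjk le_rfl
    | ord => exact absurd rfl ((hex rfl).2.2 k)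
    | _ =>
      first
        | exact absurd trivial h
        | exact not_EC_subset_of_le comb_suf trivial trivial
        | exact not_EC_subset_of_le comb_circ trivial trivial
        | exact not_EC_subset_of_le slt1_defi one_le trivial
  | slt =>
    cases Y with
    | sltk j => exact not_EC_subset_of_le (sltk_sltk j) trivial le_rfl
    | ord => exact absurd rfl (hex rfl).1
    | _ =>
      first
        | exact absurd trivial h
        | exact not_EC_subset_of_le comb_suf trivial trivial
        | exact not_EC_subset_of_le comb_circ trivial trivial
        | exact not_EC_subset_of_le slt1_defi trivial trivial
  | _ =>
    cases Y with
    | sltk j =>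
      first
        | exact absurd trivial h
        | exact not_EC_subset_of_le (nil_sltk j) trivial le_rfl
        | exact not_EC_subset_of_le suf_nc trivial trivial
    | _ =>
      -- An alternative fails as soon as one of its comparisons unfolds to `False`, so the search
      -- stops at a separation that fits.
      first
        | exact absurd trivial h
        | exact absurd rfl (hex rfl).2.1
        | exact not_EC_subset_of_le mon_fin trivial trivial
        | exact not_EC_subset_of_le comb_suf trivial trivial
        | exact not_EC_subset_of_le comb_circ trivial trivial
        | exact not_EC_subset_of_le nil_suf trivial trivial
        | exact not_EC_subset_of_le (nil_sltk 1) trivial trivial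
        | exact not_EC_subset_of_le suf_nc trivial trivial
        | exact not_EC_subset_of_le suf_circ trivial trivial
        | exact not_EC_subset_of_le comm_ps trivial trivial
        | exact not_EC_subset_of_le circ_comm trivial trivial
        | exact not_EC_subset_of_le ord_slt trivial trivial

/-- Properness reverses the arrow. Since no solid arrow starts at `ord`, the unsettled cases never
arise there. -/
theorem not_le_of_solidArrow {X Y : Entry} (h : SolidArrow X Y) : ¬ Y.le X ∧ X ≠ .ord := by
  cases h with
  | sltk_succ k =>
    exact ⟨fun h => absurd (PNat.add_one_le_iff.1 (show k + 1 ≤ k from h)) (lt_irrefl k), by simp⟩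
  | _ => exact ⟨fun h => h, by simp⟩

theorem not_EC_subset_of_not_hasPath [Infinite T] {X Y : Entry} (hXY : ¬ HasPath X Y)
    (hYX : ¬ HasPath Y X) (hex : ¬ Exceptional Y X) : ¬ EC (X.family T) ⊆ EC (Y.family T) := by
  refine not_EC_subset_of_not_le (fun h => hXY (hasPath_of_le h)) ?_
  rintro rfl
  refine ⟨?_, ?_, ?_⟩
  · rintro rfl
    exact hex ⟨rfl, Or.inl rfl⟩
  -- The entry `nc` is reached from `ord` by the dashed arrow, and `sltk 1` has a solid arrow to
  -- `ord`; the other `sltk k` and `slt` are exceptional.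
  · rintro rfl
    exact hYX (hasPath_of_le trivial)
  · rintro k rfl
    rcases eq_or_ne k 1 with rfl | hk
    · exact hXY (hasPath_of_le rfl)
    · have h2 : 1 + 1 ≤ k := PNat.add_one_le_iff.2 (lt_of_le_of_ne one_le hk.symm)
      exact hex ⟨rfl, Or.inr ⟨k, h2, rfl⟩⟩

end Diagram

end ExtCG

theorem mainTheorem2 (T : Type*) [Infinite T] :
    -- each solid arrow is a proper inclusion
    (∀ X Y : ExtCG.Entry, ExtCG.SolidArrow X Y →
      ExtCG.EC (X.family T) ⊂ ExtCG.EC (Y.family T)) ∧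
    -- the dashed arrow is an inclusion
    ExtCG.EC (ExtCG.ORD T) ⊆ ExtCG.EC (ExtCG.NC T) ∧
    -- the two families of the top entry agree
    ExtCG.EC (ExtCG.REG T) = ExtCG.EC (ExtCG.UF T) ∧
    -- entries that are not connected by a directed path are incomparable, up to the exceptions
    (∀ X Y : ExtCG.Entry, ¬ ExtCG.HasPath X Y → ¬ ExtCG.HasPath Y X →
      ¬ ExtCG.Exceptional X Y → ¬ ExtCG.Exceptional Y X →
      ¬ ExtCG.EC (X.family T) ⊆ ExtCG.EC (Y.family T) ∧
      ¬ ExtCG.EC (Y.family T) ⊆ ExtCG.EC (X.family T)) ∧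
    -- the exceptional pairs
    ¬ ExtCG.EC (ExtCG.ORD T) ⊆ ExtCG.EC (ExtCG.SLT T) ∧
    (∀ k : ℕ, 2 ≤ k → ¬ ExtCG.EC (ExtCG.ORD T) ⊆ ExtCG.EC (ExtCG.SLTk T k)) := by
  refine ⟨fun X Y h => ⟨ExtCG.EC_subset_of_solidArrow h, ?_⟩, ExtCG.EC_ORD_subset_NC,
    ExtCG.EC_REG_eq_EC_UF, fun X Y hXY hYX hex hex' =>
      ⟨ExtCG.not_EC_subset_of_not_hasPath hXY hYX hex',
        ExtCG.not_EC_subset_of_not_hasPath hYX hXY hex⟩,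
    ExtCG.not_EC_ORD_subset_EC_SLT, fun k hk h => ?_⟩
  · have := ExtCG.not_le_of_solidArrow h
    exact ExtCG.not_EC_subset_of_not_le this.1 fun hX => absurd hX this.2
  · exact ExtCG.not_EC_ORD_subset_EC_SLT
      (h.trans (ExtCG.EC_SLTk_subset_SLT k (by omega)))
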